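/- Let $m\ge 1$ and let $(\vec\beta_p)_{p\ge 2}$ be vectors in $\mathbb R^m$ with $\vec\beta_p=0$ for odd $p$ and $\sum_{p\ge2}2^p\vec\beta_p(j)^2<\infty$ for each $j$. For an $m\times m$ matrix $A$ with entries in $[-1,1]$ put $\xi(A)=\sum_{p\ge 2}(\vec\beta_p\otimes\vec\beta_p)\odot A^{\circ p}$, where $\odot$ and $^{\circ p}$ are the entrywise product and power, and let $\xi',\xi'',\xi'''$ be its entrywise derivatives. Let $\vec h\in\mathbb R^m$, let $Q$ be a positive semidefinite $m\times m$ matrix with unit diagonal, and let $\langle A,B\rangle=\sum_{i,j}A_{ij}B_{ij}$. Consider pairs $(x,\Phi)$ of the following kind. The function $x:[0,m]\to[0,1]$ is nondecreasing and right-continuous with $x(0)=0$ and $x(m)=1$; let $\mu$ be the probability measure on $[0,m]$ with $\mu([0,t])=x(t)$. The path $\Phi$ on $[0,m]$ takes positive semidefinite $m\times m$ matrices as values, is nondecreasing in the positive semidefinite order, is continuously differentiable with Lipschitz derivative, and satisfies $\Phi(0)=0$, $\Phi(m)=Q$ and $\mathrm{Trace}\,\Phi(t)=t$ for all $t\in\mathrm{supp}\,\mu$.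 With $t_x=\inf\{t\in[0,m]:x(t)=1\}$, one requires $t_x<m$ and $\det(Q-\Phi(t_x))>0$. For such a pair put $\hat\Phi(t)=\int_t^m x(s)\Phi'(s)\,ds$ and $$\mathscr C(x,\Phi)=\frac12\left[\int_0^m x(t)\big\langle \xi'(\Phi(t))+\vec h\vec h^T,\Phi'(t)\big\rangle dt+\log\det\big(\Phi(m)-\Phi(\hat T)\big)+\int_0^{\hat T}\big\langle\hat\Phi(t)^{-1},\Phi'(t)\big\rangle dt\right],$$ where $\hat T\in(t_x,m)$ is any point with $\det(\Phi(m)-\Phi(\hat T))>0$ (the value does not depend on it). Let $(x,\Phi)$ minimize $\mathscr C$ among all these pairs, and let $\mu_P$ be the measure with $\mu_P([0,t])=x(t)$. If $0\le a<b<m$ and $(a,b)\subseteq\mathrm{supp}\,\mu_P$, then for all $u\in(a,b)$ the trace below is positive and $$\mu_P([0,u])=\frac{\langle\xi'''(\Phi(u)),\Phi'(u)^{\circ3}\rangle}{2\,\mathrm{Trace}\left(\Big(\Phi'(u)^{1/2}\big(\xi''(\Phi(u))\odot\Phi'(u)\big)\Phi'(u)^{1/2}\Big)^{3/2}\right)}.$$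 -/

import Mathlib

open MeasureTheory Set
open scoped Matrix

noncomputable section

namespace VectorSpin

variable {m : ℕ}

/-- Standing assumptions on the inverse temperatures `β p = (β_p(1), …, β_p(m))`, `p ≥ 2`, of a
mixed even `p`-spin model: only even `p ≥ 2` occur and `∑ 2^p β_p(j)^2 < ∞` for every copy `j`. -/
structure IsMixedEven (β : ℕ → Fin m → ℝ) : Prop where
  eq_zero_of_lt : ∀ p, p < 2 → β p = 0
  eq_zero_of_odd : ∀ p, Odd p → β p = 0
  summable : ∀ j, Summable fun p => (2 : ℝ) ^ p * β p j ^ 2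

/-- The `r`-th derivative of `ξ(A) = ∑_p (β_p ⊗ β_p) ⊙ A^{∘p}`, taken entry by entry:
`∑_p p (p-1) ⋯ (p-r+1) (β_p ⊗ β_p) ⊙ A^{∘(p-r)}`.
The coefficient `p.descFactorial r` vanishes for `p < r`. -/
def xiDeriv (β : ℕ → Fin m → ℝ) (r : ℕ) (A : Matrix (Fin m) (Fin m) ℝ) :
    Matrix (Fin m) (Fin m) ℝ :=
  Matrix.of fun i j => ∑' p : ℕ, (p.descFactorial r : ℝ) * (β p i * β p j) * A i j ^ (p - r)

/-- The Frobenius inner product of two matrices. -/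
def frob (A B : Matrix (Fin m) (Fin m) ℝ) : ℝ := ∑ i, ∑ j, A i j * B i j

/-- The constraints `Q`: positive semidefinite matrices with entries in `[-1,1]` and unit
diagonal. -/
structure IsConstraint (Q : Matrix (Fin m) (Fin m) ℝ) : Prop where
  posSemidef : Q.PosSemidef
  entries : ∀ i j, Q i j ∈ Icc (-1 : ℝ) 1
  diag : ∀ i, Q i i = 1

/-- The distribution function `x(t) = μ([0,t])`. -/
def orderParam (μ : Measure ℝ) (t : ℝ) : ℝ := μ.real (Icc 0 t)

/-- The measure `μ` on `[0,m]` belongs to a nondecreasing right-continuous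
`x : [0,m] → [0,1]` with `x(0) = 0` and `x(m) = 1` through `x(t) = μ([0,t])`. -/
structure IsOrderMeasure (m : ℕ) (μ : Measure ℝ) : Prop where
  isProbabilityMeasure : IsProbabilityMeasure μ
  compl_eq_zero : μ (Icc (0 : ℝ) m)ᶜ = 0
  orderParam_zero : orderParam μ 0 = 0

/-- `t_x = inf {t ∈ [0,m] | x(t) = 1}`. -/
def topPoint (m : ℕ) (μ : Measure ℝ) : ℝ := sInf {t | t ∈ Icc (0 : ℝ) m ∧ orderParam μ t = 1}

/-- The derivative `Φ'(t)` of a matrix path on `[0,m]`, taken entry by entry (one-sided at the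
endpoints). -/
def pathDeriv (Φ : ℝ → Matrix (Fin m) (Fin m) ℝ) (t : ℝ) : Matrix (Fin m) (Fin m) ℝ :=
  Matrix.of fun i j => derivWithin (fun s => Φ s i j) (Icc (0 : ℝ) m) t

/-- The matrix paths: continuously differentiable monotone paths of positive semidefinite
matrices from `0` to `Q` on `[0,m]` with Lipschitz derivative (hence Lipschitz themselves), and with
`Trace Φ(t) = t` for every `t` in the support of `μ`. -/
structure IsPath (Q : Matrix (Fin m) (Fin m) ℝ) (μ : Measure ℝ)
    (Φ : ℝ → Matrix (Fin m) (Fin m) ℝ) : Prop where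
  posSemidef : ∀ t ∈ Icc (0 : ℝ) m, (Φ t).PosSemidef
  monotone : ∀ s ∈ Icc (0 : ℝ) m, ∀ t ∈ Icc (0 : ℝ) m, s ≤ t → (Φ t - Φ s).PosSemidef
  zero : Φ 0 = 0
  top : Φ m = Q
  differentiable : ∀ i j, DifferentiableOn ℝ (fun t => Φ t i j) (Icc (0 : ℝ) m)
  lipschitz_deriv : ∃ K, ∀ i j, LipschitzOnWith K (fun t => pathDeriv Φ t i j) (Icc (0 : ℝ) m)
  trace_eq : ∀ t ∈ μ.support, (Φ t).trace = t

/-- `Φ̂(t) = ∫_t^m x(s) Φ'(s) ds`. -/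
def hatPath (μ : Measure ℝ) (Φ : ℝ → Matrix (Fin m) (Fin m) ℝ) (t : ℝ) :
    Matrix (Fin m) (Fin m) ℝ :=
  Matrix.of fun i j => ∫ s in t..(m : ℝ), orderParam μ s * pathDeriv Φ s i j

/-- The Crisanti–Sommers functional `𝒞(x,Φ)`, written with the cut-off point `T`. -/
def csFunctional (β : ℕ → Fin m → ℝ) (h : Fin m → ℝ) (μ : Measure ℝ)
    (Φ : ℝ → Matrix (Fin m) (Fin m) ℝ) (T : ℝ) : ℝ :=
  (1 / 2) *
    ((∫ t in (0 : ℝ)..(m : ℝ),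
        orderParam μ t * frob (xiDeriv β 1 (Φ t) + Matrix.vecMulVec h h) (pathDeriv Φ t))
      + Real.log (Φ m - Φ T).det
      + ∫ t in (0 : ℝ)..T, frob (hatPath μ Φ t)⁻¹ (pathDeriv Φ t))

/-- The pairs `(x,Φ)` over which the functional is minimized. -/
structure IsAdmissible (Q : Matrix (Fin m) (Fin m) ℝ) (μ : Measure ℝ)
    (Φ : ℝ → Matrix (Fin m) (Fin m) ℝ) : Prop where
  isOrderMeasure : IsOrderMeasure m μ
  isPath : IsPath Q μ Φ
  topPoint_lt : topPoint m μ < m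
  det_pos : 0 < (Q - Φ (topPoint m μ)).det

/-- The cut-off points: those `T` with `t_x < T < m` for which `Φ(m) - Φ(T)` is nonsingular, so that
the logarithm in the functional is finite. The value of the functional is the same for all of
them. -/
def cutoffs (μ : Measure ℝ) (Φ : ℝ → Matrix (Fin m) (Fin m) ℝ) : Set ℝ :=
  {T | topPoint m μ < T ∧ T < m ∧ 0 < (Φ m - Φ T).det}

/-- `(x,Φ)`, with `x(t) = μ([0,t])`, is a minimizer of the Crisanti–Sommers functional. -/
def IsMinimizer (β : ℕ → Fin m → ℝ) (h : Fin m → ℝ) (Q : Matrix (Fin m) (Fin m) ℝ)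
    (μ : Measure ℝ) (Φ : ℝ → Matrix (Fin m) (Fin m) ℝ) : Prop :=
  IsAdmissible Q μ Φ ∧
    ∀ (ν : Measure ℝ) (Ψ : ℝ → Matrix (Fin m) (Fin m) ℝ), IsAdmissible Q ν Ψ →
      ∀ T ∈ cutoffs μ Φ, ∀ S ∈ cutoffs ν Ψ,
        csFunctional β h μ Φ T ≤ csFunctional β h ν Ψ S

/-- The power `A^r` of a positive semidefinite matrix, by functional calculus. -/
def psdPow (A : Matrix (Fin m) (Fin m) ℝ) (r : ℝ) : Matrix (Fin m) (Fin m) ℝ :=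
  cfc (fun y : ℝ => y ^ r) A

/-- `(D^{1/2} (ξ''(A) ⊙ D) D^{1/2})^{3/2}`. -/
def threeHalves (β : ℕ → Fin m → ℝ) (A D : Matrix (Fin m) (Fin m) ℝ) :
    Matrix (Fin m) (Fin m) ℝ :=
  psdPow (psdPow D (1 / 2) * (xiDeriv β 2 A ⊙ D) * psdPow D (1 / 2)) (3 / 2)

end VectorSpin

end

/-!
Write `D = Φ'`, `P = Φ̂⁻¹`, `x(t) = μ([0,t])` and `G(t) = ξ'(Φ(t)) + h hᵀ - ∫₀ᵗ P D P`. Up to a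
factor, the first variation of the Crisanti–Sommers functional in a direction `Ψ` is
`-∫ ⟨G, Ψ⟩ dμ`. The trace condition does not constrain `Ψ`: the functional is invariant under a
change of time, so a path that violates the condition can be reparametrized by its trace. A
minimizer can therefore be compared with `Φ + ε Φ̂ G Φ̂`: as `(Φ̂ G Φ̂)'` contains the term `-D`
from `G'`, this path is, up to a correction of order `ε²`, still increasing for small `ε > 0`;
it jumps to its prescribed values at the two ends, and the jumps are removed by mollification.
So `-∫ ⟨G, Φ̂ G Φ̂⟩ dμ ≥ 0`, although the pairing is nonnegative; hence `G = 0` on the support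
of `μ`.

In the interior of the support, differentiating `G = 0` gives `ξ''(Φ) ⊙ D = P D P`.
Differentiating this once more and pairing with `D`, so that the possible nondifferentiability
of `D` drops out, gives `⟨ξ'''(Φ), D^{∘3}⟩ = 2 x Tr(P D P D P D)`, and the last trace is that
of the `3/2`-th power of `D^{1/2} P D P D^{1/2} = (D^{1/2} P D^{1/2})²`.
-/

namespace VectorSpin

/-! ### Quadratic forms and the covariance `ξ` -/

section QuadraticForms

variable {n : Type*} {A B : Matrix n n ℝ}

theorem symm_apply (hA : A.IsHermitian) (i j : n) : A i j = A j i :=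
  (Matrix.isHermitian_iff_isSymm.1 hA).apply j i

theorem transpose_eq (hA : A.IsHermitian) : Aᵀ = A := Matrix.isHermitian_iff_isSymm.1 hA

theorem posSemidef_map_pow [Finite n] (hA : A.PosSemidef) (k : ℕ) :
    (A.map fun y => y ^ k).PosSemidef := by
  induction k with
  | zero =>
    have hone := Matrix.posSemidef_vecMulVec_self_star (R := ℝ) (fun _ : n => 1)
    convert! hone using 1
    ext i j; simp [Matrix.vecMulVec_apply]
  | succ k ih => convert! ih.hadamard hA using 1

variable [Fintype n]

theorem dotProduct_mulVec_eq_sum (A : Matrix n n ℝ) (v w : n → ℝ) :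
    v ⬝ᵥ A *ᵥ w = ∑ i, ∑ j, v i * w j * A i j := by
  simp only [dotProduct, Matrix.mulVec, Finset.mul_sum]
  exact Finset.sum_congr rfl fun i _ => Finset.sum_congr rfl fun j _ => by ring

theorem quad_nonneg (hA : A.PosSemidef) (v : n → ℝ) : 0 ≤ v ⬝ᵥ A *ᵥ v := by
  simpa using hA.dotProduct_mulVec_nonneg v

theorem posSemidef_of_quad_nonneg (hA : A.IsHermitian) (h : ∀ v : n → ℝ, 0 ≤ v ⬝ᵥ A *ᵥ v) :
    A.PosSemidef :=
  .of_dotProduct_mulVec_nonneg hA (by simpa using h)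

theorem quad_le_of_posSemidef_sub (h : (B - A).PosSemidef) (v : n → ℝ) :
    v ⬝ᵥ A *ᵥ v ≤ v ⬝ᵥ B *ᵥ v := by
  simpa [Matrix.sub_mulVec] using quad_nonneg h v

theorem posSemidef_sub_of_quad_le (hA : A.IsHermitian) (hB : B.IsHermitian)
    (h : ∀ v : n → ℝ, v ⬝ᵥ A *ᵥ v ≤ v ⬝ᵥ B *ᵥ v) : (B - A).PosSemidef :=
  posSemidef_of_quad_nonneg (hB.sub hA) fun v => by simpa [Matrix.sub_mulVec] using h v

end QuadraticForms

theorem apply_mem_Icc_of_diag_le_one {n : Type*} [Finite n] {A : Matrix n n ℝ}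
    (hA : A.PosSemidef) (hd : ∀ i, A i i ≤ 1) (i j : n) : A i j ∈ Icc (-1 : ℝ) 1 := by
  classical
  have := Fintype.ofFinite n
  have hquad : ∀ c : ℝ, 0 ≤ A i i + 2 * c * A i j + c ^ 2 * A j j := fun c => by
    have := quad_nonneg hA (Pi.single i 1 + c • Pi.single j 1)
    simp only [Matrix.mulVec_add, Matrix.mulVec_smul, add_dotProduct, dotProduct_add,
      smul_dotProduct, dotProduct_smul, Matrix.mulVec_single_one, single_one_dotProduct,
      Matrix.col_apply, smul_eq_mul, symm_apply hA.isHermitian j i] at this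
    linarith
  constructor <;> linarith [hd i, hd j, hquad 1, hquad (-1)]

section Covariance

variable {m : ℕ} {β : ℕ → Fin m → ℝ}

/-- Mixtures whose covariance `ξ` has, entry by entry, a radius of convergence larger than `1`, so
that `ξ` and all its derivatives make sense on matrices with entries in `[-1,1]`. Odd interactions
are allowed. -/
def IsMixed (β : ℕ → Fin m → ℝ) : Prop :=
  ∃ ρ : ℝ, 1 < ρ ∧ ∀ j, Summable fun p => ρ ^ p * β p j ^ 2

theorem IsMixedEven.isMixed (hβ : IsMixedEven β) : IsMixed β := ⟨2, one_lt_two, hβ.summable⟩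

/-- The scalar power series in the entry `(i, j)` of `xiDeriv β r`. -/
noncomputable def xiEntry (β : ℕ → Fin m → ℝ) (r : ℕ) (i j : Fin m) (y : ℝ) : ℝ :=
  ∑' p : ℕ, (p.descFactorial r : ℝ) * (β p i * β p j) * y ^ (p - r)

theorem xiDeriv_apply (r : ℕ) (A : Matrix (Fin m) (Fin m) ℝ) (i j : Fin m) :
    xiDeriv β r A i j = xiEntry β r i j (A i j) := rfl

theorem xiEntry_comm (r : ℕ) (i j : Fin m) (y : ℝ) : xiEntry β r i j y = xiEntry β r j i y := by
  simp only [xiEntry, mul_comm (β _ i)]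

theorem summable_pow_mul_abs_mul {ρ : ℝ} (hρ : 0 ≤ ρ)
    (hβ : ∀ j, Summable fun p => ρ ^ p * β p j ^ 2) (i j : Fin m) :
    Summable fun p => ρ ^ p * |β p i * β p j| := by
  refine Summable.of_nonneg_of_le (fun p => by positivity) (fun p => ?_) ((hβ i).add (hβ j))
  rw [← mul_add]
  refine mul_le_mul_of_nonneg_left ?_ (by positivity)
  rw [abs_le]
  constructor <;> nlinarith [sq_nonneg (β p i + β p j), sq_nonneg (β p i - β p j)]

theorem IsMixed.exists_summable_bound (hβ : IsMixed β) (r : ℕ) (i j : Fin m) :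
    ∃ R > 1, ∃ w : ℕ → ℝ, Summable w ∧ ∀ p, ∀ y ∈ Metric.ball (0 : ℝ) R,
      ‖(p.descFactorial r : ℝ) * (β p i * β p j) * y ^ (p - r)‖ ≤ w p := by
  obtain ⟨ρ, hρ, hsum⟩ := hβ
  obtain ⟨R, hR, hRρ⟩ := exists_between hρ
  have hR0 : 0 < R := one_pos.trans hR
  have hρ0 : 0 < ρ := hR0.trans hRρ
  -- The geometric gain `(R / ρ) ^ p` absorbs the polynomial factor `p ^ r` of the derivative.
  obtain ⟨B, hB⟩ := (tendsto_pow_const_mul_const_pow_of_abs_lt_one r (r := R / ρ) (by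
    rwa [abs_of_pos (by positivity), div_lt_one hρ0])).bddAbove_range
  refine ⟨R, hR, fun p => B * (ρ ^ p * |β p i * β p j|),
    (summable_pow_mul_abs_mul hρ0.le hsum i j).mul_left B, fun p y hy => ?_⟩
  have hpow : |y| ^ (p - r) ≤ R ^ p :=
    (pow_le_pow_left₀ (abs_nonneg y) (by simpa using (Metric.mem_ball.1 hy).le) _).trans
      (pow_le_pow_right₀ hR.le (Nat.sub_le p r))
  have hfac : (p.descFactorial r : ℝ) ≤ (p : ℝ) ^ r := by
    exact_mod_cast Nat.descFactorial_le_pow p r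
  rw [norm_mul, norm_mul, norm_pow, Real.norm_natCast, Real.norm_eq_abs, Real.norm_eq_abs]
  calc (p.descFactorial r : ℝ) * |β p i * β p j| * |y| ^ (p - r)
      ≤ (p : ℝ) ^ r * |β p i * β p j| * R ^ p := by gcongr
    _ = ((p : ℝ) ^ r * (R / ρ) ^ p) * (ρ ^ p * |β p i * β p j|) := by
        rw [div_pow]; field_simp
    _ ≤ B * (ρ ^ p * |β p i * β p j|) := by gcongr; exact hB ⟨p, rfl⟩

theorem IsMixed.summable_xiEntry (hβ : IsMixed β) (r : ℕ) (i j : Fin m) {y : ℝ} (hy : |y| ≤ 1) :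
    Summable fun p : ℕ => (p.descFactorial r : ℝ) * (β p i * β p j) * y ^ (p - r) := by
  obtain ⟨R, hR, w, hw, hb⟩ := hβ.exists_summable_bound r i j
  exact Summable.of_norm_bounded hw fun p => hb p y (by simpa using hy.trans_lt hR)

theorem IsMixed.hasDerivAt_xiEntry (hβ : IsMixed β) (r : ℕ) (i j : Fin m) {y : ℝ}
    (hy : |y| ≤ 1) : HasDerivAt (xiEntry β r i j) (xiEntry β (r + 1) i j y) y := by
  obtain ⟨R, hR, w, hw, hb⟩ := hβ.exists_summable_bound (r + 1) i j
  refine hasDerivAt_tsum_of_isPreconnected hw Metric.isOpen_ball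
    (convex_ball (0 : ℝ) R).isPreconnected (fun p z _ => ?_) (fun p z hz => hb p z hz)
    (Metric.mem_ball_self (one_pos.trans hR)) (hβ.summable_xiEntry r i j (by simp))
    (by simpa using hy.trans_lt hR)
  refine ((hasDerivAt_pow (p - r) z).const_mul
    ((p.descFactorial r : ℝ) * (β p i * β p j))).congr_deriv ?_
  rw [Nat.descFactorial_succ, Nat.cast_mul, Nat.sub_sub]
  ring

theorem IsMixed.continuousOn_xiEntry (hβ : IsMixed β) (r : ℕ) (i j : Fin m) :
    ContinuousOn (xiEntry β r i j) (Icc (-1) 1) := fun _ hy =>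
  (hβ.hasDerivAt_xiEntry r i j (abs_le.2 hy)).continuousAt.continuousWithinAt

theorem IsMixed.posSemidef_xiDeriv (hβ : IsMixed β) (r : ℕ) {A : Matrix (Fin m) (Fin m) ℝ}
    (hA : A.PosSemidef) (hA' : ∀ i j, A i j ∈ Icc (-1 : ℝ) 1) : (xiDeriv β r A).PosSemidef := by
  refine posSemidef_of_quad_nonneg (.ext fun i j => ?_) fun v => ?_
  · rw [star_trivial, xiDeriv_apply, xiDeriv_apply, xiEntry_comm, symm_apply hA.isHermitian]
  rw [dotProduct_mulVec_eq_sum]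
  have hsum : HasSum (fun p : ℕ => ∑ i, ∑ j, v i * v j *
      ((p.descFactorial r : ℝ) * (β p i * β p j) * A i j ^ (p - r)))
      (∑ i, ∑ j, v i * v j * xiDeriv β r A i j) :=
    hasSum_sum fun i _ => hasSum_sum fun j _ =>
      (hβ.summable_xiEntry r i j (abs_le.2 (hA' i j))).hasSum.mul_left _
  refine hsum.nonneg fun p => ?_
  have hterm := mul_nonneg (Nat.cast_nonneg (α := ℝ) (p.descFactorial r))
    (quad_nonneg (posSemidef_map_pow hA (p - r)) fun i => β p i * v i)
  rw [dotProduct_mulVec_eq_sum] at hterm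
  refine hterm.trans_eq ?_
  simp only [Finset.mul_sum, Matrix.map_apply]
  exact Finset.sum_congr rfl fun i _ => Finset.sum_congr rfl fun j _ => by ring

end Covariance

/-! ### Powers of matrices and the Frobenius product -/

section PositiveSemidefinite

variable {n : Type*} [Fintype n] {A P S : Matrix n n ℝ}

theorem posDef_mul_inv [DecidableEq n] (hP : P.PosDef) : P * P⁻¹ = 1 :=
  P.mul_nonsing_inv (P.isUnit_iff_isUnit_det.1 hP.isUnit)

theorem posDef_inv_mul [DecidableEq n] (hP : P.PosDef) : P⁻¹ * P = 1 :=
  P.nonsing_inv_mul (P.isUnit_iff_isUnit_det.1 hP.isUnit)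

theorem posSemidef_conj (hA : A.PosSemidef) (hP : P.IsHermitian) : (P * A * P).PosSemidef := by
  simpa only [hP.eq] using hA.mul_mul_conjTranspose_same P

theorem eq_zero_of_conj_posDef_eq_zero (hP : P.PosDef) (hS : S.IsHermitian) (h : S * P * S = 0) :
    S = 0 := by
  refine Matrix.ext_iff_mulVec.2 fun v => ?_
  by_contra hv
  rw [Matrix.zero_mulVec] at hv
  have hpos := hP.dotProduct_mulVec_pos hv
  rw [Matrix.star_mulVec, hS.eq, ← Matrix.dotProduct_mulVec, Matrix.mulVec_mulVec,
    Matrix.mulVec_mulVec, h] at hpos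
  simp at hpos

theorem eq_zero_of_conj_eq_zero (hP : P.PosDef) (h : P * A * P = 0) : A = 0 := by
  classical
  calc A = (P⁻¹ * P) * A * (P * P⁻¹) := by rw [posDef_inv_mul hP, posDef_mul_inv hP]; simp
    _ = P⁻¹ * (P * A * P) * P⁻¹ := by simp only [mul_assoc]
    _ = 0 := by rw [h]; simp

end PositiveSemidefinite

section Powers

variable {m : ℕ} {D P : Matrix (Fin m) (Fin m) ℝ}

theorem isHermitian_psdPow (D : Matrix (Fin m) (Fin m) ℝ) (r : ℝ) : (psdPow D r).IsHermitian :=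
  cfc_predicate (p := IsSelfAdjoint) _ D

theorem spectrum_nonneg_of_posSemidef (hD : D.PosSemidef) : ∀ y ∈ spectrum ℝ D, 0 ≤ y :=
  fun _ hy => (Matrix.posSemidef_iff_isHermitian_and_spectrum_nonneg.1 hD).2 hy

theorem continuousOn_rpow_const_of_nonneg {r : ℝ} (hr : 0 ≤ r) (s : Set ℝ) :
    ContinuousOn (fun y : ℝ => y ^ r) s :=
  continuousOn_id.rpow_const fun _ _ => Or.inr hr

theorem psdPow_half_mul_self (hD : D.PosSemidef) :
    psdPow D (1 / 2) * psdPow D (1 / 2) = D := by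
  have hc := continuousOn_rpow_const_of_nonneg (r := 1 / 2) (by norm_num) (spectrum ℝ D)
  have hsa : IsSelfAdjoint D := hD.isHermitian
  rw [psdPow, ← cfc_mul _ _ D hc hc]
  conv_rhs => rw [← cfc_id ℝ D]
  refine cfc_congr fun y hy => ?_
  rw [id, ← Real.sqrt_eq_rpow, Real.mul_self_sqrt (spectrum_nonneg_of_posSemidef hD y hy)]

theorem psdPow_three_halves_mul_self (hD : D.PosSemidef) :
    psdPow (D * D) (3 / 2) = D * D * D := by
  have hsa : IsSelfAdjoint D := hD.isHermitian
  have hsq : cfc (fun y : ℝ => y ^ 2) D = D * D := by rw [cfc_pow_id (R := ℝ) D 2, sq]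
  have hcube : cfc (fun y : ℝ => y ^ 3) D = D * D * D := by
    rw [cfc_pow_id (R := ℝ) D 3, pow_succ, sq]
  rw [psdPow, ← hcube, ← hsq, ← cfc_comp' (fun y : ℝ => y ^ (3 / 2 : ℝ)) (fun y : ℝ => y ^ 2) D
    (continuousOn_rpow_const_of_nonneg (by norm_num) _) (by fun_prop)]
  refine cfc_congr fun y hy => ?_
  rw [← Real.rpow_natCast y 2, ← Real.rpow_mul (spectrum_nonneg_of_posSemidef hD y hy),
    ← Real.rpow_natCast y 3]
  norm_num

theorem trace_mul_mul_self_pos (hD : D.PosSemidef) (hD0 : D ≠ 0) : 0 < (D * D * D).trace := by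
  have hS := isHermitian_psdPow D (1 / 2)
  have hSS := psdPow_half_mul_self hD
  have hcube : D * D * D = (psdPow D (1 / 2) * D)ᴴ * (psdPow D (1 / 2) * D) := by
    rw [Matrix.conjTranspose_mul, hS.eq, hD.isHermitian.eq, mul_assoc, mul_assoc,
      ← mul_assoc (psdPow D (1 / 2)), hSS]
  rw [hcube]
  refine (Matrix.posSemidef_conjTranspose_mul_self _).trace_nonneg.lt_of_ne' fun h => hD0 ?_
  have hSD : psdPow D (1 / 2) * D = 0 := Matrix.trace_conjTranspose_mul_self_eq_zero_iff.1 h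
  have hDD : Dᴴ * D = 0 := by
    rw [hD.isHermitian.eq]; nth_rw 1 [← hSS]; rw [mul_assoc, hSD, mul_zero]
  exact Matrix.conjTranspose_mul_self_eq_zero.1 hDD

-- With `S = D^{1/2}` and `X = P D P` one has `S X S = (S P S)²`.
theorem psdPow_three_halves_conj (hD : D.PosSemidef) (hP : P.PosSemidef) :
    psdPow (psdPow D (1 / 2) * (P * D * P) * psdPow D (1 / 2)) (3 / 2) =
      (psdPow D (1 / 2) * P * psdPow D (1 / 2)) * (psdPow D (1 / 2) * P * psdPow D (1 / 2)) *
        (psdPow D (1 / 2) * P * psdPow D (1 / 2)) := by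
  rw [← psdPow_three_halves_mul_self (posSemidef_conj hP (isHermitian_psdPow D _))]
  congr 1
  nth_rw 2 [← psdPow_half_mul_self hD]
  simp only [mul_assoc]

theorem trace_psdPow_three_halves_conj (hD : D.PosSemidef) (hP : P.PosSemidef) :
    (psdPow (psdPow D (1 / 2) * (P * D * P) * psdPow D (1 / 2)) (3 / 2)).trace =
      (P * D * P * D * P * D).trace := by
  rw [psdPow_three_halves_conj hD hP]
  have hSS := psdPow_half_mul_self hD
  set S := psdPow D (1 / 2)
  have hcycle : S * P * S * (S * P * S) * (S * P * S) = S * (P * D * P * D * P * S) := by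
    rw [← hSS]; simp only [mul_assoc]
  rw [hcycle, Matrix.trace_mul_comm, mul_assoc _ S, hSS]

theorem trace_psdPow_three_halves_conj_pos (hD : D.PosSemidef) (hP : P.PosDef) (hD0 : D ≠ 0) :
    0 < (psdPow (psdPow D (1 / 2) * (P * D * P) * psdPow D (1 / 2)) (3 / 2)).trace := by
  have hS := isHermitian_psdPow D (1 / 2)
  rw [psdPow_three_halves_conj hD hP.posSemidef]
  refine trace_mul_mul_self_pos (posSemidef_conj hP.posSemidef hS) fun h => hD0 ?_
  rw [← psdPow_half_mul_self hD, eq_zero_of_conj_posDef_eq_zero hP hS h, zero_mul]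

end Powers

section Frobenius

variable {m : ℕ} (A B C : Matrix (Fin m) (Fin m) ℝ) (c : ℝ)

theorem frob_eq_trace : frob A B = (Aᵀ * B).trace := by
  simp only [frob, Matrix.trace, Matrix.diag_apply, Matrix.mul_apply, Matrix.transpose_apply]
  exact Finset.sum_comm

theorem frob_comm : frob A B = frob B A := by
  simp only [frob, mul_comm]

theorem frob_add_left : frob (A + B) C = frob A C + frob B C := by
  simp only [frob, Matrix.add_apply, add_mul, Finset.sum_add_distrib]

theorem frob_sub_left : frob (A - B) C = frob A C - frob B C := by
  simp only [frob, Matrix.sub_apply, sub_mul, Finset.sum_sub_distrib]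

theorem frob_smul_left : frob (c • A) B = c * frob A B := by
  simp only [frob, Matrix.smul_apply, smul_eq_mul, Finset.mul_sum, mul_assoc]

theorem frob_add_right : frob A (B + C) = frob A B + frob A C := by
  rw [frob_comm, frob_add_left, frob_comm B, frob_comm C]

theorem frob_sub_right : frob A (B - C) = frob A B - frob A C := by
  rw [frob_comm, frob_sub_left, frob_comm B, frob_comm C]

theorem frob_smul_right : frob A (c • B) = c * frob A B := by
  rw [frob_comm, frob_smul_left, frob_comm]

theorem frob_neg_right : frob A (-B) = -frob A B := by simp [frob]

theorem frob_zero_left : frob 0 A = 0 := by simp [frob]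

theorem frob_zero_right : frob A 0 = 0 := by simp [frob]

theorem frob_hadamard_right : frob (A ⊙ B) C = frob (A ⊙ C) B := by
  simp only [frob, Matrix.hadamard_apply, mul_right_comm]

variable {A B C} {G P R : Matrix (Fin m) (Fin m) ℝ}

theorem frob_conj (hP : P.IsHermitian) : frob (P * A * P) B = frob A (P * B * P) := by
  rw [frob_eq_trace, frob_eq_trace, Matrix.transpose_mul, Matrix.transpose_mul, transpose_eq hP,
    ← mul_assoc, ← mul_assoc, mul_assoc P Aᵀ, mul_assoc P, Matrix.trace_mul_comm]
  simp only [mul_assoc]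

theorem frob_conj_self (hR : R.PosSemidef) :
    frob G (R * G * R) =
      ((psdPow R (1 / 2) * G * psdPow R (1 / 2))ᴴ *
        (psdPow R (1 / 2) * G * psdPow R (1 / 2))).trace := by
  have hSS := psdPow_half_mul_self hR
  have hS := isHermitian_psdPow R (1 / 2)
  set S := psdPow R (1 / 2)
  have hassoc : R * G * R = S * (S * G * S) * S := by rw [← hSS]; simp only [mul_assoc]
  rw [hassoc, ← frob_conj hS, frob_eq_trace, Matrix.conjTranspose_eq_transpose_of_trivial]

theorem frob_conj_self_nonneg (hR : R.PosSemidef) : 0 ≤ frob G (R * G * R) := by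
  rw [frob_conj_self hR]
  exact (Matrix.posSemidef_conjTranspose_mul_self _).trace_nonneg

theorem eq_zero_of_frob_conj_self (hR : R.PosDef) (h : frob G (R * G * R) = 0) : G = 0 := by
  rw [frob_conj_self hR.posSemidef, Matrix.trace_conjTranspose_mul_self_eq_zero_iff] at h
  have hSS := psdPow_half_mul_self hR.posSemidef
  set S := psdPow R (1 / 2)
  refine eq_zero_of_conj_eq_zero hR ?_
  calc R * G * R = S * (S * G * S) * S := by rw [← hSS]; simp only [mul_assoc]
    _ = 0 := by rw [h]; simp

end Frobenius

/-! ### Matrix-valued calculus and the order parameter -/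

open scoped Matrix.Norms.Operator

section Derivatives

variable {n : Type*} {F : ℝ → Matrix n n ℝ} {F' : Matrix n n ℝ} {s : Set ℝ} {t : ℝ}

theorem continuousOn_apply {X : Type*} [TopologicalSpace X] {F : X → Matrix n n ℝ} {s : Set X}
    (hF : ContinuousOn F s) (i j : n) : ContinuousOn (fun x => F x i j) s :=
  continuousOn_pi.1 (continuousOn_pi.1 hF i) j

theorem hasDerivWithinAt_matrix_iff [Finite n] : HasDerivWithinAt F F' s t ↔
    ∀ i j, HasDerivWithinAt (fun y => F y i j) (F' i j) s t := by
  have := Fintype.ofFinite n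
  exact (hasDerivWithinAt_pi (E' := fun _ => n → ℝ) (φ := F) (φ' := F')).trans
    (forall_congr' fun _ => hasDerivWithinAt_pi)

variable [Fintype n]

theorem hasDerivWithinAt_quad (hF : HasDerivWithinAt F F' s t) (v : n → ℝ) :
    HasDerivWithinAt (fun y => v ⬝ᵥ F y *ᵥ v) (v ⬝ᵥ F' *ᵥ v) s t := by
  simp only [dotProduct_mulVec_eq_sum]
  exact HasDerivWithinAt.fun_sum fun i _ => HasDerivWithinAt.fun_sum fun j _ =>
    (hasDerivWithinAt_matrix_iff.1 hF i j).const_mul _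

theorem hasDerivWithinAt_matrix_inv [DecidableEq n] (hF : HasDerivWithinAt F F' s t)
    (hu : IsUnit (F t).det) :
    HasDerivWithinAt (fun y => (F y)⁻¹) (-((F t)⁻¹ * F' * (F t)⁻¹)) s t := by
  obtain ⟨A, hA⟩ := (Matrix.isUnit_iff_isUnit_det _).2 hu
  have hinv := hasFDerivAt_ringInverse (𝕜 := ℝ) A
  rw [hA] at hinv
  simp only [Matrix.nonsing_inv_eq_ringInverse]
  refine (hinv.comp_hasDerivWithinAt t hF).congr_deriv ?_
  simp [← hA]

theorem continuousOn_matrix_inv [DecidableEq n] {X : Type*} [TopologicalSpace X]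
    {F : X → Matrix n n ℝ} {s : Set X} (hF : ContinuousOn F s)
    (hu : ∀ x ∈ s, IsUnit (F x).det) : ContinuousOn (fun x => (F x)⁻¹) s := fun x hx =>
  (continuousAt_matrix_inv (F x) (by
    rw [Ring.inverse_eq_inv']
    exact continuousAt_inv₀ (hu x hx).ne_zero)).comp_continuousWithinAt (hF x hx)

end Derivatives

section Frobenius

variable {m : ℕ}

theorem continuousOn_frob {X : Type*} [TopologicalSpace X] {F K : X → Matrix (Fin m) (Fin m) ℝ}
    {s : Set X} (hF : ContinuousOn F s) (hK : ContinuousOn K s) :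
    ContinuousOn (fun x => frob (F x) (K x)) s :=
  continuousOn_finsetSum _ fun i _ => continuousOn_finsetSum _ fun j _ =>
    (continuousOn_apply hF i j).mul (continuousOn_apply hK i j)

theorem hasDerivWithinAt_frob {F K : ℝ → Matrix (Fin m) (Fin m) ℝ}
    {F' K' : Matrix (Fin m) (Fin m) ℝ} {s : Set ℝ} {t : ℝ} (hF : HasDerivWithinAt F F' s t)
    (hK : HasDerivWithinAt K K' s t) :
    HasDerivWithinAt (fun y => frob (F y) (K y)) (frob F' (K t) + frob (F t) K') s t := by
  simp only [frob, ← Finset.sum_add_distrib]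
  exact HasDerivWithinAt.fun_sum fun i _ => HasDerivWithinAt.fun_sum fun j _ =>
    (hasDerivWithinAt_matrix_iff.1 hF i j).mul (hasDerivWithinAt_matrix_iff.1 hK i j)

end Frobenius

theorem integrable_of_continuousOn_of_ae_mem {α : Type*} [TopologicalSpace α] [T2Space α]
    [MeasurableSpace α] [OpensMeasurableSpace α] {ν : Measure α} [IsFiniteMeasure ν] {K : Set α}
    (hK : IsCompact K) (hν : ∀ᵐ t ∂ν, t ∈ K) {f : α → ℝ} (hf : ContinuousOn f K) :
    Integrable f ν := by
  rw [← integrableOn_univ, ← integrableOn_congr_set_ae (Filter.eventuallyEq_univ.2 hν)]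
  exact hf.integrableOn_compact' hK hK.measurableSet

section OrderMeasure

variable {m : ℕ} {μ : Measure ℝ}

theorem IsOrderMeasure.orderParam_eq_cdf (hμ : IsOrderMeasure m μ) :
    orderParam μ = ProbabilityTheory.cdf μ := by
  have := hμ.isProbabilityMeasure
  ext t
  rw [ProbabilityTheory.cdf_eq_real, orderParam]
  refine measureReal_congr ?_
  have h0 : ∀ᵐ s ∂μ, s ∈ Icc (0 : ℝ) m := mem_ae_iff.2 hμ.compl_eq_zero
  filter_upwards [h0] with s hs
  exact propext ⟨fun h => h.2, fun h => ⟨hs.1, h⟩⟩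

theorem IsOrderMeasure.monotone (hμ : IsOrderMeasure m μ) : Monotone (orderParam μ) := by
  rw [hμ.orderParam_eq_cdf]; exact ProbabilityTheory.monotone_cdf μ

theorem orderParam_nonneg (μ : Measure ℝ) (t : ℝ) : 0 ≤ orderParam μ t := measureReal_nonneg

theorem IsOrderMeasure.le_one (hμ : IsOrderMeasure m μ) (t : ℝ) : orderParam μ t ≤ 1 := by
  rw [hμ.orderParam_eq_cdf]; exact ProbabilityTheory.cdf_le_one μ t

theorem IsOrderMeasure.continuousWithinAt (hμ : IsOrderMeasure m μ) (t : ℝ) :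
    ContinuousWithinAt (orderParam μ) (Ici t) t := by
  rw [hμ.orderParam_eq_cdf]; exact (ProbabilityTheory.cdf μ).right_continuous t

theorem IsOrderMeasure.orderParam_top (hμ : IsOrderMeasure m μ) : orderParam μ m = 1 := by
  have := hμ.isProbabilityMeasure
  have h0 : ∀ᵐ s ∂μ, s ∈ Icc (0 : ℝ) m := mem_ae_iff.2 hμ.compl_eq_zero
  have h1 : Icc (0 : ℝ) m =ᵐ[μ] univ := by
    filter_upwards [h0] with s hs
    exact propext ⟨fun _ => trivial, fun _ => hs⟩
  rw [orderParam, measureReal_congr h1, probReal_univ]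

theorem IsOrderMeasure.exists_lt_orderParam_eq_one (hμ : IsOrderMeasure m μ) {T : ℝ}
    (hT : topPoint m μ < T) :
    ∃ s ∈ Icc (0 : ℝ) m, s < T ∧ orderParam μ s = 1 := by
  have hne : {t | t ∈ Icc (0 : ℝ) m ∧ orderParam μ t = 1}.Nonempty :=
    ⟨(m : ℝ), ⟨Nat.cast_nonneg m, le_rfl⟩, hμ.orderParam_top⟩
  obtain ⟨s, hs, hsT⟩ := exists_lt_of_csInf_lt hne hT
  exact ⟨s, hs.1, hsT, hs.2⟩

theorem topPoint_nonneg (m : ℕ) (μ : Measure ℝ) : 0 ≤ topPoint m μ :=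
  Real.sInf_nonneg fun _ ht => ht.1.1

theorem IsOrderMeasure.orderParam_eq_one (hμ : IsOrderMeasure m μ) {T t : ℝ}
    (hT : topPoint m μ < T) (ht : T ≤ t) : orderParam μ t = 1 := by
  obtain ⟨s, -, hsT, hs⟩ := hμ.exists_lt_orderParam_eq_one hT
  exact le_antisymm (hμ.le_one t) (hs ▸ hμ.monotone (hsT.le.trans ht))

theorem IsOrderMeasure.ae_mem_Icc (hμ : IsOrderMeasure m μ) {s : ℝ} (hs : orderParam μ s = 1) :
    ∀ᵐ t ∂μ, t ∈ Icc 0 s := by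
  have := hμ.isProbabilityMeasure
  change Icc 0 s ∈ ae μ
  rw [mem_ae_iff, prob_compl_eq_zero_iff measurableSet_Icc]
  rw [orderParam, measureReal_def] at hs
  rw [← ENNReal.ofReal_toReal (measure_ne_top μ (Icc 0 s)), hs, ENNReal.ofReal_one]

theorem IsOrderMeasure.ae_pos (hμ : IsOrderMeasure m μ) : ∀ᵐ t ∂μ, 0 < t := by
  have := hμ.isProbabilityMeasure
  have h0 := hμ.orderParam_zero
  rw [orderParam, measureReal_eq_zero_iff, Icc_self] at h0
  have h1 : ∀ᵐ t ∂μ, t ≠ 0 := by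
    rw [ae_iff]; simpa using h0
  filter_upwards [hμ.ae_mem_Icc hμ.orderParam_top, h1] with t ht ht'
  exact ht.1.lt_of_ne' ht'

theorem IsOrderMeasure.ae_mem_Ioo (hμ : IsOrderMeasure m μ) {T : ℝ} (hT : topPoint m μ < T) :
    ∀ᵐ t ∂μ, t ∈ Ioo 0 T := by
  obtain ⟨s, -, hsT, hs⟩ := hμ.exists_lt_orderParam_eq_one hT
  filter_upwards [hμ.ae_mem_Icc hs, hμ.ae_pos] with t ht ht'
  exact ⟨ht', ht.2.trans_lt hsT⟩

theorem IsOrderMeasure.support_subset (hμ : IsOrderMeasure m μ) :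
    μ.support ⊆ Icc 0 (topPoint m μ) := by
  intro u hu
  have key : ∀ T, topPoint m μ < T → u ∈ Icc 0 T := fun T hT => by
    obtain ⟨s, -, hsT, hs⟩ := hμ.exists_lt_orderParam_eq_one hT
    have := Measure.support_subset_of_isClosed isClosed_Icc (hμ.ae_mem_Icc hs) hu
    exact ⟨this.1, this.2.trans hsT.le⟩
  exact ⟨(key _ (lt_add_one _)).1, le_of_forall_gt_imp_ge_of_dense fun T hT => (key T hT).2⟩

theorem IsOrderMeasure.integrable_of_continuousOn (hμ : IsOrderMeasure m μ) {s : ℝ}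
    (hs : orderParam μ s = 1) {f : ℝ → ℝ} (hf : ContinuousOn f (Icc 0 s)) : Integrable f μ := by
  have := hμ.isProbabilityMeasure
  exact integrable_of_continuousOn_of_ae_mem isCompact_Icc (hμ.ae_mem_Icc hs) hf

theorem IsOrderMeasure.intervalIntegrable_mul (hμ : IsOrderMeasure m μ) {f : ℝ → ℝ} {s T : ℝ}
    (hf : ContinuousOn f (uIcc s T)) :
    IntervalIntegrable (fun t => orderParam μ t * f t) volume s T :=
  (hμ.monotone.intervalIntegrable (a := s) (b := T)).mul_continuousOn hf

theorem IsOrderMeasure.integral_orderParam_mul_eq_integral_integral (hμ : IsOrderMeasure m μ)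
    {T : ℝ} (hT0 : 0 ≤ T) (hT : orderParam μ T = 1) {f : ℝ → ℝ}
    (hf : IntegrableOn f (Ioc 0 T)) :
    ∫ t in 0..T, orderParam μ t * f t = ∫ s, (∫ t in s..T, f t) ∂μ := by
  have := hμ.isProbabilityMeasure
  have hmeas : MeasurableSet {q : ℝ × ℝ | q.2 ≤ q.1} :=
    measurableSet_le measurable_snd measurable_fst
  have hI : Integrable (Function.uncurry fun t s => (Iic t).indicator (fun _ => f t) s)
      ((volume.restrict (Ioc 0 T)).prod μ) :=
    ((hf.comp_fst μ).indicator hmeas).congr (Filter.Eventually.of_forall fun _ => rfl)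
  have hx : ∀ t, orderParam μ t * f t = ∫ s, (Iic t).indicator (fun _ => f t) s ∂μ := fun t => by
    rw [integral_indicator_const _ measurableSet_Iic, smul_eq_mul, hμ.orderParam_eq_cdf,
      ProbabilityTheory.cdf_eq_real]
  rw [intervalIntegral.integral_of_le hT0]
  simp_rw [hx]
  rw [integral_integral_swap hI]
  refine integral_congr_ae ?_
  filter_upwards [hμ.ae_pos, hμ.ae_mem_Icc hT] with s hs0 hs
  have hind : ∀ t, (Iic t).indicator (fun _ => f t) s = (Ici s).indicator f t := fun t => by
    simp only [indicator, mem_Iic, mem_Ici]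
  have hset : Ioc 0 T ∩ Ici s = Icc s T := by
    ext t
    simp only [mem_inter_iff, mem_Ioc, mem_Ici, mem_Icc]
    exact ⟨fun h => ⟨h.2, h.1.2⟩, fun h => ⟨⟨hs0.trans_le h.1, h.2⟩, h.1⟩⟩
  simp_rw [hind]
  rw [setIntegral_indicator measurableSet_Ici, hset, integral_Icc_eq_integral_Ioc,
    intervalIntegral.integral_of_le hs.2]

theorem IsOrderMeasure.integral_orderParam_mul_deriv (hμ : IsOrderMeasure m μ) {T : ℝ}
    (hT0 : 0 ≤ T) (hT : orderParam μ T = 1) {f f' : ℝ → ℝ} (hf : ContinuousOn f (Icc 0 T))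
    (hf' : ContinuousOn f' (Icc 0 T))
    (hd : ∀ t ∈ Ico 0 T, HasDerivWithinAt f (f' t) (Ici t) t) :
    ∫ t in 0..T, orderParam μ t * f' t = f T - ∫ s, f s ∂μ := by
  have := hμ.isProbabilityMeasure
  have hftc : ∀ s ∈ Icc 0 T, ∫ t in s..T, f' t = f T - f s := fun s hs => by
    have hsub : uIcc s T ⊆ Icc 0 T := uIcc_of_le hs.2 ▸ Icc_subset_Icc_left hs.1
    refine intervalIntegral.integral_eq_sub_of_hasDeriv_right (hf.mono hsub) (fun t ht => ?_)
      (hf'.mono hsub).intervalIntegrable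
    rw [min_eq_left hs.2, max_eq_right hs.2] at ht
    exact (hd t ⟨hs.1.trans ht.1.le, ht.2⟩).mono Ioi_subset_Ici_self
  rw [hμ.integral_orderParam_mul_eq_integral_integral hT0 hT
      (hf'.integrableOn_Icc.mono_set Ioc_subset_Icc_self),
    integral_congr_ae ((hμ.ae_mem_Icc hT).mono hftc),
    integral_sub (integrable_const _) (hμ.integrable_of_continuousOn hT hf)]
  simp

end OrderMeasure

/-! ### Paths, `Φ̂` and the gradient -/

section Paths

variable {m : ℕ} {μ κ : Measure ℝ} {Q : Matrix (Fin m) (Fin m) ℝ}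
  {Φ : ℝ → Matrix (Fin m) (Fin m) ℝ}

section Path

theorem left_mem_Icc_natCast (m : ℕ) : (0 : ℝ) ∈ Icc (0 : ℝ) m := ⟨le_rfl, m.cast_nonneg⟩

theorem right_mem_Icc_natCast (m : ℕ) : (m : ℝ) ∈ Icc (0 : ℝ) m := ⟨m.cast_nonneg, le_rfl⟩

theorem IsPath.of_zero_measure (hΦ : IsPath Q κ Φ) : IsPath Q 0 Φ :=
  ⟨hΦ.posSemidef, hΦ.monotone, hΦ.zero, hΦ.top, hΦ.differentiable, hΦ.lipschitz_deriv, by simp⟩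

theorem IsPath.hasDerivWithinAt (hΦ : IsPath Q κ Φ) {t : ℝ} (ht : t ∈ Icc (0 : ℝ) m) :
    HasDerivWithinAt Φ (pathDeriv Φ t) (Icc (0 : ℝ) m) t :=
  hasDerivWithinAt_matrix_iff.2 fun i j => (hΦ.differentiable i j t ht).hasDerivWithinAt

theorem IsPath.hasDerivWithinAt_Ici (hΦ : IsPath Q κ Φ) {t : ℝ} (ht : t ∈ Ico (0 : ℝ) m) :
    HasDerivWithinAt Φ (pathDeriv Φ t) (Ici t) t :=
  (hΦ.hasDerivWithinAt ⟨ht.1, ht.2.le⟩).mono_of_mem_nhdsWithin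
    (Filter.mem_of_superset (Icc_mem_nhdsGE ht.2) (Icc_subset_Icc_left ht.1))

theorem IsPath.continuousOn (hΦ : IsPath Q κ Φ) : ContinuousOn Φ (Icc (0 : ℝ) m) := fun _ ht =>
  (hΦ.hasDerivWithinAt ht).continuousWithinAt

theorem IsPath.continuousOn_pathDeriv (hΦ : IsPath Q κ Φ) :
    ContinuousOn (pathDeriv Φ) (Icc (0 : ℝ) m) := by
  obtain ⟨K, hK⟩ := hΦ.lipschitz_deriv
  exact continuousOn_pi.2 fun i => continuousOn_pi.2 fun j => (hK i j).continuousOn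

theorem IsPath.posSemidef_pathDeriv (hΦ : IsPath Q κ Φ) {t : ℝ} (ht : t ∈ Icc (0 : ℝ) m) :
    (pathDeriv Φ t).PosSemidef := by
  rcases Nat.eq_zero_or_pos m with rfl | hm
  · rw [Subsingleton.elim (pathDeriv Φ t) 0]
    exact .zero
  have hu : UniqueDiffWithinAt ℝ (Icc (0 : ℝ) m) t := uniqueDiffOn_Icc (Nat.cast_pos.2 hm) t ht
  refine posSemidef_of_quad_nonneg (.ext fun i j => ?_) fun v => ?_
  · have hd := hasDerivWithinAt_matrix_iff.1 (hΦ.hasDerivWithinAt ht)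
    exact hu.eq_deriv _ (hd j i) ((hd i j).congr
      (fun s hs => symm_apply (hΦ.posSemidef s hs).isHermitian j i)
      (symm_apply (hΦ.posSemidef t ht).isHermitian j i))
  · rw [← (hasDerivWithinAt_quad (hΦ.hasDerivWithinAt ht) v).derivWithin hu]
    exact MonotoneOn.derivWithin_nonneg fun s hs s' hs' hss' =>
      quad_le_of_posSemidef_sub (hΦ.monotone s hs s' hs' hss') v

theorem IsPath.apply_mem_Icc (hΦ : IsPath Q κ Φ) (hQ : IsConstraint Q) {t : ℝ}
    (ht : t ∈ Icc (0 : ℝ) m) (i j : Fin m) : Φ t i j ∈ Icc (-1 : ℝ) 1 := by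
  refine apply_mem_Icc_of_diag_le_one (hΦ.posSemidef t ht) (fun i => ?_) i j
  have hdiag := (hΦ.monotone t ht m (right_mem_Icc_natCast m) ht.2).diag_nonneg (i := i)
  rwa [Matrix.sub_apply, hΦ.top, hQ.diag i, sub_nonneg] at hdiag

end Path

section HatPath

theorem IsPath.intervalIntegrable_hatPath (hΦ : IsPath Q κ Φ) (hμ : IsOrderMeasure m μ)
    (i j : Fin m) {s t : ℝ} (hs : s ∈ Icc (0 : ℝ) m) (ht : t ∈ Icc (0 : ℝ) m) :
    IntervalIntegrable (fun y => orderParam μ y * pathDeriv Φ y i j) volume s t :=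
  hμ.intervalIntegrable_mul
    ((continuousOn_apply hΦ.continuousOn_pathDeriv i j).mono (uIcc_subset_Icc hs ht))

theorem hatPath_apply_eq_neg (t : ℝ) (i j : Fin m) :
    hatPath μ Φ t i j = -∫ s in (m : ℝ)..t, orderParam μ s * pathDeriv Φ s i j :=
  intervalIntegral.integral_symm _ _

theorem IsPath.hasDerivWithinAt_hatPath (hΦ : IsPath Q κ Φ) (hμ : IsOrderMeasure m μ) {t : ℝ}
    (ht : t ∈ Ico (0 : ℝ) m) :
    HasDerivWithinAt (hatPath μ Φ) (-(orderParam μ t • pathDeriv Φ t)) (Ici t) t := by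
  refine hasDerivWithinAt_matrix_iff.2 fun i j => ?_
  have ht' : t ∈ Icc (0 : ℝ) m := ⟨ht.1, ht.2.le⟩
  have hD := continuousOn_apply hΦ.continuousOn_pathDeriv i j
  have hnhds : Icc (0 : ℝ) m ∈ nhdsWithin t (Ici t) :=
    Filter.mem_of_superset (Icc_mem_nhdsGE ht.2) (Icc_subset_Icc_left ht.1)
  have hcont : ContinuousWithinAt (fun y => orderParam μ y * pathDeriv Φ y i j) (Ioi t) t :=
    ((hμ.continuousWithinAt t).mul ((hD t ht').mono_of_mem_nhdsWithin hnhds)).mono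
      Ioi_subset_Ici_self
  have hmeas : StronglyMeasurableAtFilter (fun y => orderParam μ y * pathDeriv Φ y i j)
      (nhdsWithin t (Ioi t)) volume :=
    ⟨Icc (0 : ℝ) m, nhdsWithin_mono t Ioi_subset_Ici_self hnhds,
      hμ.monotone.measurable.aestronglyMeasurable.mul
        (hD.aestronglyMeasurable measurableSet_Icc)⟩
  simp only [hatPath_apply_eq_neg]
  exact (intervalIntegral.integral_hasDerivWithinAt_right
    (hΦ.intervalIntegrable_hatPath hμ i j (right_mem_Icc_natCast m) ht') (s := Ici t) hmeas
    hcont).fun_neg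

theorem IsPath.continuousOn_hatPath (hΦ : IsPath Q κ Φ) (hμ : IsOrderMeasure m μ) :
    ContinuousOn (hatPath μ Φ) (Icc (0 : ℝ) m) := by
  refine continuousOn_pi.2 fun i => continuousOn_pi.2 fun j => ?_
  have h := intervalIntegral.continuousOn_primitive_interval'
    (hΦ.intervalIntegrable_hatPath hμ i j (left_mem_Icc_natCast m) (right_mem_Icc_natCast m))
    (a := (m : ℝ)) right_mem_uIcc
  rw [uIcc_of_le (Nat.cast_nonneg m)] at h
  exact h.neg.congr fun t _ => hatPath_apply_eq_neg t i j

theorem IsPath.hatPath_sub (hΦ : IsPath Q κ Φ) (hμ : IsOrderMeasure m μ) {s t : ℝ}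
    (hs : s ∈ Icc (0 : ℝ) m) (ht : t ∈ Icc (0 : ℝ) m) (i j : Fin m) :
    hatPath μ Φ s i j - hatPath μ Φ t i j =
      ∫ y in s..t, orderParam μ y * pathDeriv Φ y i j := by
  simp only [hatPath, Matrix.of_apply]
  rw [sub_eq_iff_eq_add, intervalIntegral.integral_add_adjacent_intervals
    (hΦ.intervalIntegrable_hatPath hμ i j hs ht)
    (hΦ.intervalIntegrable_hatPath hμ i j ht (right_mem_Icc_natCast m))]

theorem IsPath.isHermitian_hatPath (hΦ : IsPath Q κ Φ) {t : ℝ} (ht : t ∈ Icc (0 : ℝ) m) :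
    (hatPath μ Φ t).IsHermitian := by
  refine .ext fun i j => intervalIntegral.integral_congr fun s hs => ?_
  have hs' : s ∈ Icc (0 : ℝ) m := uIcc_subset_Icc ht (right_mem_Icc_natCast m) hs
  exact congrArg (orderParam μ s * ·) (symm_apply (hΦ.posSemidef_pathDeriv hs').isHermitian j i)

theorem IsPath.quad_hatPath_sub (hΦ : IsPath Q κ Φ) (hμ : IsOrderMeasure m μ) {s t : ℝ}
    (hs : s ∈ Icc (0 : ℝ) m) (ht : t ∈ Icc (0 : ℝ) m) (v : Fin m → ℝ) :
    v ⬝ᵥ (hatPath μ Φ s - hatPath μ Φ t) *ᵥ v =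
      ∫ y in s..t, orderParam μ y * (v ⬝ᵥ pathDeriv Φ y *ᵥ v) := by
  have hint := fun i j => (hΦ.intervalIntegrable_hatPath hμ i j hs ht).const_mul (v i * v j)
  have hsum : ∀ i, IntervalIntegrable (fun y => ∑ j, v i * v j *
      (orderParam μ y * pathDeriv Φ y i j)) volume s t := fun i => by
    simpa only [← Finset.sum_fn] using IntervalIntegrable.sum Finset.univ fun j _ => hint i j
  simp only [dotProduct_mulVec_eq_sum, Finset.mul_sum, mul_left_comm (orderParam μ _)]
  rw [intervalIntegral.integral_finsetSum fun i _ => hsum i]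
  refine Finset.sum_congr rfl fun i _ => ?_
  rw [intervalIntegral.integral_finsetSum fun j _ => hint i j]
  refine Finset.sum_congr rfl fun j _ => ?_
  rw [intervalIntegral.integral_const_mul, Matrix.sub_apply, hΦ.hatPath_sub hμ hs ht]

theorem IsPath.posSemidef_hatPath_sub (hΦ : IsPath Q κ Φ) (hμ : IsOrderMeasure m μ) {s t : ℝ}
    (hs : s ∈ Icc (0 : ℝ) m) (ht : t ∈ Icc (0 : ℝ) m) (hst : s ≤ t) :
    (hatPath μ Φ s - hatPath μ Φ t).PosSemidef := by
  refine posSemidef_of_quad_nonneg ((hΦ.isHermitian_hatPath hs).sub (hΦ.isHermitian_hatPath ht))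
    fun v => ?_
  rw [hΦ.quad_hatPath_sub hμ hs ht]
  exact intervalIntegral.integral_nonneg hst fun y hy => mul_nonneg (orderParam_nonneg μ y)
    (quad_nonneg (hΦ.posSemidef_pathDeriv ⟨hs.1.trans hy.1, hy.2.trans ht.2⟩) v)

theorem IsPath.hatPath_eq_sub (hΦ : IsPath Q κ Φ) (hμ : IsOrderMeasure m μ) {t : ℝ}
    (ht : topPoint m μ < t) (htm : t ≤ m) : hatPath μ Φ t = Q - Φ t := by
  have ht0 : 0 ≤ t := (topPoint_nonneg m μ).trans ht.le
  have hsub : uIcc t (m : ℝ) ⊆ Icc (0 : ℝ) m := by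
    rw [uIcc_of_le htm]
    exact Icc_subset_Icc_left ht0
  ext i j
  calc hatPath μ Φ t i j = ∫ s in t..(m : ℝ), pathDeriv Φ s i j :=
        intervalIntegral.integral_congr fun s hs => by
          rw [uIcc_of_le htm] at hs
          rw [hμ.orderParam_eq_one ht hs.1, one_mul]
    _ = Φ m i j - Φ t i j := by
        refine intervalIntegral.integral_eq_sub_of_hasDeriv_right
          ((continuousOn_apply hΦ.continuousOn i j).mono hsub) (fun s hs => ?_)
          ((continuousOn_apply hΦ.continuousOn_pathDeriv i j).mono hsub).intervalIntegrable
        rw [min_eq_left htm, max_eq_right htm] at hs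
        exact (hasDerivWithinAt_matrix_iff.1
          (hΦ.hasDerivWithinAt_Ici ⟨ht0.trans hs.1.le, hs.2⟩) i j).mono Ioi_subset_Ici_self
    _ = (Q - Φ t) i j := by rw [hΦ.top, Matrix.sub_apply]

end HatPath

/-- `T ∈ (t_x, m)` is a point at which the functional may be cut off: the logarithm in it is finite
because `Q - Φ(T)` is nonsingular. The trace of `Φ` is left unconstrained (`IsPath Q 0`), so that
convex combinations of paths are covered. -/
structure IsCutoff (Q : Matrix (Fin m) (Fin m) ℝ) (μ : Measure ℝ)
    (Φ : ℝ → Matrix (Fin m) (Fin m) ℝ) (T : ℝ) : Prop where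
  isOrderMeasure : IsOrderMeasure m μ
  isPath : IsPath Q 0 Φ
  topPoint_lt : topPoint m μ < T
  lt : T < m
  posDef : (Q - Φ T).PosDef

section Resolvent

variable {T t : ℝ}

theorem IsCutoff.pos (hT : IsCutoff Q μ Φ T) : 0 < T :=
  (topPoint_nonneg m μ).trans_lt hT.topPoint_lt

theorem IsCutoff.Icc_subset (hT : IsCutoff Q μ Φ T) : Icc 0 T ⊆ Icc (0 : ℝ) m :=
  Icc_subset_Icc_right hT.lt.le

theorem IsCutoff.posDef_hatPath (hT : IsCutoff Q μ Φ T) (ht : t ∈ Icc 0 T) :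
    (hatPath μ Φ t).PosDef := by
  have hsub := hT.isPath.posSemidef_hatPath_sub hT.isOrderMeasure (hT.Icc_subset ht)
    (hT.Icc_subset ⟨hT.pos.le, le_rfl⟩) ht.2
  have hadd := hT.posDef.add_posSemidef hsub
  rwa [hT.isPath.hatPath_eq_sub hT.isOrderMeasure hT.topPoint_lt hT.lt.le, add_sub_cancel] at hadd

theorem IsCutoff.isUnit_det_hatPath (hT : IsCutoff Q μ Φ T) (ht : t ∈ Icc 0 T) :
    IsUnit (hatPath μ Φ t).det :=
  (Matrix.isUnit_iff_isUnit_det _).1 (hT.posDef_hatPath ht).isUnit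

theorem IsCutoff.continuousOn_hatPath (hT : IsCutoff Q μ Φ T) :
    ContinuousOn (hatPath μ Φ) (Icc 0 T) :=
  (hT.isPath.continuousOn_hatPath hT.isOrderMeasure).mono hT.Icc_subset

theorem IsCutoff.continuousOn_inv_hatPath (hT : IsCutoff Q μ Φ T) :
    ContinuousOn (fun t => (hatPath μ Φ t)⁻¹) (Icc 0 T) :=
  continuousOn_matrix_inv hT.continuousOn_hatPath fun _ => hT.isUnit_det_hatPath

theorem IsCutoff.hasDerivWithinAt_inv_hatPath (hT : IsCutoff Q μ Φ T) (ht : t ∈ Ico 0 T) :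
    HasDerivWithinAt (fun t => (hatPath μ Φ t)⁻¹)
      (orderParam μ t • ((hatPath μ Φ t)⁻¹ * pathDeriv Φ t * (hatPath μ Φ t)⁻¹)) (Ici t) t :=
  (hasDerivWithinAt_matrix_inv
    (hT.isPath.hasDerivWithinAt_hatPath hT.isOrderMeasure ⟨ht.1, ht.2.trans hT.lt⟩)
    (hT.isUnit_det_hatPath ⟨ht.1, ht.2.le⟩)).congr_deriv (by simp)

/-- The path `∫_0^t Φ̂⁻¹ Φ' Φ̂⁻¹`, which collects the variation of the entropy part of the
functional. -/
noncomputable def responsePath (μ : Measure ℝ) (Φ : ℝ → Matrix (Fin m) (Fin m) ℝ) (t : ℝ) :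
    Matrix (Fin m) (Fin m) ℝ :=
  Matrix.of fun i j =>
    ∫ s in 0..t, ((hatPath μ Φ s)⁻¹ * pathDeriv Φ s * (hatPath μ Φ s)⁻¹) i j

theorem responsePath_zero (μ : Measure ℝ) (Φ : ℝ → Matrix (Fin m) (Fin m) ℝ) :
    responsePath μ Φ 0 = 0 := by
  ext i j
  simp [responsePath]

theorem IsCutoff.continuousOn_responseDeriv (hT : IsCutoff Q μ Φ T) :
    ContinuousOn (fun t => (hatPath μ Φ t)⁻¹ * pathDeriv Φ t * (hatPath μ Φ t)⁻¹) (Icc 0 T) :=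
  (hT.continuousOn_inv_hatPath.mul (hT.isPath.continuousOn_pathDeriv.mono hT.Icc_subset)).mul
    hT.continuousOn_inv_hatPath

theorem IsCutoff.hasDerivWithinAt_responsePath (hT : IsCutoff Q μ Φ T) (ht : t ∈ Icc 0 T) :
    HasDerivWithinAt (responsePath μ Φ)
      ((hatPath μ Φ t)⁻¹ * pathDeriv Φ t * (hatPath μ Φ t)⁻¹) (Icc 0 T) t := by
  refine hasDerivWithinAt_matrix_iff.2 fun i j => ?_
  have hc := continuousOn_apply hT.continuousOn_responseDeriv i j
  have : Fact (t ∈ Icc 0 T) := ⟨ht⟩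
  exact intervalIntegral.integral_hasDerivWithinAt_right
    (hc.mono (uIcc_subset_Icc ⟨le_rfl, hT.pos.le⟩ ht)).intervalIntegrable
    (s := Icc 0 T) (t := Icc 0 T)
    ⟨Icc 0 T, self_mem_nhdsWithin, hc.aestronglyMeasurable measurableSet_Icc⟩ (hc t ht)

theorem IsCutoff.isHermitian_responsePath (hT : IsCutoff Q μ Φ T) (ht : t ∈ Icc 0 T) :
    (responsePath μ Φ t).IsHermitian := by
  refine .ext fun i j => intervalIntegral.integral_congr fun s hs => ?_
  have hs' : s ∈ Icc 0 T := uIcc_subset_Icc ⟨le_rfl, hT.pos.le⟩ ht hs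
  exact symm_apply (posSemidef_conj (hT.isPath.posSemidef_pathDeriv (hT.Icc_subset hs'))
    (hT.posDef_hatPath hs').inv.isHermitian).isHermitian j i

end Resolvent

section Gradient

variable {T t : ℝ} {β : ℕ → Fin m → ℝ} {h : Fin m → ℝ}

/-- The matrix `G = ξ'(Φ) + h hᵀ - ∫_0^t Φ̂⁻¹ Φ' Φ̂⁻¹`, which represents the first variation of the
functional in the path: it is `-(1/2) ∫ ⟨G, Ψ⟩ dμ` in the direction `Ψ`. -/
noncomputable def gradPath (β : ℕ → Fin m → ℝ) (h : Fin m → ℝ) (μ : Measure ℝ)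
    (Φ : ℝ → Matrix (Fin m) (Fin m) ℝ) (t : ℝ) : Matrix (Fin m) (Fin m) ℝ :=
  xiDeriv β 1 (Φ t) + Matrix.vecMulVec h h - responsePath μ Φ t

theorem IsPath.hasDerivWithinAt_xiDeriv (hΦ : IsPath Q κ Φ) (hβ : IsMixed β)
    (hQ : IsConstraint Q) (r : ℕ) (ht : t ∈ Icc (0 : ℝ) m) :
    HasDerivWithinAt (fun t => xiDeriv β r (Φ t)) (xiDeriv β (r + 1) (Φ t) ⊙ pathDeriv Φ t)
      (Icc (0 : ℝ) m) t := by
  refine hasDerivWithinAt_matrix_iff.2 fun i j => ?_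
  have hxi := hβ.hasDerivAt_xiEntry r i j (abs_le.2 (hΦ.apply_mem_Icc hQ ht i j))
  exact hxi.comp_hasDerivWithinAt t (hasDerivWithinAt_matrix_iff.1 (hΦ.hasDerivWithinAt ht) i j)

theorem IsPath.posSemidef_xiDeriv (hΦ : IsPath Q κ Φ) (hβ : IsMixed β) (hQ : IsConstraint Q)
    (r : ℕ) (ht : t ∈ Icc (0 : ℝ) m) : (xiDeriv β r (Φ t)).PosSemidef :=
  hβ.posSemidef_xiDeriv r (hΦ.posSemidef t ht) (hΦ.apply_mem_Icc hQ ht)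

theorem posSemidef_vecMulVec_self (h : Fin m → ℝ) : (Matrix.vecMulVec h h).PosSemidef := by
  simpa using Matrix.posSemidef_vecMulVec_self_star h

theorem IsCutoff.hasDerivWithinAt_gradPath (hT : IsCutoff Q μ Φ T) (hβ : IsMixed β)
    (hQ : IsConstraint Q) (ht : t ∈ Icc 0 T) :
    HasDerivWithinAt (gradPath β h μ Φ)
      (xiDeriv β 2 (Φ t) ⊙ pathDeriv Φ t -
        (hatPath μ Φ t)⁻¹ * pathDeriv Φ t * (hatPath μ Φ t)⁻¹) (Icc 0 T) t :=
  (((hT.isPath.hasDerivWithinAt_xiDeriv hβ hQ 1 (hT.Icc_subset ht)).mono hT.Icc_subset).add_const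
    _).fun_sub (hT.hasDerivWithinAt_responsePath ht)

theorem IsCutoff.isHermitian_gradPath (hT : IsCutoff Q μ Φ T) (hβ : IsMixed β)
    (hQ : IsConstraint Q) (ht : t ∈ Icc 0 T) : (gradPath β h μ Φ t).IsHermitian :=
  (((hT.isPath.posSemidef_xiDeriv hβ hQ 1 (hT.Icc_subset ht)).isHermitian.add
    (posSemidef_vecMulVec_self h).isHermitian)).sub (hT.isHermitian_responsePath ht)

theorem IsPath.posSemidef_gradPath_zero (hΦ : IsPath Q κ Φ) (hβ : IsMixed β)
    (hQ : IsConstraint Q) : (gradPath β h μ Φ 0).PosSemidef := by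
  rw [gradPath, responsePath_zero, sub_zero]
  exact (hΦ.posSemidef_xiDeriv hβ hQ 1 (left_mem_Icc_natCast m)).add (posSemidef_vecMulVec_self h)

end Gradient

end Paths

/-! ### Change of time and convex combinations of paths -/

section Reparametrization

section Lipschitz

variable {X ι : Type*} [PseudoMetricSpace X] {s : Set X} {f g : X → ℝ}

theorem lipschitzOnWith_congr {K : NNReal} (hf : LipschitzOnWith K f s) (hfg : EqOn g f s) :
    LipschitzOnWith K g s := fun x hx y hy => by
  rw [hfg hx, hfg hy]
  exact hf hx hy

theorem exists_lipschitzOnWith_iff :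
    (∃ K, LipschitzOnWith K f s) ↔ ∃ K : ℝ, ∀ x ∈ s, ∀ y ∈ s, |f x - f y| ≤ K * dist x y := by
  constructor
  · rintro ⟨K, hK⟩
    exact ⟨K, fun x hx y hy => hK.dist_le_mul x hx y hy⟩
  · rintro ⟨K, hK⟩
    refine ⟨K.toNNReal, LipschitzOnWith.of_dist_le_mul fun x hx y hy => ?_⟩
    exact (hK x hx y hy).trans (mul_le_mul_of_nonneg_right (Real.le_coe_toNNReal K) dist_nonneg)

theorem exists_lipschitzOnWith_mul (hs : IsCompact s) (hf : ∃ K, LipschitzOnWith K f s)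
    (hg : ∃ K, LipschitzOnWith K g s) : ∃ K, LipschitzOnWith K (fun x => f x * g x) s := by
  obtain ⟨A, hA⟩ := hs.exists_bound_of_continuousOn hf.choose_spec.continuousOn
  obtain ⟨B, hB⟩ := hs.exists_bound_of_continuousOn hg.choose_spec.continuousOn
  obtain ⟨K, hK⟩ := exists_lipschitzOnWith_iff.1 hf
  obtain ⟨L, hL⟩ := exists_lipschitzOnWith_iff.1 hg
  refine exists_lipschitzOnWith_iff.2 ⟨A * L + B * K, fun x hx y hy => ?_⟩
  calc |f x * g x - f y * g y| = |f x * (g x - g y) + g y * (f x - f y)| := by ring_nf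
    _ ≤ |f x| * |g x - g y| + |g y| * |f x - f y| := by
        rw [← abs_mul, ← abs_mul]
        exact abs_add_le _ _
    _ ≤ A * (L * dist x y) + B * (K * dist x y) :=
        add_le_add
          (mul_le_mul (hA x hx) (hL x hx y hy) (abs_nonneg _) ((norm_nonneg _).trans (hA x hx)))
          (mul_le_mul (hB y hy) (hK x hx y hy) (abs_nonneg _) ((norm_nonneg _).trans (hB y hy)))
    _ = (A * L + B * K) * dist x y := by ring

theorem exists_lipschitzOnWith_inv (hs : IsCompact s) (hf₀ : ∀ x ∈ s, f x ≠ 0)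
    (hf : ∃ K, LipschitzOnWith K f s) : ∃ K, LipschitzOnWith K (fun x => (f x)⁻¹) s := by
  obtain ⟨C, hC⟩ := hs.exists_bound_of_continuousOn (hf.choose_spec.continuousOn.inv₀ hf₀)
  obtain ⟨K, hK⟩ := exists_lipschitzOnWith_iff.1 hf
  refine exists_lipschitzOnWith_iff.2 ⟨C * C * K, fun x hx y hy => ?_⟩
  have hC₀ : 0 ≤ C := (norm_nonneg _).trans (hC x hx)
  calc |(f x)⁻¹ - (f y)⁻¹| = |(f x)⁻¹| * |(f y)⁻¹| * |f x - f y| := by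
        rw [inv_sub_inv (hf₀ x hx) (hf₀ y hy), abs_div, abs_sub_comm, abs_mul, abs_inv, abs_inv,
          div_eq_inv_mul, mul_inv]
    _ ≤ C * C * (K * dist x y) :=
        mul_le_mul (mul_le_mul (hC x hx) (hC y hy) (abs_nonneg _) hC₀) (hK x hx y hy)
          (abs_nonneg _) (mul_nonneg hC₀ hC₀)
    _ = C * C * K * dist x y := by ring

theorem exists_forall_lipschitzOnWith [Finite ι] {f : ι → X → ℝ}
    (hf : ∀ i, ∃ K, LipschitzOnWith K (f i) s) : ∃ K, ∀ i, LipschitzOnWith K (f i) s := by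
  choose K hK using hf
  obtain ⟨L, hL⟩ := (finite_range K).bddAbove
  exact ⟨L, fun i => (hK i).weaken (hL (mem_range_self i))⟩

theorem exists_lipschitzOnWith_sum [Fintype ι] {f : ι → X → ℝ}
    (hf : ∀ i, ∃ K, LipschitzOnWith K (f i) s) :
    ∃ K, LipschitzOnWith K (fun x => ∑ i, f i x) s := by
  choose K hK using hf
  refine exists_lipschitzOnWith_iff.2 ⟨∑ i, (K i : ℝ), fun x hx y hy => ?_⟩
  rw [← Finset.sum_sub_distrib, Finset.sum_mul]
  exact (Finset.abs_sum_le_sum_abs _ _).trans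
    (Finset.sum_le_sum fun i _ => (hK i).dist_le_mul x hx y hy)

theorem exists_orderIso_eq_add {g : ℝ → ℝ} {K : NNReal} (hK : K < 1) (hg : LipschitzWith K g) :
    ∃ τ : ℝ ≃o ℝ, ∀ t, τ t = t + g t := by
  have hgrowth : ∀ s t, s ≤ t → (1 - K) * (t - s) ≤ t + g t - (s + g s) := fun s t hst => by
    have hdist := (abs_le.1 (hg.dist_le_mul t s)).1
    rw [Real.dist_eq, abs_of_nonneg (sub_nonneg.2 hst)] at hdist
    linarith
  have hK' : (0 : ℝ) < 1 - K := sub_pos.2 hK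
  have hmono : StrictMono fun t => t + g t := fun s t hst =>
    sub_pos.1 ((mul_pos hK' (sub_pos.2 hst)).trans_le (hgrowth s t hst.le))
  have htop : Filter.Tendsto (fun t : ℝ => (1 - K) * t + g 0) Filter.atTop Filter.atTop :=
    Filter.tendsto_atTop_add_const_right _ _ (Filter.tendsto_id.const_mul_atTop hK')
  have hbot : Filter.Tendsto (fun t : ℝ => (1 - K) * t + g 0) Filter.atBot Filter.atBot :=
    Filter.tendsto_atBot_add_const_right _ _ (Filter.tendsto_id.const_mul_atBot hK')
  refine ⟨hmono.orderIsoOfSurjective _ ((continuous_id.add hg.continuous).surjective ?_ ?_),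
    fun t => rfl⟩
  · refine Filter.tendsto_atTop_mono' _ ?_ htop
    filter_upwards [Filter.eventually_ge_atTop 0] with t ht
    have := hgrowth 0 t ht
    simp only [Pi.add_apply, id_eq]
    linarith
  · refine Filter.tendsto_atBot_mono' _ ?_ hbot
    filter_upwards [Filter.eventually_le_atBot 0] with t ht
    have := hgrowth t 0 ht
    simp only [Pi.add_apply, id_eq]
    linarith

end Lipschitz

variable {m : ℕ} {μ κ κ' : Measure ℝ} {Q : Matrix (Fin m) (Fin m) ℝ}
  {Φ Φ₁ : ℝ → Matrix (Fin m) (Fin m) ℝ}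

theorem hasDerivWithinAt_trace {n : Type*} [Fintype n] {F : ℝ → Matrix n n ℝ} {F' : Matrix n n ℝ}
    {s : Set ℝ} {t : ℝ} (hF : HasDerivWithinAt F F' s t) :
    HasDerivWithinAt (fun y => (F y).trace) F'.trace s t :=
  HasDerivWithinAt.fun_sum fun i _ => hasDerivWithinAt_matrix_iff.1 hF i i

theorem pathDeriv_eq_of_hasDerivWithinAt {F : ℝ → Matrix (Fin m) (Fin m) ℝ}
    {F' : Matrix (Fin m) (Fin m) ℝ} {t : ℝ} (ht : t ∈ Icc (0 : ℝ) m)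
    (hF : HasDerivWithinAt F F' (Icc (0 : ℝ) m) t) : pathDeriv F t = F' := by
  ext i j
  have hm : (0 : ℝ) < m := Nat.cast_pos.2 i.pos
  exact (hasDerivWithinAt_matrix_iff.1 hF i j).derivWithin (uniqueDiffOn_Icc hm t ht)

theorem IsPath.exists_lipschitzOnWith_trace (hΦ : IsPath Q κ Φ) :
    ∃ K, LipschitzOnWith K (fun t => (pathDeriv Φ t).trace) (Icc (0 : ℝ) m) :=
  exists_lipschitzOnWith_sum fun i => hΦ.lipschitz_deriv.imp fun _ hK => hK i i

theorem IsPath.posSemidef_sub (hΦ : IsPath Q κ Φ) {t : ℝ} (ht : t ∈ Icc (0 : ℝ) m) :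
    (Q - Φ t).PosSemidef := by
  simpa only [hΦ.top] using hΦ.monotone t ht m (right_mem_Icc_natCast m) ht.2

section Cutoff

variable {T t : ℝ}

theorem IsCutoff.posDef_sub (hT : IsCutoff Q μ Φ T) (ht : t ∈ Icc 0 T) : (Q - Φ t).PosDef := by
  have hsub := hT.isPath.monotone t (hT.Icc_subset ht) T (hT.Icc_subset ⟨hT.pos.le, le_rfl⟩) ht.2
  simpa only [sub_add_sub_cancel] using hT.posDef.add_posSemidef hsub

theorem IsCutoff.mem_cutoffs (hT : IsCutoff Q μ Φ T) : T ∈ cutoffs μ Φ :=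
  ⟨hT.topPoint_lt, hT.lt, by rw [hT.isPath.top]; exact hT.posDef.det_pos⟩

end Cutoff

theorem map_orderIso_apply (μ : Measure ℝ) (τ : ℝ ≃o ℝ) (s : Set ℝ) :
    μ.map τ s = μ (τ ⁻¹' s) :=
  τ.toHomeomorph.toMeasurableEquiv.map_apply s

theorem symm_apply_mem_support {τ : ℝ ≃o ℝ} {s : ℝ} (hs : s ∈ (μ.map τ).support) :
    τ.symm s ∈ μ.support := by
  rw [Measure.mem_support_iff_forall] at hs ⊢
  intro U hU
  have hpos := hs (τ.symm ⁻¹' U) (τ.symm.continuous.continuousAt.preimage_mem_nhds hU)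
  have hid : τ.symm ∘ τ = id := funext τ.symm_apply_apply
  rwa [map_orderIso_apply, ← preimage_comp, hid, preimage_id] at hpos

/-- A time change of `[0,m]` of class `C^{1,1}` with positive derivative `τ'`. It is an order
isomorphism of the whole line, so that order measures can be pushed forward along it. -/
structure IsTimeChange (m : ℕ) (τ : ℝ ≃o ℝ) (τ' : ℝ → ℝ) : Prop where
  map_zero : τ 0 = 0
  map_top : τ m = m
  hasDerivWithinAt : ∀ t ∈ Icc (0 : ℝ) m, HasDerivWithinAt τ (τ' t) (Icc (0 : ℝ) m) t
  deriv_pos : ∀ t ∈ Icc (0 : ℝ) m, 0 < τ' t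
  lipschitz_deriv : ∃ K, LipschitzOnWith K τ' (Icc (0 : ℝ) m)

namespace IsTimeChange

variable {τ : ℝ ≃o ℝ} {τ' : ℝ → ℝ} {s t T : ℝ}

theorem symm_zero (hτ : IsTimeChange m τ τ') : τ.symm 0 = 0 := by
  rw [OrderIso.symm_apply_eq, hτ.map_zero]

theorem symm_top (hτ : IsTimeChange m τ τ') : τ.symm m = m := by
  rw [OrderIso.symm_apply_eq, hτ.map_top]

theorem apply_mem_Icc (hτ : IsTimeChange m τ τ') (ht : t ∈ Icc (0 : ℝ) m) :
    τ t ∈ Icc (0 : ℝ) m :=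
  ⟨hτ.map_zero ▸ τ.monotone ht.1, (τ.monotone ht.2).trans_eq hτ.map_top⟩

theorem symm_apply_mem_Icc (hτ : IsTimeChange m τ τ') (hs : s ∈ Icc (0 : ℝ) m) :
    τ.symm s ∈ Icc (0 : ℝ) m :=
  ⟨hτ.symm_zero ▸ τ.symm.monotone hs.1, (τ.symm.monotone hs.2).trans_eq hτ.symm_top⟩

theorem hasDerivWithinAt_symm (hτ : IsTimeChange m τ τ') (hs : s ∈ Icc (0 : ℝ) m) :
    HasDerivWithinAt τ.symm (τ' (τ.symm s))⁻¹ (Icc (0 : ℝ) m) s := by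
  have hs' := hτ.symm_apply_mem_Icc hs
  have hslope := hasDerivWithinAt_iff_tendsto_slope.1 (hτ.hasDerivWithinAt _ hs')
  have hsymm : Filter.Tendsto τ.symm (nhdsWithin s (Icc (0 : ℝ) m \ {s}))
      (nhdsWithin (τ.symm s) (Icc (0 : ℝ) m \ {τ.symm s})) :=
    τ.symm.continuous.continuousWithinAt.tendsto_nhdsWithin fun y hy =>
      ⟨hτ.symm_apply_mem_Icc hy.1, fun h => hy.2 (τ.symm.injective h)⟩
  refine hasDerivWithinAt_iff_tendsto_slope.2
    (((hslope.comp hsymm).inv₀ (hτ.deriv_pos _ hs').ne').congr fun y => ?_)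
  simp [slope_def_field]

theorem continuousOn_deriv_symm (hτ : IsTimeChange m τ τ') :
    ContinuousOn (fun s => (τ' (τ.symm s))⁻¹) (Icc (0 : ℝ) m) := by
  have hcont := hτ.lipschitz_deriv.choose_spec.continuousOn
  exact (hcont.comp τ.symm.continuous.continuousOn fun _ hs => hτ.symm_apply_mem_Icc hs).inv₀
    fun s hs => (hτ.deriv_pos _ (hτ.symm_apply_mem_Icc hs)).ne'

theorem exists_lipschitzOnWith_symm (hτ : IsTimeChange m τ τ') :
    ∃ K, LipschitzOnWith K τ.symm (Icc (0 : ℝ) m) := by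
  obtain ⟨C, hC⟩ := isCompact_Icc.exists_bound_of_continuousOn hτ.continuousOn_deriv_symm
  exact ⟨C.toNNReal, (convex_Icc (0 : ℝ) m).lipschitzOnWith_of_nnnorm_hasDerivWithin_le
    (fun s hs => hτ.hasDerivWithinAt_symm hs) fun s hs =>
      NNReal.coe_le_coe.1 ((hC s hs).trans (Real.le_coe_toNNReal C))⟩

theorem hasDerivWithinAt_comp_symm (hτ : IsTimeChange m τ τ') (hΦ : IsPath Q κ Φ)
    (hs : s ∈ Icc (0 : ℝ) m) :
    HasDerivWithinAt (fun y => Φ (τ.symm y)) ((τ' (τ.symm s))⁻¹ • pathDeriv Φ (τ.symm s))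
      (Icc (0 : ℝ) m) s :=
  (hΦ.hasDerivWithinAt (hτ.symm_apply_mem_Icc hs)).scomp s (hτ.hasDerivWithinAt_symm hs)
    fun _ hy => hτ.symm_apply_mem_Icc hy

theorem pathDeriv_comp_symm (hτ : IsTimeChange m τ τ') (hΦ : IsPath Q κ Φ)
    (hs : s ∈ Icc (0 : ℝ) m) :
    pathDeriv (fun y => Φ (τ.symm y)) s = (τ' (τ.symm s))⁻¹ • pathDeriv Φ (τ.symm s) :=
  pathDeriv_eq_of_hasDerivWithinAt hs (hτ.hasDerivWithinAt_comp_symm hΦ hs)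

theorem smul_pathDeriv_comp_symm (hτ : IsTimeChange m τ τ') (hΦ : IsPath Q κ Φ)
    (ht : t ∈ Icc (0 : ℝ) m) :
    τ' t • pathDeriv (fun y => Φ (τ.symm y)) (τ t) = pathDeriv Φ t := by
  rw [hτ.pathDeriv_comp_symm hΦ (hτ.apply_mem_Icc ht), τ.symm_apply_apply, smul_smul,
    mul_inv_cancel₀ (hτ.deriv_pos t ht).ne', one_smul]

theorem exists_lipschitzOnWith_pathDeriv_comp_symm (hτ : IsTimeChange m τ τ')
    (hΦ : IsPath Q κ Φ) (i j : Fin m) :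
    ∃ K, LipschitzOnWith K (fun s => pathDeriv (fun y => Φ (τ.symm y)) s i j)
      (Icc (0 : ℝ) m) := by
  have hmaps : MapsTo τ.symm (Icc (0 : ℝ) m) (Icc (0 : ℝ) m) := fun s => hτ.symm_apply_mem_Icc
  obtain ⟨K, hK⟩ := hΦ.lipschitz_deriv
  obtain ⟨L, hL⟩ := hτ.exists_lipschitzOnWith_symm
  obtain ⟨N, hN⟩ := exists_lipschitzOnWith_inv isCompact_Icc
    (fun t ht => (hτ.deriv_pos t ht).ne') hτ.lipschitz_deriv
  obtain ⟨M, hM⟩ := exists_lipschitzOnWith_mul isCompact_Icc ⟨_, hN.comp hL hmaps⟩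
    ⟨_, (hK i j).comp hL hmaps⟩
  refine ⟨M, lipschitzOnWith_congr hM fun s hs => ?_⟩
  rw [hτ.pathDeriv_comp_symm hΦ hs]
  rfl

theorem orderParam_map (hτ : IsTimeChange m τ τ') (μ : Measure ℝ) (t : ℝ) :
    orderParam (μ.map τ) (τ t) = orderParam μ t := by
  rw [orderParam, orderParam, measureReal_def, measureReal_def, map_orderIso_apply, τ.preimage_Icc,
    hτ.symm_zero, τ.symm_apply_apply]

theorem topPoint_map (hτ : IsTimeChange m τ τ') (hμ : IsOrderMeasure m μ) :
    topPoint m (μ.map τ) = τ (topPoint m μ) := by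
  have hset : {t | t ∈ Icc (0 : ℝ) m ∧ orderParam (μ.map τ) t = 1} =
      τ '' {t | t ∈ Icc (0 : ℝ) m ∧ orderParam μ t = 1} := by
    ext s
    constructor
    · rintro ⟨hs, hs1⟩
      refine ⟨τ.symm s, ⟨hτ.symm_apply_mem_Icc hs, ?_⟩, τ.apply_symm_apply s⟩
      rw [← hτ.orderParam_map, τ.apply_symm_apply, hs1]
    · rintro ⟨t, ⟨ht, ht1⟩, rfl⟩
      exact ⟨hτ.apply_mem_Icc ht, by rw [hτ.orderParam_map, ht1]⟩
  have hne : {t | t ∈ Icc (0 : ℝ) m ∧ orderParam μ t = 1}.Nonempty :=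
    ⟨m, right_mem_Icc_natCast m, hμ.orderParam_top⟩
  rw [topPoint, hset, topPoint, τ.map_csInf' hne ⟨0, fun t ht => ht.1.1⟩]

theorem isOrderMeasure_map (hτ : IsTimeChange m τ τ') (hμ : IsOrderMeasure m μ) :
    IsOrderMeasure m (μ.map τ) where
  isProbabilityMeasure :=
    have := hμ.isProbabilityMeasure
    Measure.isProbabilityMeasure_map τ.continuous.measurable.aemeasurable
  compl_eq_zero := by
    rw [map_orderIso_apply, preimage_compl, τ.preimage_Icc, hτ.symm_zero, hτ.symm_top]
    exact hμ.compl_eq_zero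
  orderParam_zero := by
    have h := hτ.orderParam_map μ 0
    rwa [hτ.map_zero, hμ.orderParam_zero] at h

theorem isPath_comp_symm (hτ : IsTimeChange m τ τ') (hΦ : IsPath Q κ Φ)
    (htr : ∀ t ∈ μ.support, (Φ t).trace = τ t) :
    IsPath Q (μ.map τ) (fun y => Φ (τ.symm y)) where
  posSemidef s hs := hΦ.posSemidef _ (hτ.symm_apply_mem_Icc hs)
  monotone s hs t ht hst := hΦ.monotone _ (hτ.symm_apply_mem_Icc hs) _ (hτ.symm_apply_mem_Icc ht)
    (τ.symm.monotone hst)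
  zero := by rw [hτ.symm_zero, hΦ.zero]
  top := by rw [hτ.symm_top, hΦ.top]
  differentiable i j s hs := (hasDerivWithinAt_matrix_iff.1
    (hτ.hasDerivWithinAt_comp_symm hΦ hs) i j).differentiableWithinAt
  lipschitz_deriv := by
    obtain ⟨K, hK⟩ := exists_forall_lipschitzOnWith fun p : Fin m × Fin m =>
      hτ.exists_lipschitzOnWith_pathDeriv_comp_symm hΦ p.1 p.2
    exact ⟨K, fun i j => hK (i, j)⟩
  trace_eq s hs := by rw [htr _ (symm_apply_mem_support hs), τ.apply_symm_apply]

theorem isAdmissible (hτ : IsTimeChange m τ τ') (hT : IsCutoff Q μ Φ T)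
    (htr : ∀ t ∈ μ.support, (Φ t).trace = τ t) :
    IsAdmissible Q (μ.map τ) (fun y => Φ (τ.symm y)) where
  isOrderMeasure := hτ.isOrderMeasure_map hT.isOrderMeasure
  isPath := hτ.isPath_comp_symm hT.isPath htr
  topPoint_lt := by
    rw [hτ.topPoint_map hT.isOrderMeasure]
    exact (τ.strictMono (hT.topPoint_lt.trans hT.lt)).trans_eq hτ.map_top
  det_pos := by
    rw [hτ.topPoint_map hT.isOrderMeasure, τ.symm_apply_apply]
    exact (hT.posDef_sub ⟨topPoint_nonneg m μ, hT.topPoint_lt.le⟩).det_pos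

theorem apply_mem_cutoffs (hτ : IsTimeChange m τ τ') (hT : IsCutoff Q μ Φ T) :
    τ T ∈ cutoffs (μ.map τ) (fun y => Φ (τ.symm y)) := by
  refine ⟨?_, (τ.strictMono hT.lt).trans_eq hτ.map_top, ?_⟩
  · rw [hτ.topPoint_map hT.isOrderMeasure]
    exact τ.strictMono hT.topPoint_lt
  · simpa only [hτ.symm_top, τ.symm_apply_apply] using hT.mem_cutoffs.2.2

theorem integral_comp (hτ : IsTimeChange m τ τ') {a b : ℝ} (ha : 0 ≤ a) (hab : a ≤ b)
    (hb : b ≤ m) (g : ℝ → ℝ) :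
    ∫ s in τ a..τ b, g s = ∫ t in a..b, τ' t * g (τ t) := by
  have hsub : Icc a b ⊆ Icc (0 : ℝ) m := Icc_subset_Icc ha hb
  rw [intervalIntegral.integral_of_le (τ.monotone hab), intervalIntegral.integral_of_le hab,
    ← integral_Icc_eq_integral_Ioc, ← integral_Icc_eq_integral_Ioc, ← τ.image_Icc,
    integral_image_eq_integral_abs_deriv_smul measurableSet_Icc
      (fun t ht => (hτ.hasDerivWithinAt t (hsub ht)).mono hsub) τ.injective.injOn]
  refine setIntegral_congr_fun measurableSet_Icc fun t ht => ?_
  simp only [smul_eq_mul, abs_of_pos (hτ.deriv_pos t (hsub ht))]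

theorem hatPath_map (hτ : IsTimeChange m τ τ') (hΦ : IsPath Q κ Φ) (ht : t ∈ Icc (0 : ℝ) m) :
    hatPath (μ.map τ) (fun y => Φ (τ.symm y)) (τ t) = hatPath μ Φ t := by
  ext i j
  simp only [hatPath, Matrix.of_apply]
  conv_lhs => rw [← hτ.map_top]
  rw [hτ.integral_comp ht.1 ht.2 le_rfl]
  refine intervalIntegral.integral_congr fun s hs => ?_
  have hs' : s ∈ Icc (0 : ℝ) m := uIcc_subset_Icc ht (right_mem_Icc_natCast m) hs
  simp only [hτ.orderParam_map, ← hτ.smul_pathDeriv_comp_symm hΦ hs', Matrix.smul_apply,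
    smul_eq_mul]
  ring

theorem csFunctional_map (hτ : IsTimeChange m τ τ') (hΦ : IsPath Q κ Φ)
    (hT : T ∈ Icc (0 : ℝ) m) (β : ℕ → Fin m → ℝ) (h : Fin m → ℝ) :
    csFunctional β h (μ.map τ) (fun y => Φ (τ.symm y)) (τ T) = csFunctional β h μ Φ T := by
  have hpotential : ∫ t in (0 : ℝ)..m, orderParam (μ.map τ) t *
        frob (xiDeriv β 1 (Φ (τ.symm t)) + Matrix.vecMulVec h h)
          (pathDeriv (fun y => Φ (τ.symm y)) t) =
      ∫ t in (0 : ℝ)..m, orderParam μ t *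
        frob (xiDeriv β 1 (Φ t) + Matrix.vecMulVec h h) (pathDeriv Φ t) := by
    conv_lhs => rw [← hτ.map_top, ← hτ.map_zero]
    rw [hτ.integral_comp le_rfl m.cast_nonneg le_rfl]
    refine intervalIntegral.integral_congr fun s hs => ?_
    have hs' : s ∈ Icc (0 : ℝ) m := by rwa [uIcc_of_le m.cast_nonneg] at hs
    simp only [hτ.orderParam_map, τ.symm_apply_apply]
    rw [← hτ.smul_pathDeriv_comp_symm hΦ hs', frob_smul_right]
    ring
  have hentropy : ∫ t in (0 : ℝ)..τ T, frob (hatPath (μ.map τ) (fun y => Φ (τ.symm y)) t)⁻¹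
        (pathDeriv (fun y => Φ (τ.symm y)) t) =
      ∫ t in (0 : ℝ)..T, frob (hatPath μ Φ t)⁻¹ (pathDeriv Φ t) := by
    conv_lhs => rw [← hτ.map_zero]
    rw [hτ.integral_comp le_rfl hT.1 hT.2]
    refine intervalIntegral.integral_congr fun s hs => ?_
    have hs' : s ∈ Icc (0 : ℝ) m := uIcc_subset_Icc (left_mem_Icc_natCast m) hT hs
    simp only [hτ.hatPath_map hΦ hs', ← hτ.smul_pathDeriv_comp_symm hΦ hs', frob_smul_right]
  simp only [csFunctional]
  rw [hpotential, hentropy, hτ.symm_top, τ.symm_apply_apply]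

end IsTimeChange

theorem exists_isTimeChange_eq_add {e e' : ℝ → ℝ}
    (he : ∀ t ∈ Icc (0 : ℝ) m, HasDerivWithinAt e (e' t) (Icc (0 : ℝ) m) t)
    (he₀ : e 0 = 0) (hem : e m = 0) (hbd : ∀ t ∈ Icc (0 : ℝ) m, |e' t| ≤ 1 / 2)
    (hlip : ∃ K, LipschitzOnWith K e' (Icc (0 : ℝ) m)) :
    ∃ τ : ℝ ≃o ℝ, IsTimeChange m τ (fun t => 1 + e' t) ∧
      ∀ t ∈ Icc (0 : ℝ) m, τ t = t + e t := by
  have heLip : LipschitzOnWith (1 / 2) e (Icc (0 : ℝ) m) :=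
    (convex_Icc (0 : ℝ) m).lipschitzOnWith_of_nnnorm_hasDerivWithin_le he fun t ht =>
      NNReal.coe_le_coe.1 (by simpa using hbd t ht)
  obtain ⟨g, hg, heg⟩ := heLip.extend_real
  obtain ⟨τ, hτ⟩ := exists_orderIso_eq_add (by norm_num) hg
  have hτe : ∀ t ∈ Icc (0 : ℝ) m, τ t = t + e t := fun t ht => by rw [hτ, heg ht]
  refine ⟨τ, ⟨?_, ?_, fun t ht => ?_, fun t ht => ?_, ?_⟩, hτe⟩
  · rw [hτe 0 (left_mem_Icc_natCast m), he₀, add_zero]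
  · rw [hτe m (right_mem_Icc_natCast m), hem, add_zero]
  · exact ((hasDerivWithinAt_id t _).fun_add (he t ht)).congr hτe (hτe t ht)
  · linarith [(abs_le.1 (hbd t ht)).1]
  · exact hlip.elim fun K hK => ⟨_, (LipschitzWith.const (1 : ℝ)).lipschitzOnWith.add hK⟩

section Mix

variable {ε t T : ℝ}

/-- The convex combination `(1 - ε) Φ + ε Φ₁` of two paths. -/
def mixPath (Φ Φ₁ : ℝ → Matrix (Fin m) (Fin m) ℝ) (ε t : ℝ) : Matrix (Fin m) (Fin m) ℝ :=
  Φ t + ε • (Φ₁ t - Φ t)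

theorem mixPath_eq (Φ Φ₁ : ℝ → Matrix (Fin m) (Fin m) ℝ) (ε t : ℝ) :
    mixPath Φ Φ₁ ε t = (1 - ε) • Φ t + ε • Φ₁ t := by
  rw [mixPath]
  module

theorem hasDerivWithinAt_mixPath (hΦ : IsPath Q κ Φ) (hΦ₁ : IsPath Q κ' Φ₁) (ε : ℝ)
    (ht : t ∈ Icc (0 : ℝ) m) :
    HasDerivWithinAt (mixPath Φ Φ₁ ε) (pathDeriv Φ t + ε • (pathDeriv Φ₁ t - pathDeriv Φ t))
      (Icc (0 : ℝ) m) t :=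
  (hΦ.hasDerivWithinAt ht).fun_add
    (((hΦ₁.hasDerivWithinAt ht).fun_sub (hΦ.hasDerivWithinAt ht)).const_smul ε)

theorem pathDeriv_mixPath (hΦ : IsPath Q κ Φ) (hΦ₁ : IsPath Q κ' Φ₁) (ε : ℝ)
    (ht : t ∈ Icc (0 : ℝ) m) :
    pathDeriv (mixPath Φ Φ₁ ε) t = pathDeriv Φ t + ε • (pathDeriv Φ₁ t - pathDeriv Φ t) :=
  pathDeriv_eq_of_hasDerivWithinAt ht (hasDerivWithinAt_mixPath hΦ hΦ₁ ε ht)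

theorem isPath_mixPath (hΦ : IsPath Q κ Φ) (hΦ₁ : IsPath Q κ' Φ₁) (hε : ε ∈ Icc (0 : ℝ) 1) :
    IsPath Q 0 (mixPath Φ Φ₁ ε) where
  posSemidef t ht := by
    rw [mixPath_eq]
    exact ((hΦ.posSemidef t ht).smul (sub_nonneg.2 hε.2)).add ((hΦ₁.posSemidef t ht).smul hε.1)
  monotone s hs t ht hst := by
    have hsub : mixPath Φ Φ₁ ε t - mixPath Φ Φ₁ ε s =
        (1 - ε) • (Φ t - Φ s) + ε • (Φ₁ t - Φ₁ s) := by
      rw [mixPath_eq, mixPath_eq]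
      module
    rw [hsub]
    exact ((hΦ.monotone s hs t ht hst).smul (sub_nonneg.2 hε.2)).add
      ((hΦ₁.monotone s hs t ht hst).smul hε.1)
  zero := by simp [mixPath, hΦ.zero, hΦ₁.zero]
  top := by simp [mixPath, hΦ.top, hΦ₁.top]
  differentiable i j t ht := (hasDerivWithinAt_matrix_iff.1
    (hasDerivWithinAt_mixPath hΦ hΦ₁ ε ht) i j).differentiableWithinAt
  lipschitz_deriv := by
    obtain ⟨K, hK⟩ := hΦ.lipschitz_deriv
    obtain ⟨L, hL⟩ := hΦ₁.lipschitz_deriv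
    refine ⟨_, fun i j => lipschitzOnWith_congr ((hK i j).add
      ((lipschitzWith_smul ε).comp_lipschitzOnWith ((hL i j).sub (hK i j)))) fun t ht => ?_⟩
    rw [pathDeriv_mixPath hΦ hΦ₁ ε ht]
    rfl
  trace_eq := by simp

theorem IsCutoff.mixPath (hT : IsCutoff Q μ Φ T) (hΦ₁ : IsPath Q κ Φ₁) (hε : ε ∈ Ico (0 : ℝ) 1) :
    IsCutoff Q μ (mixPath Φ Φ₁ ε) T where
  isOrderMeasure := hT.isOrderMeasure
  isPath := isPath_mixPath hT.isPath hΦ₁ ⟨hε.1, hε.2.le⟩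
  topPoint_lt := hT.topPoint_lt
  lt := hT.lt
  posDef := by
    have hsub : Q - VectorSpin.mixPath Φ Φ₁ ε T = (1 - ε) • (Q - Φ T) + ε • (Q - Φ₁ T) := by
      rw [mixPath_eq]
      module
    rw [hsub]
    exact (hT.posDef.smul (sub_pos.2 hε.2)).add_posSemidef
      ((hΦ₁.posSemidef_sub (hT.Icc_subset ⟨hT.pos.le, le_rfl⟩)).smul hε.1)

theorem eventually_exists_isTimeChange_mixPath (hΦ : IsPath Q κ Φ) (hΦ₁ : IsPath Q κ' Φ₁) :
    ∀ᶠ ε in nhdsWithin 0 (Ioi 0), ∃ τ τ', IsTimeChange m τ τ' ∧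
      ∀ t ∈ Icc (0 : ℝ) m, τ t = t + ε * ((Φ₁ t).trace - (Φ t).trace) := by
  obtain ⟨K, hK⟩ := hΦ₁.exists_lipschitzOnWith_trace
  obtain ⟨L, hL⟩ := hΦ.exists_lipschitzOnWith_trace
  obtain ⟨C, hC⟩ := isCompact_Icc.exists_bound_of_continuousOn (hK.sub hL).continuousOn
  have hsmall : Filter.Tendsto (fun ε : ℝ => ε * C) (nhdsWithin 0 (Ioi 0)) (nhds 0) := by
    simpa using ((continuous_mul_const C).tendsto 0).mono_left nhdsWithin_le_nhds
  filter_upwards [self_mem_nhdsWithin, hsmall.eventually_le_const (by norm_num : (0 : ℝ) < 1 / 2)]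
    with ε hε hεC
  obtain ⟨τ, hτ, hτe⟩ := exists_isTimeChange_eq_add
    (fun t ht => ((hasDerivWithinAt_trace (hΦ₁.hasDerivWithinAt ht)).fun_sub
      (hasDerivWithinAt_trace (hΦ.hasDerivWithinAt ht))).const_mul ε)
    (by simp [hΦ.zero, hΦ₁.zero]) (by simp [hΦ.top, hΦ₁.top])
    (fun t ht => by
      rw [abs_mul, abs_of_pos hε]
      exact (mul_le_mul_of_nonneg_left (hC t ht) (le_of_lt hε)).trans hεC)
    ⟨_, (lipschitzWith_smul ε).comp_lipschitzOnWith (hK.sub hL)⟩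
  exact ⟨τ, _, hτ, hτe⟩

variable {β : ℕ → Fin m → ℝ} {h : Fin m → ℝ}

theorem IsMinimizer.isCutoff (hmin : IsMinimizer β h Q μ Φ) (hT : T ∈ cutoffs μ Φ) :
    IsCutoff Q μ Φ T where
  isOrderMeasure := hmin.1.isOrderMeasure
  isPath := hmin.1.isPath.of_zero_measure
  topPoint_lt := hT.1
  lt := hT.2.1
  posDef := by
    have hdet := hT.2.2
    rw [hmin.1.isPath.top] at hdet
    exact (hmin.1.isPath.posSemidef_sub
      ⟨(topPoint_nonneg m μ).trans hT.1.le, hT.2.1.le⟩).posDef_iff_det_ne_zero.2 hdet.ne'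

/-- The trace normalization can be restored by a time change, so it does not restrict the
competitors. -/
theorem IsMinimizer.eventually_le_mixPath (hmin : IsMinimizer β h Q μ Φ)
    (hT : IsCutoff Q μ Φ T) (hΦ₁ : IsPath Q κ Φ₁) :
    ∀ᶠ ε in nhdsWithin 0 (Ioi 0),
      csFunctional β h μ Φ T ≤ csFunctional β h μ (mixPath Φ Φ₁ ε) T := by
  filter_upwards [eventually_exists_isTimeChange_mixPath hT.isPath hΦ₁,
    Ioo_mem_nhdsGT (zero_lt_one' ℝ)] with ε ⟨τ, τ', hτ, hτe⟩ hε
  have hmix := hT.mixPath hΦ₁ ⟨hε.1.le, hε.2⟩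
  have htr : ∀ t ∈ μ.support, (mixPath Φ Φ₁ ε t).trace = τ t := fun t ht => by
    have ht' : t ∈ Icc 0 T :=
      Icc_subset_Icc_right hT.topPoint_lt.le (hT.isOrderMeasure.support_subset ht)
    rw [hτe t (hT.Icc_subset ht'), mixPath, Matrix.trace_add, Matrix.trace_smul,
      Matrix.trace_sub, smul_eq_mul, hmin.1.isPath.trace_eq t ht]
  rw [← hτ.csFunctional_map hmix.isPath (hT.Icc_subset ⟨hT.pos.le, le_rfl⟩)]
  exact hmin.2 _ _ (hτ.isAdmissible hmix htr) T hT.mem_cutoffs _ (hτ.apply_mem_cutoffs hmix)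

end Mix

end Reparametrization

/-! ### The first variation -/

section FunctionalDerivative

section ParametricIntegral

variable {α : Type*} [TopologicalSpace α] [T2Space α] [MeasurableSpace α] [OpensMeasurableSpace α]
  {ν : Measure α} [IsFiniteMeasure ν] {K : Set α}

theorem hasDerivWithinAt_integral_of_continuousOn (hK : IsCompact K) (hν : ∀ᵐ t ∂ν, t ∈ K)
    {F F' : ℝ → α → ℝ} {r : ℝ} (hr : 0 < r) (hF : ∀ ε ∈ Icc 0 r, ContinuousOn (F ε) K)
    (hF' : ContinuousOn (Function.uncurry F') (Icc 0 r ×ˢ K))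
    (hd : ∀ t ∈ K, ∀ ε ∈ Icc 0 r, HasDerivWithinAt (fun ε => F ε t) (F' ε t) (Icc 0 r) ε) :
    HasDerivWithinAt (fun ε => ∫ t, F ε t ∂ν) (∫ t, F' 0 t ∂ν) (Ici 0) 0 := by
  have h0 : (0 : ℝ) ∈ Icc 0 r := ⟨le_rfl, hr.le⟩
  have hint : ∀ ε ∈ Icc 0 r, Integrable (F ε) ν := fun ε hε =>
    integrable_of_continuousOn_of_ae_mem hK hν (hF ε hε)
  have hIoc : Ioc 0 r ∈ nhdsWithin (0 : ℝ) (Ioi 0) := Ioc_mem_nhdsGT hr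
  obtain ⟨B, hB⟩ := (isCompact_Icc.prod hK).exists_bound_of_continuousOn hF'
  have hslope : ∀ t ∈ K, ∀ ε ∈ Ioc 0 r, ‖slope (fun ε => F ε t) 0 ε‖ ≤ B := fun t ht ε hε => by
    have hle := (convex_Icc 0 r).norm_image_sub_le_of_norm_hasDerivWithin_le (hd t ht)
      (fun δ hδ => hB (δ, t) ⟨hδ, ht⟩) h0 ⟨hε.1.le, hε.2⟩
    rw [slope_def_field, norm_div]
    exact div_le_of_le_mul₀ (norm_nonneg _) ((norm_nonneg _).trans (hB (0, t) ⟨h0, ht⟩)) hle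
  refine (hasDerivWithinAt_Ioi_iff_Ici).1 ((hasDerivWithinAt_iff_tendsto_slope' (by simp)).2 ?_)
  have hlim : Filter.Tendsto (fun ε => ∫ t, slope (fun ε => F ε t) 0 ε ∂ν)
      (nhdsWithin 0 (Ioi 0)) (nhds (∫ t, F' 0 t ∂ν)) := by
    refine tendsto_integral_filter_of_dominated_convergence (fun _ => B) ?_ ?_
      (integrable_const B) ?_
    · filter_upwards [hIoc] with ε hε
      simp only [slope_def_field]
      exact (((hint ε ⟨hε.1.le, hε.2⟩).sub (hint 0 h0)).div_const _).aestronglyMeasurable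
    · filter_upwards [hIoc] with ε hε
      filter_upwards [hν] with t ht using hslope t ht ε hε
    · filter_upwards [hν] with t ht
      exact (hasDerivWithinAt_iff_tendsto_slope' (by simp)).1
        ((hd t ht 0 h0).mono_of_mem_nhdsWithin
          (Filter.mem_of_superset hIoc Ioc_subset_Icc_self))
  refine hlim.congr' ?_
  filter_upwards [hIoc] with ε hε
  simp only [slope_def_field]
  rw [integral_div, integral_sub (hint ε ⟨hε.1.le, hε.2⟩) (hint 0 h0)]

end ParametricIntegral

variable {m : ℕ} {μ κ κ' : Measure ℝ} {Q : Matrix (Fin m) (Fin m) ℝ}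
  {Φ Φ₁ : ℝ → Matrix (Fin m) (Fin m) ℝ} {β : ℕ → Fin m → ℝ} {h : Fin m → ℝ} {T t : ℝ}

theorem mixPath_zero (Φ Φ₁ : ℝ → Matrix (Fin m) (Fin m) ℝ) : mixPath Φ Φ₁ 0 = Φ := by
  ext t : 1
  simp [mixPath]

section Potential

/-- The potential `A ↦ ∑ᵢⱼ ξ(A)ᵢⱼ + ⟨h hᵀ, A⟩`, whose gradient `ξ'(A) + h hᵀ` is the matrix paired
with `Φ'` in the energy term of the functional. -/
noncomputable def potential (β : ℕ → Fin m → ℝ) (h : Fin m → ℝ) (A : Matrix (Fin m) (Fin m) ℝ) :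
    ℝ :=
  ∑ i, ∑ j, (xiEntry β 0 i j (A i j) + h i * h j * A i j)

theorem IsMixed.hasDerivWithinAt_potential (hβ : IsMixed β) {F : ℝ → Matrix (Fin m) (Fin m) ℝ}
    {F' : Matrix (Fin m) (Fin m) ℝ} {s : Set ℝ} (hF : HasDerivWithinAt F F' s t)
    (hF₁ : ∀ i j, F t i j ∈ Icc (-1 : ℝ) 1) :
    HasDerivWithinAt (fun y => potential β h (F y))
      (frob (xiDeriv β 1 (F t) + Matrix.vecMulVec h h) F') s t := by
  refine HasDerivWithinAt.fun_sum fun i _ => HasDerivWithinAt.fun_sum fun j _ => ?_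
  have hFij := hasDerivWithinAt_matrix_iff.1 hF i j
  refine (((hβ.hasDerivAt_xiEntry 0 i j (abs_le.2 (hF₁ i j))).comp_hasDerivWithinAt t
    hFij).add (hFij.const_mul (h i * h j))).congr_deriv ?_
  rw [Matrix.add_apply, xiDeriv_apply, Matrix.vecMulVec_apply, add_mul]

theorem IsMixed.continuousOn_xiDeriv (hβ : IsMixed β) (r : ℕ) {X : Type*} [TopologicalSpace X]
    {F : X → Matrix (Fin m) (Fin m) ℝ} {s : Set X} (hF : ContinuousOn F s)
    (hF₁ : ∀ x ∈ s, ∀ i j, F x i j ∈ Icc (-1 : ℝ) 1) :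
    ContinuousOn (fun x => xiDeriv β r (F x)) s :=
  continuousOn_pi.2 fun i => continuousOn_pi.2 fun j =>
    (hβ.continuousOn_xiEntry r i j).comp (continuousOn_apply hF i j) fun x hx => hF₁ x hx i j

theorem IsPath.hasDerivWithinAt_potential (hΦ : IsPath Q κ Φ) (hβ : IsMixed β)
    (hQ : IsConstraint Q) (ht : t ∈ Icc (0 : ℝ) m) :
    HasDerivWithinAt (fun t => potential β h (Φ t))
      (frob (xiDeriv β 1 (Φ t) + Matrix.vecMulVec h h) (pathDeriv Φ t)) (Icc (0 : ℝ) m) t :=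
  hβ.hasDerivWithinAt_potential (hΦ.hasDerivWithinAt ht) (hΦ.apply_mem_Icc hQ ht)

theorem IsPath.continuousOn_potentialGrad (hΦ : IsPath Q κ Φ) (hβ : IsMixed β)
    (hQ : IsConstraint Q) :
    ContinuousOn (fun t => xiDeriv β 1 (Φ t) + Matrix.vecMulVec h h) (Icc (0 : ℝ) m) :=
  (hβ.continuousOn_xiDeriv 1 hΦ.continuousOn fun _ ht => hΦ.apply_mem_Icc hQ ht).add
    continuousOn_const

theorem IsPath.csFunctional_eq (hΦ : IsPath Q κ Φ) (hμ : IsOrderMeasure m μ) (hβ : IsMixed β)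
    (hQ : IsConstraint Q) (T : ℝ) :
    2 * csFunctional β h μ Φ T = potential β h Q - (∫ t, potential β h (Φ t) ∂μ)
      + Real.log (Q - Φ T).det + ∫ t in (0 : ℝ)..T, frob (hatPath μ Φ t)⁻¹ (pathDeriv Φ t) := by
  have henergy := hμ.integral_orderParam_mul_deriv (Nat.cast_nonneg m) hμ.orderParam_top
    (fun t ht => (hΦ.hasDerivWithinAt_potential (h := h) hβ hQ ht).continuousWithinAt)
    (continuousOn_frob (hΦ.continuousOn_potentialGrad hβ hQ) hΦ.continuousOn_pathDeriv)
    (fun t ht => hβ.hasDerivWithinAt_potential (hΦ.hasDerivWithinAt_Ici ht)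
      (hΦ.apply_mem_Icc hQ ⟨ht.1, ht.2.le⟩))
  rw [csFunctional, henergy, hΦ.top]
  ring

theorem hasDerivWithinAt_integral_potential (hΦ : IsPath Q κ Φ) (hΦ₁ : IsPath Q κ' Φ₁)
    (hμ : IsOrderMeasure m μ) (hβ : IsMixed β) (hQ : IsConstraint Q) :
    HasDerivWithinAt (fun ε => ∫ t, potential β h (mixPath Φ Φ₁ ε t) ∂μ)
      (∫ t, frob (xiDeriv β 1 (Φ t) + Matrix.vecMulVec h h) (Φ₁ t - Φ t) ∂μ) (Ici 0) 0 := by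
  have := hμ.isProbabilityMeasure
  have hmix : ∀ ε ∈ Icc (0 : ℝ) 1, IsPath Q 0 (mixPath Φ Φ₁ ε) := fun ε hε =>
    isPath_mixPath hΦ hΦ₁ hε
  have hcont : ∀ {F : ℝ → Matrix (Fin m) (Fin m) ℝ}, ContinuousOn F (Icc (0 : ℝ) m) →
      ContinuousOn (fun q : ℝ × ℝ => F q.2) (Icc (0 : ℝ) 1 ×ˢ Icc (0 : ℝ) m) := fun hF =>
    hF.comp continuousOn_snd fun q hq => hq.2
  have hsub : ContinuousOn (fun t => Φ₁ t - Φ t) (Icc (0 : ℝ) m) :=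
    hΦ₁.continuousOn.sub hΦ.continuousOn
  have key := hasDerivWithinAt_integral_of_continuousOn (ν := μ) isCompact_Icc
    (hμ.ae_mem_Icc hμ.orderParam_top) one_pos
    (F := fun ε t => potential β h (mixPath Φ Φ₁ ε t))
    (F' := fun ε t =>
      frob (xiDeriv β 1 (mixPath Φ Φ₁ ε t) + Matrix.vecMulVec h h) (Φ₁ t - Φ t))
    (fun ε hε t ht => ((hmix ε hε).hasDerivWithinAt_potential hβ hQ ht).continuousWithinAt)
    (continuousOn_frob ((hβ.continuousOn_xiDeriv 1
        ((hcont hΦ.continuousOn).add (continuousOn_fst.smul (hcont hsub)))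
        fun q hq => (hmix q.1 hq.1).apply_mem_Icc hQ hq.2).add continuousOn_const) (hcont hsub))
    (fun t ht ε hε => hβ.hasDerivWithinAt_potential (F := fun ε => mixPath Φ Φ₁ ε t)
      ((((hasDerivWithinAt_id ε _).smul_const (Φ₁ t - Φ t)).const_add (Φ t)).congr_deriv
        (one_smul ℝ _)) ((hmix ε hε).apply_mem_Icc hQ ht))
  simpa only [mixPath_zero] using key

end Potential

section LogDet

variable {n : Type*} [Fintype n] [DecidableEq n]

theorem hasDerivAt_det_one_add_smul (M : Matrix n n ℝ) :
    HasDerivAt (fun ε : ℝ => (1 + ε • M).det) M.trace 0 := by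
  set q := (1 + (Polynomial.X : Polynomial ℝ) • M.map Polynomial.C).det.divX.divX
  have hexp : (fun ε : ℝ => (1 + ε • M).det) = fun ε => 1 + M.trace * ε + q.eval ε * ε ^ 2 :=
    funext fun ε => Matrix.det_one_add_smul ε M
  rw [hexp]
  refine ((((hasDerivAt_id (0 : ℝ)).const_mul M.trace).const_add 1).add
    ((q.hasDerivAt 0).mul (hasDerivAt_pow 2 (0 : ℝ)))).congr_deriv ?_
  simp

theorem hasDerivAt_log_det_add_smul {A : Matrix n n ℝ} (hA : IsUnit A.det) (B : Matrix n n ℝ) :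
    HasDerivAt (fun ε : ℝ => Real.log (A + ε • B).det) (A⁻¹ * B).trace 0 := by
  have hfactor : ∀ ε : ℝ, (A + ε • B).det = A.det * (1 + ε • (A⁻¹ * B)).det := fun ε => by
    rw [← Matrix.det_mul, mul_add, mul_one, Matrix.mul_smul,
      Matrix.mul_nonsing_inv_cancel_left _ _ hA]
  simp only [hfactor]
  refine (((hasDerivAt_det_one_add_smul (A⁻¹ * B)).const_mul A.det).log
    (by simpa using hA.ne_zero)).congr_deriv ?_
  rw [zero_smul, add_zero, Matrix.det_one, mul_one, mul_div_cancel_left₀ _ hA.ne_zero]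

end LogDet

section Entropy

theorem hatPath_mixPath (hΦ : IsPath Q κ Φ) (hΦ₁ : IsPath Q κ' Φ₁) (hμ : IsOrderMeasure m μ)
    (ε : ℝ) (ht : t ∈ Icc (0 : ℝ) m) :
    hatPath μ (mixPath Φ Φ₁ ε) t =
      hatPath μ Φ t + ε • (hatPath μ Φ₁ t - hatPath μ Φ t) := by
  have hm := right_mem_Icc_natCast m
  ext i j
  have hi := hΦ.intervalIntegrable_hatPath hμ i j ht hm
  have hi₁ := hΦ₁.intervalIntegrable_hatPath hμ i j ht hm
  simp only [hatPath, Matrix.of_apply, Matrix.add_apply, Matrix.smul_apply, Matrix.sub_apply,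
    smul_eq_mul]
  rw [← intervalIntegral.integral_sub hi₁ hi, ← intervalIntegral.integral_const_mul,
    ← intervalIntegral.integral_add hi ((hi₁.sub hi).const_mul ε)]
  refine intervalIntegral.integral_congr fun s hs => ?_
  simp only [pathDeriv_mixPath hΦ hΦ₁ ε (uIcc_subset_Icc ht hm hs), Matrix.add_apply,
    Matrix.smul_apply, Matrix.sub_apply, smul_eq_mul]
  ring

theorem hasDerivWithinAt_frob_inv_add_smul {R ρ D δ : Matrix (Fin m) (Fin m) ℝ} {s : Set ℝ}
    {ε : ℝ} (hR : IsUnit (R + ε • ρ).det) :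
    HasDerivWithinAt (fun ε : ℝ => frob (R + ε • ρ)⁻¹ (D + ε • δ))
      (frob (R + ε • ρ)⁻¹ δ - frob ((R + ε • ρ)⁻¹ * ρ * (R + ε • ρ)⁻¹) (D + ε • δ)) s ε := by
  have haffine : ∀ A B : Matrix (Fin m) (Fin m) ℝ,
      HasDerivWithinAt (fun ε : ℝ => A + ε • B) B s ε := fun A B =>
    (((hasDerivWithinAt_id ε s).smul_const B).const_add A).congr_deriv (one_smul ℝ B)
  refine (hasDerivWithinAt_frob (hasDerivWithinAt_matrix_inv (haffine R ρ) hR)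
    (haffine D δ)).congr_deriv ?_
  rw [← neg_one_smul ℝ, frob_smul_left]
  ring

theorem hasDerivWithinAt_integral_frob_inv {R ρ D δ : ℝ → Matrix (Fin m) (Fin m) ℝ} (hT : 0 ≤ T)
    (hR : ContinuousOn R (Icc 0 T)) (hρ : ContinuousOn ρ (Icc 0 T))
    (hD : ContinuousOn D (Icc 0 T)) (hδ : ContinuousOn δ (Icc 0 T)) {r : ℝ} (hr : 0 < r)
    (hdet : ∀ ε ∈ Icc 0 r, ∀ t ∈ Icc 0 T, IsUnit (R t + ε • ρ t).det) :
    HasDerivWithinAt (fun ε : ℝ => ∫ t in (0 : ℝ)..T, frob (R t + ε • ρ t)⁻¹ (D t + ε • δ t))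
      (∫ t in (0 : ℝ)..T, (frob (R t)⁻¹ (δ t) - frob ((R t)⁻¹ * ρ t * (R t)⁻¹) (D t)))
      (Ici 0) 0 := by
  have hsnd : ∀ {A : ℝ → Matrix (Fin m) (Fin m) ℝ}, ContinuousOn A (Icc 0 T) →
      ContinuousOn (fun q : ℝ × ℝ => A q.2) (Icc 0 r ×ˢ Icc 0 T) := fun hA =>
    hA.comp continuousOn_snd fun q hq => hq.2
  have haffine : ∀ {A B : ℝ → Matrix (Fin m) (Fin m) ℝ}, ContinuousOn A (Icc 0 T) →
      ContinuousOn B (Icc 0 T) →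
      ContinuousOn (fun q : ℝ × ℝ => A q.2 + q.1 • B q.2) (Icc 0 r ×ˢ Icc 0 T) := fun hA hB =>
    (hsnd hA).fun_add (continuousOn_fst.fun_smul (hsnd hB))
  have hinv := continuousOn_matrix_inv (haffine hR hρ) fun q hq => hdet q.1 hq.1 q.2 hq.2
  let F : ℝ → ℝ → ℝ := fun ε t => frob (R t + ε • ρ t)⁻¹ (D t + ε • δ t)
  let F' : ℝ → ℝ → ℝ := fun ε t => frob (R t + ε • ρ t)⁻¹ (δ t) -
    frob ((R t + ε • ρ t)⁻¹ * ρ t * (R t + ε • ρ t)⁻¹) (D t + ε • δ t)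
  have hF : ContinuousOn (Function.uncurry F) (Icc 0 r ×ˢ Icc 0 T) :=
    continuousOn_frob hinv (haffine hD hδ)
  have hF' : ContinuousOn (Function.uncurry F') (Icc 0 r ×ˢ Icc 0 T) :=
    (continuousOn_frob hinv (hsnd hδ)).fun_sub
      (continuousOn_frob ((hinv.fun_mul (hsnd hρ)).fun_mul hinv) (haffine hD hδ))
  have hderiv : ∀ t ∈ Icc 0 T, ∀ ε ∈ Icc 0 r,
      HasDerivWithinAt (fun ε => F ε t) (F' ε t) (Icc 0 r) ε := fun t ht ε hε =>
    hasDerivWithinAt_frob_inv_add_smul (hdet ε hε t ht)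
  have key := hasDerivWithinAt_integral_of_continuousOn (ν := volume.restrict (Ioc 0 T))
    isCompact_Icc ((ae_restrict_mem measurableSet_Ioc).mono fun t ht => Ioc_subset_Icc_self ht) hr
    (fun ε hε => hF.uncurry_left ε hε) hF' hderiv
  simpa only [intervalIntegral.integral_of_le hT, F, F', zero_smul, add_zero] using key

theorem IsCutoff.continuousOn_responsePath (hT : IsCutoff Q μ Φ T) :
    ContinuousOn (responsePath μ Φ) (Icc 0 T) := fun _ ht =>
  (hT.hasDerivWithinAt_responsePath ht).continuousWithinAt

theorem IsCutoff.hasDerivWithinAt_responsePath_Ici (hT : IsCutoff Q μ Φ T) (ht : t ∈ Ico 0 T) :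
    HasDerivWithinAt (responsePath μ Φ)
      ((hatPath μ Φ t)⁻¹ * pathDeriv Φ t * (hatPath μ Φ t)⁻¹) (Ici t) t :=
  (hT.hasDerivWithinAt_responsePath ⟨ht.1, ht.2.le⟩).mono_of_mem_nhdsWithin
    (Filter.mem_of_superset (Icc_mem_nhdsGE ht.2) (Icc_subset_Icc_left ht.1))

theorem IsCutoff.integral_orderParam_mul_frob_responsePath (hT : IsCutoff Q μ Φ T)
    (hΦ₁ : IsPath Q κ Φ₁) :
    ∫ t in (0 : ℝ)..T, orderParam μ t *
        (frob ((hatPath μ Φ t)⁻¹ * pathDeriv Φ t * (hatPath μ Φ t)⁻¹) (Φ₁ t - Φ t) +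
          frob (responsePath μ Φ t) (pathDeriv Φ₁ t - pathDeriv Φ t)) =
      frob (responsePath μ Φ T) (Φ₁ T - Φ T) -
        ∫ t, frob (responsePath μ Φ t) (Φ₁ t - Φ t) ∂μ := by
  have hΦ := hT.isPath
  have hsub := (hΦ₁.continuousOn.sub hΦ.continuousOn).mono hT.Icc_subset
  have hsub' := (hΦ₁.continuousOn_pathDeriv.sub hΦ.continuousOn_pathDeriv).mono hT.Icc_subset
  exact hT.isOrderMeasure.integral_orderParam_mul_deriv hT.pos.le
    (hT.isOrderMeasure.orderParam_eq_one hT.topPoint_lt le_rfl)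
    (continuousOn_frob hT.continuousOn_responsePath hsub)
    ((continuousOn_frob hT.continuousOn_responseDeriv hsub).add
      (continuousOn_frob hT.continuousOn_responsePath hsub'))
    fun t ht => hasDerivWithinAt_frob (hT.hasDerivWithinAt_responsePath_Ici ht)
      ((hΦ₁.hasDerivWithinAt_Ici ⟨ht.1, ht.2.trans hT.lt⟩).fun_sub
        (hΦ.hasDerivWithinAt_Ici ⟨ht.1, ht.2.trans hT.lt⟩))

theorem IsCutoff.hasDerivWithinAt_entropyPairing (hT : IsCutoff Q μ Φ T) (hΦ₁ : IsPath Q κ Φ₁)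
    (ht : t ∈ Ico 0 T) :
    HasDerivWithinAt
      (fun t => frob (hatPath μ Φ t)⁻¹ (Φ₁ t - Φ t) -
        frob (responsePath μ Φ t) (hatPath μ Φ₁ t - hatPath μ Φ t))
      ((frob (hatPath μ Φ t)⁻¹ (pathDeriv Φ₁ t - pathDeriv Φ t) -
        frob ((hatPath μ Φ t)⁻¹ * pathDeriv Φ t * (hatPath μ Φ t)⁻¹)
          (hatPath μ Φ₁ t - hatPath μ Φ t)) +
        orderParam μ t *
          (frob ((hatPath μ Φ t)⁻¹ * pathDeriv Φ t * (hatPath μ Φ t)⁻¹) (Φ₁ t - Φ t) +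
            frob (responsePath μ Φ t) (pathDeriv Φ₁ t - pathDeriv Φ t))) (Ici t) t := by
  have htm : t ∈ Ico (0 : ℝ) m := ⟨ht.1, ht.2.trans hT.lt⟩
  have hsub := (hΦ₁.hasDerivWithinAt_Ici htm).fun_sub (hT.isPath.hasDerivWithinAt_Ici htm)
  have hhat := ((hΦ₁.hasDerivWithinAt_hatPath hT.isOrderMeasure htm).fun_sub
    (hT.isPath.hasDerivWithinAt_hatPath hT.isOrderMeasure htm)).congr_deriv
    (show _ = -(orderParam μ t • (pathDeriv Φ₁ t - pathDeriv Φ t)) by module)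
  refine ((hasDerivWithinAt_frob (hT.hasDerivWithinAt_inv_hatPath ht) hsub).fun_sub
    (hasDerivWithinAt_frob (hT.hasDerivWithinAt_responsePath_Ici ht) hhat)).congr_deriv ?_
  rw [frob_smul_left, frob_neg_right, frob_smul_right]
  ring

theorem IsCutoff.integral_entropy_variation (hT : IsCutoff Q μ Φ T) (hΦ₁ : IsPath Q κ Φ₁) :
    (∫ t in (0 : ℝ)..T, (frob (hatPath μ Φ t)⁻¹ (pathDeriv Φ₁ t - pathDeriv Φ t) -
        frob ((hatPath μ Φ t)⁻¹ * (hatPath μ Φ₁ t - hatPath μ Φ t) * (hatPath μ Φ t)⁻¹)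
          (pathDeriv Φ t))) =
      frob (hatPath μ Φ T)⁻¹ (Φ₁ T - Φ T) + ∫ t, frob (responsePath μ Φ t) (Φ₁ t - Φ t) ∂μ := by
  have hΦ := hT.isPath
  have hμ := hT.isOrderMeasure
  have hI : uIcc 0 T = Icc 0 T := uIcc_of_le hT.pos.le
  have hsub := (hΦ₁.continuousOn.fun_sub hΦ.continuousOn).mono hT.Icc_subset
  have hsub' := (hΦ₁.continuousOn_pathDeriv.fun_sub hΦ.continuousOn_pathDeriv).mono hT.Icc_subset
  have hhat := ((hΦ₁.continuousOn_hatPath hμ).mono hT.Icc_subset).fun_sub hT.continuousOn_hatPath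
  have hi := ((continuousOn_frob hT.continuousOn_inv_hatPath hsub').fun_sub
    (continuousOn_frob hT.continuousOn_responseDeriv hhat)).intervalIntegrable_of_Icc
      (μ := volume) hT.pos.le
  have hi' := hμ.intervalIntegrable_mul (hI ▸ (continuousOn_frob hT.continuousOn_responseDeriv
    hsub).fun_add (continuousOn_frob hT.continuousOn_responsePath hsub'))
  have hftc := intervalIntegral.integral_eq_sub_of_hasDeriv_right
    (hI ▸ (continuousOn_frob hT.continuousOn_inv_hatPath hsub).sub
      (continuousOn_frob hT.continuousOn_responsePath hhat))
    (fun t ht => (hT.hasDerivWithinAt_entropyPairing hΦ₁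
      (by rw [min_eq_left hT.pos.le, max_eq_right hT.pos.le] at ht
          exact ⟨ht.1.le, ht.2⟩)).mono Ioi_subset_Ici_self) (hi.add hi')
  have hhatT : hatPath μ Φ₁ T - hatPath μ Φ T = -(Φ₁ T - Φ T) := by
    rw [hΦ.hatPath_eq_sub hμ hT.topPoint_lt hT.lt.le,
      hΦ₁.hatPath_eq_sub hμ hT.topPoint_lt hT.lt.le]
    abel
  rw [intervalIntegral.integral_add hi hi',
    hT.integral_orderParam_mul_frob_responsePath hΦ₁] at hftc
  simp only [hΦ.zero, hΦ₁.zero, sub_zero,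
    responsePath_zero, frob_zero_left, frob_zero_right, hhatT, frob_neg_right] at hftc
  have hcongr : ∀ t ∈ uIcc 0 T,
      frob ((hatPath μ Φ t)⁻¹ * (hatPath μ Φ₁ t - hatPath μ Φ t) * (hatPath μ Φ t)⁻¹)
        (pathDeriv Φ t) =
      frob ((hatPath μ Φ t)⁻¹ * pathDeriv Φ t * (hatPath μ Φ t)⁻¹)
        (hatPath μ Φ₁ t - hatPath μ Φ t) := fun t ht => by
    rw [frob_conj (hT.posDef_hatPath (hI ▸ ht)).inv.isHermitian, frob_comm]
  rw [intervalIntegral.integral_congr fun t ht => congrArg _ (hcongr t ht)]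
  linarith

end Entropy

section Variation

theorem IsCutoff.csFunctional_mixPath_eq (hT : IsCutoff Q μ Φ T) (hΦ₁ : IsPath Q κ Φ₁)
    (hβ : IsMixed β) (hQ : IsConstraint Q) {ε : ℝ} (hε : ε ∈ Icc (0 : ℝ) 1) :
    2 * csFunctional β h μ (VectorSpin.mixPath Φ Φ₁ ε) T =
      potential β h Q - (∫ t, potential β h (VectorSpin.mixPath Φ Φ₁ ε t) ∂μ) +
        Real.log (Q - Φ T + ε • (Φ T - Φ₁ T)).det +
        ∫ t in (0 : ℝ)..T, frob (hatPath μ Φ t + ε • (hatPath μ Φ₁ t - hatPath μ Φ t))⁻¹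
          (pathDeriv Φ t + ε • (pathDeriv Φ₁ t - pathDeriv Φ t)) := by
  have hsub : Q - VectorSpin.mixPath Φ Φ₁ ε T = Q - Φ T + ε • (Φ T - Φ₁ T) := by
    rw [VectorSpin.mixPath]
    module
  rw [(isPath_mixPath hT.isPath hΦ₁ hε).csFunctional_eq hT.isOrderMeasure hβ hQ, hsub]
  congr 1
  refine intervalIntegral.integral_congr fun t ht => ?_
  have ht' := hT.Icc_subset (uIcc_of_le hT.pos.le ▸ ht)
  simp only [hatPath_mixPath hT.isPath hΦ₁ hT.isOrderMeasure ε ht',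
    pathDeriv_mixPath hT.isPath hΦ₁ ε ht']

theorem IsCutoff.integral_frob_gradPath (hT : IsCutoff Q μ Φ T) (hβ : IsMixed β)
    (hQ : IsConstraint Q) {F : ℝ → Matrix (Fin m) (Fin m) ℝ} (hF : ContinuousOn F (Icc 0 T)) :
    ∫ t, frob (gradPath β h μ Φ t) (F t) ∂μ =
      (∫ t, frob (xiDeriv β 1 (Φ t) + Matrix.vecMulVec h h) (F t) ∂μ) -
        ∫ t, frob (responsePath μ Φ t) (F t) ∂μ := by
  have hμ := hT.isOrderMeasure
  have hone := hμ.orderParam_eq_one hT.topPoint_lt le_rfl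
  simp only [gradPath, frob_sub_left]
  exact integral_sub
    (hμ.integrable_of_continuousOn hone (continuousOn_frob
      ((hT.isPath.continuousOn_potentialGrad hβ hQ).mono hT.Icc_subset) hF))
    (hμ.integrable_of_continuousOn hone (continuousOn_frob hT.continuousOn_responsePath hF))

theorem IsCutoff.hasDerivWithinAt_csFunctional_mixPath (hT : IsCutoff Q μ Φ T)
    (hΦ₁ : IsPath Q κ Φ₁) (hβ : IsMixed β) (hQ : IsConstraint Q) :
    HasDerivWithinAt (fun ε => 2 * csFunctional β h μ (VectorSpin.mixPath Φ Φ₁ ε) T)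
      (-∫ t, frob (gradPath β h μ Φ t) (Φ₁ t - Φ t) ∂μ) (Ici 0) 0 := by
  have hΦ := hT.isPath
  have hμ := hT.isOrderMeasure
  have hentropy := hasDerivWithinAt_integral_frob_inv hT.pos.le hT.continuousOn_hatPath
    (((hΦ₁.continuousOn_hatPath hμ).mono hT.Icc_subset).fun_sub
      hT.continuousOn_hatPath)
    (hΦ.continuousOn_pathDeriv.mono hT.Icc_subset)
    ((hΦ₁.continuousOn_pathDeriv.fun_sub hΦ.continuousOn_pathDeriv).mono hT.Icc_subset)
    (r := 1 / 2) (by norm_num) fun ε hε t ht => by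
      rw [← hatPath_mixPath hΦ hΦ₁ hμ ε (hT.Icc_subset ht)]
      exact (hT.mixPath hΦ₁ ⟨hε.1, hε.2.trans_lt (by norm_num)⟩).isUnit_det_hatPath ht
  have hlogdet := (hasDerivAt_log_det_add_smul hT.posDef.det_pos.ne'.isUnit
    (Φ T - Φ₁ T)).hasDerivWithinAt (s := Ici 0)
  have hlim : -(∫ t, frob (xiDeriv β 1 (Φ t) + Matrix.vecMulVec h h) (Φ₁ t - Φ t) ∂μ) +
      ((Q - Φ T)⁻¹ * (Φ T - Φ₁ T)).trace + (frob (hatPath μ Φ T)⁻¹ (Φ₁ T - Φ T) +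
        ∫ t, frob (responsePath μ Φ t) (Φ₁ t - Φ t) ∂μ) =
      -∫ t, frob (gradPath β h μ Φ t) (Φ₁ t - Φ t) ∂μ := by
    rw [hT.integral_frob_gradPath hβ hQ
      ((hΦ₁.continuousOn.fun_sub hΦ.continuousOn).mono hT.Icc_subset),
      hΦ.hatPath_eq_sub hμ hT.topPoint_lt hT.lt.le, frob_eq_trace,
      transpose_eq hT.posDef.inv.isHermitian, ← neg_sub (Φ₁ T), mul_neg, Matrix.trace_neg]
    ring
  rw [hT.integral_entropy_variation hΦ₁] at hentropy
  refine (((((hasDerivWithinAt_integral_potential hΦ hΦ₁ hμ hβ hQ).const_sub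
    (potential β h Q)).add hlogdet).add hentropy).congr_deriv hlim).congr_of_eventuallyEq ?_
    (hT.csFunctional_mixPath_eq hΦ₁ hβ hQ ⟨le_rfl, zero_le_one⟩)
  filter_upwards [Icc_mem_nhdsGE one_pos] with ε hε using hT.csFunctional_mixPath_eq hΦ₁ hβ hQ hε

theorem IsMinimizer.integral_frob_gradPath_sub_nonpos (hmin : IsMinimizer β h Q μ Φ)
    (hT : IsCutoff Q μ Φ T) (hβ : IsMixed β) (hQ : IsConstraint Q) (hΦ₁ : IsPath Q κ Φ₁) :
    ∫ t, frob (gradPath β h μ Φ t) (Φ₁ t - Φ t) ∂μ ≤ 0 := by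
  have hslope := (hasDerivWithinAt_iff_tendsto_slope' (by simp)).1
    ((hT.hasDerivWithinAt_csFunctional_mixPath (h := h) hΦ₁ hβ hQ).mono Ioi_subset_Ici_self)
  refine neg_nonneg.1 (ge_of_tendsto hslope ?_)
  filter_upwards [hmin.eventually_le_mixPath hT hΦ₁, self_mem_nhdsWithin] with ε hε hpos
  rw [slope_def_field, mixPath_zero]
  exact div_nonneg (by linarith) (sub_nonneg.2 (le_of_lt hpos))

end Variation

end FunctionalDerivative

/-! ### Competitors with jumps -/

section Jumps

variable {m : ℕ} {μ κ : Measure ℝ} {Q : Matrix (Fin m) (Fin m) ℝ}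
  {Φ Ψ : ℝ → Matrix (Fin m) (Fin m) ℝ} {β : ℕ → Fin m → ℝ} {h : Fin m → ℝ} {T t : ℝ}

section Mollify

/-- Entrywise convolution of `Ψ` with a bump function, delayed by its radius so that values at
nonpositive times stay untouched at `0`. It smooths the competitors of the variational problem. -/
noncomputable def mollify (φ : ContDiffBump (0 : ℝ)) (Ψ : ℝ → Matrix (Fin m) (Fin m) ℝ) (t : ℝ) :
    Matrix (Fin m) (Fin m) ℝ :=
  Matrix.of fun i j => convolution (φ.normed volume) (fun s => Ψ s i j)
    (ContinuousLinearMap.lsmul ℝ ℝ) volume (t - φ.rOut)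

theorem monotone_quad (hmono : ∀ s t, s ≤ t → (Ψ t - Ψ s).PosSemidef) (v : Fin m → ℝ) :
    Monotone fun t => v ⬝ᵥ Ψ t *ᵥ v := fun s t hst =>
  quad_le_of_posSemidef_sub (hmono s t hst) v

theorem apply_eq_polarization {A : Matrix (Fin m) (Fin m) ℝ} (hA : A.IsHermitian) (i j : Fin m) :
    A i j = (1 / 2 : ℝ) • ((Pi.single i 1 + Pi.single j 1) ⬝ᵥ A *ᵥ (Pi.single i 1 + Pi.single j 1)
      - Pi.single i 1 ⬝ᵥ A *ᵥ Pi.single i 1 - Pi.single j 1 ⬝ᵥ A *ᵥ Pi.single j 1) := by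
  simp only [Matrix.mulVec_add, add_dotProduct, dotProduct_add, Matrix.mulVec_single_one,
    single_one_dotProduct, Matrix.col_apply, smul_eq_mul]
  rw [symm_apply hA j i]
  ring

theorem locallyIntegrable_apply (hherm : ∀ t, (Ψ t).IsHermitian)
    (hmono : ∀ s t, s ≤ t → (Ψ t - Ψ s).PosSemidef) (i j : Fin m) :
    LocallyIntegrable (fun t => Ψ t i j) volume := by
  have hquad := fun v => (monotone_quad hmono v).locallyIntegrable (μ := volume)
  rw [funext fun t => apply_eq_polarization (hherm t) i j]
  exact (((hquad _).sub (hquad _)).sub (hquad _)).smul (1 / 2 : ℝ)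

variable (φ : ContDiffBump (0 : ℝ))

theorem convolution_normed_eq_of_forall_abs_sub_le {φ : ContDiffBump (0 : ℝ)} {g : ℝ → ℝ} {c x : ℝ}
    (hg : ∀ y, |y - x| ≤ φ.rOut → g y = c) :
    convolution (φ.normed volume) g (ContinuousLinearMap.lsmul ℝ ℝ) volume x = c := by
  have hcongr : ∀ s, φ.normed volume s • g (x - s) = φ.normed volume s * c := fun s => by
    by_cases hs : |s| ≤ φ.rOut
    · rw [hg (x - s) (by simpa using hs), smul_eq_mul]
    · rw [image_eq_zero_of_notMem_tsupport (f := φ.normed volume)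
        (by simpa [φ.tsupport_normed_eq] using hs), zero_smul, zero_mul]
  simp only [convolution_def, ContinuousLinearMap.lsmul_apply, hcongr]
  rw [integral_mul_const, φ.integral_normed, one_mul]

theorem mollify_eq_of_forall_mem_Icc {A : Matrix (Fin m) (Fin m) ℝ}
    (hA : ∀ s ∈ Icc (t - 2 * φ.rOut) t, Ψ s = A) : mollify φ Ψ t = A := by
  ext i j
  rw [mollify, Matrix.of_apply]
  refine convolution_normed_eq_of_forall_abs_sub_le fun y hy => ?_
  rw [hA y ⟨by linarith [(abs_le.1 hy).1], by linarith [(abs_le.1 hy).2]⟩]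

theorem contDiff_mollify (hint : ∀ i j, LocallyIntegrable (fun t => Ψ t i j) volume)
    (i j : Fin m) : ContDiff ℝ 2 fun t => mollify φ Ψ t i j :=
  (φ.hasCompactSupport_normed.contDiff_convolution_left (ContinuousLinearMap.lsmul ℝ ℝ)
    φ.contDiff_normed (hint i j)).comp (contDiff_id.sub contDiff_const)

theorem integrable_normed_mul (hint : ∀ i j, LocallyIntegrable (fun t => Ψ t i j) volume)
    (t : ℝ) (i j : Fin m) :
    Integrable fun s => φ.normed volume s * Ψ (t - φ.rOut - s) i j :=
  φ.hasCompactSupport_normed.convolutionExists_left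
    (ContinuousLinearMap.lsmul ℝ ℝ) φ.continuous_normed (hint i j) (t - φ.rOut)

theorem normed_mul_quad_eq_sum (v : Fin m → ℝ) (t s : ℝ) :
    φ.normed volume s * (v ⬝ᵥ Ψ (t - φ.rOut - s) *ᵥ v) =
      ∑ i, ∑ j, v i * v j * (φ.normed volume s * Ψ (t - φ.rOut - s) i j) := by
  simp only [dotProduct_mulVec_eq_sum, Finset.mul_sum, mul_left_comm (φ.normed volume s)]

theorem integrable_normed_mul_quad (hint : ∀ i j, LocallyIntegrable (fun t => Ψ t i j) volume)
    (v : Fin m → ℝ) (t : ℝ) :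
    Integrable fun s => φ.normed volume s * (v ⬝ᵥ Ψ (t - φ.rOut - s) *ᵥ v) := by
  simp only [normed_mul_quad_eq_sum]
  exact integrable_finsetSum _ fun i _ => integrable_finsetSum _ fun j _ =>
    (integrable_normed_mul φ hint t i j).const_mul _

theorem quad_mollify (hint : ∀ i j, LocallyIntegrable (fun t => Ψ t i j) volume)
    (v : Fin m → ℝ) (t : ℝ) :
    v ⬝ᵥ mollify φ Ψ t *ᵥ v =
      ∫ s, φ.normed volume s * (v ⬝ᵥ Ψ (t - φ.rOut - s) *ᵥ v) := by
  have hi : ∀ i j, Integrable fun s =>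
      v i * v j * (φ.normed volume s * Ψ (t - φ.rOut - s) i j) := fun i j =>
    (integrable_normed_mul φ hint t i j).const_mul _
  simp only [normed_mul_quad_eq_sum]
  rw [dotProduct_mulVec_eq_sum,
    integral_finsetSum _ fun i _ => integrable_finsetSum _ fun j _ => hi i j]
  refine Finset.sum_congr rfl fun i _ => ?_
  rw [integral_finsetSum _ fun j _ => hi i j]
  refine Finset.sum_congr rfl fun j _ => ?_
  rw [integral_const_mul]
  rfl

theorem isHermitian_mollify (hherm : ∀ t, (Ψ t).IsHermitian) (t : ℝ) :
    (mollify φ Ψ t).IsHermitian := by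
  refine Matrix.IsHermitian.ext fun i j => ?_
  simp only [mollify, Matrix.of_apply, star_trivial, funext fun s => symm_apply (hherm s) i j]

theorem posSemidef_mollify_sub (hherm : ∀ t, (Ψ t).IsHermitian)
    (hmono : ∀ s t, s ≤ t → (Ψ t - Ψ s).PosSemidef) {s t : ℝ} (hst : s ≤ t) :
    (mollify φ Ψ t - mollify φ Ψ s).PosSemidef := by
  have hint := locallyIntegrable_apply hherm hmono
  refine posSemidef_sub_of_quad_le (isHermitian_mollify φ hherm s)
    (isHermitian_mollify φ hherm t) fun v => ?_
  rw [quad_mollify φ hint, quad_mollify φ hint]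
  exact integral_mono (integrable_normed_mul_quad φ hint v s)
    (integrable_normed_mul_quad φ hint v t) fun y =>
    mul_le_mul_of_nonneg_left (monotone_quad hmono v (by linarith)) (φ.nonneg_normed y)

theorem tendsto_mollify {ι : Type*} {l : Filter ι} {φ : ι → ContDiffBump (0 : ℝ)}
    (hφ : Filter.Tendsto (fun n => (φ n).rOut) l (nhds 0))
    (hint : ∀ i j, LocallyIntegrable (fun t => Ψ t i j) volume) (hΨ : ContinuousAt Ψ t) :
    Filter.Tendsto (fun n => mollify (φ n) Ψ t) l (nhds (Ψ t)) := by
  refine tendsto_pi_nhds.2 fun i => tendsto_pi_nhds.2 fun j => ?_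
  have hij : ContinuousAt (fun s => Ψ s i j) t :=
    continuousAt_pi.1 (continuousAt_pi.1 hΨ i) j
  exact ContDiffBump.convolution_tendsto_right (φ := φ) (g := fun _ s => Ψ s i j)
    (k := fun n => t - (φ n).rOut) hφ
    (.of_forall fun _ => (hint i j).aestronglyMeasurable)
    (hij.tendsto.comp Filter.tendsto_snd) (by simpa using hφ.const_sub t)

theorem exists_contDiffBump_tendsto_zero {r : ℝ} (hr : 0 < r) :
    ∃ φ : ℕ → ContDiffBump (0 : ℝ), (∀ n, (φ n).rOut ≤ r) ∧
      Filter.Tendsto (fun n => (φ n).rOut) Filter.atTop (nhds 0) := by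
  have hpos : ∀ n : ℕ, 0 < r / (n + 1) := fun n => by positivity
  refine ⟨fun n => ⟨r / (n + 1) / 2, r / (n + 1), half_pos (hpos n), half_lt_self (hpos n)⟩,
    fun n => div_le_self hr.le (by simp), ?_⟩
  simpa [div_eq_mul_inv] using tendsto_one_div_add_atTop_nhds_zero_nat.const_mul r

end Mollify

/-- Paths from `0` to `Q`, nondecreasing in the semidefinite order, continuous on `(0, T)` but
allowed to jump at `0` and at `T`: the competitors to which the first variation extends by
mollification. They are extended to all of `ℝ` by constants. -/
structure IsJumpPath (Q : Matrix (Fin m) (Fin m) ℝ) (Ψ : ℝ → Matrix (Fin m) (Fin m) ℝ)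
    (T : ℝ) : Prop where
  monotone : ∀ s t, s ≤ t → (Ψ t - Ψ s).PosSemidef
  zero : ∀ t ≤ 0, Ψ t = 0
  top : ∀ t, T ≤ t → Ψ t = Q
  continuousAt : ∀ t ∈ Ioo 0 T, ContinuousAt Ψ t

namespace IsJumpPath

theorem isHermitian (hΨ : IsJumpPath Q Ψ T) (t : ℝ) : (Ψ t).IsHermitian := by
  rcases le_total t 0 with ht | ht
  · rw [hΨ.zero t ht]
    exact Matrix.isHermitian_zero
  · simpa [hΨ.zero 0 le_rfl] using (hΨ.monotone 0 t ht).isHermitian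

theorem locallyIntegrable_apply (hΨ : IsJumpPath Q Ψ T) (i j : Fin m) :
    LocallyIntegrable (fun t => Ψ t i j) volume :=
  VectorSpin.locallyIntegrable_apply hΨ.isHermitian hΨ.monotone i j

theorem isPath_mollify (hΨ : IsJumpPath Q Ψ T) (hm : (0 : ℝ) < m) {φ : ContDiffBump (0 : ℝ)}
    (hφ : 2 * φ.rOut ≤ m - T) : IsPath Q 0 (mollify φ Ψ) := by
  have hmono : ∀ s t, s ≤ t → (mollify φ Ψ t - mollify φ Ψ s).PosSemidef := fun s t =>
    posSemidef_mollify_sub φ hΨ.isHermitian hΨ.monotone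
  have hzero : mollify φ Ψ 0 = 0 := mollify_eq_of_forall_mem_Icc φ fun s hs => hΨ.zero s hs.2
  have hC2 := contDiff_mollify φ hΨ.locallyIntegrable_apply
  refine ⟨fun t ht => by simpa [hzero] using hmono 0 t ht.1, fun s _ t _ => hmono s t, hzero,
    mollify_eq_of_forall_mem_Icc φ fun s hs => hΨ.top s (by linarith [hs.1]),
    fun i j => ((hC2 i j).differentiable two_ne_zero).differentiableOn, ?_, by simp⟩
  obtain ⟨K, hK⟩ := exists_forall_lipschitzOnWith (ι := Fin m × Fin m) (s := Icc (0 : ℝ) m)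
    fun p => ((hC2 p.1 p.2).deriv' (n := 1)).contDiffOn.exists_lipschitzOnWith one_ne_zero
      (convex_Icc 0 (m : ℝ)) isCompact_Icc
  refine ⟨K, fun i j => lipschitzOnWith_congr (hK (i, j)) fun t ht => ?_⟩
  exact ((hC2 i j).differentiable two_ne_zero t).derivWithin (uniqueDiffOn_Icc hm t ht)

end IsJumpPath

section FirstVariation

theorem abs_frob_le {A B : Matrix (Fin m) (Fin m) ℝ} {c : ℝ} (hB : ∀ i j, |B i j| ≤ c) :
    |frob A B| ≤ c * ∑ i, ∑ j, |A i j| := by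
  simp only [Finset.mul_sum]
  refine (Finset.abs_sum_le_sum_abs _ _).trans (Finset.sum_le_sum fun i _ =>
    (Finset.abs_sum_le_sum_abs _ _).trans (Finset.sum_le_sum fun j _ => ?_))
  rw [abs_mul, mul_comm]
  exact mul_le_mul_of_nonneg_right (hB i j) (abs_nonneg _)

theorem IsCutoff.continuousOn_gradPath (hT : IsCutoff Q μ Φ T) (hβ : IsMixed β)
    (hQ : IsConstraint Q) : ContinuousOn (gradPath β h μ Φ) (Icc 0 T) := fun _ ht =>
  (hT.hasDerivWithinAt_gradPath hβ hQ ht).continuousWithinAt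

theorem IsOrderMeasure.tendsto_integral_frob {F : ℕ → ℝ → Matrix (Fin m) (Fin m) ℝ}
    {G : ℝ → Matrix (Fin m) (Fin m) ℝ} {c : ℝ} (hμ : IsOrderMeasure m μ) (hT : topPoint m μ < T)
    (hG : ContinuousOn G (Icc 0 T)) (hF : ∀ n, ContinuousOn (F n) (Icc 0 T))
    (hbound : ∀ n, ∀ t ∈ Icc 0 T, ∀ i j, |F n t i j| ≤ c)
    (hlim : ∀ t ∈ Ioo 0 T, Filter.Tendsto (fun n => F n t) Filter.atTop (nhds (Ψ t))) :
    Filter.Tendsto (fun n => ∫ t, frob (G t) (F n t) ∂μ) Filter.atTop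
      (nhds (∫ t, frob (G t) (Ψ t) ∂μ)) := by
  have hone := hμ.orderParam_eq_one hT le_rfl
  refine tendsto_integral_of_dominated_convergence (fun t => c * ∑ i, ∑ j, |G t i j|)
    (fun n => (hμ.integrable_of_continuousOn hone
      (continuousOn_frob hG (hF n))).aestronglyMeasurable)
    (hμ.integrable_of_continuousOn hone (continuousOn_const.mul (continuousOn_finsetSum _
      fun i _ => continuousOn_finsetSum _ fun j _ => (continuousOn_apply hG i j).abs))) ?_ ?_
  · exact fun n => (hμ.ae_mem_Icc hone).mono fun t ht => abs_frob_le (hbound n t ht)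
  · filter_upwards [hμ.ae_mem_Ioo hT] with t ht
    exact tendsto_finsetSum _ fun i _ => tendsto_finsetSum _ fun j _ =>
      (tendsto_pi_nhds.1 (tendsto_pi_nhds.1 (hlim t ht) i) j).const_mul _

theorem IsMinimizer.integral_frob_gradPath_sub_nonpos_of_isJumpPath (hmin : IsMinimizer β h Q μ Φ)
    (hT : IsCutoff Q μ Φ T) (hβ : IsMixed β) (hQ : IsConstraint Q) (hΨ : IsJumpPath Q Ψ T) :
    ∫ t, frob (gradPath β h μ Φ t) (Ψ t - Φ t) ∂μ ≤ 0 := by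
  obtain ⟨φ, hφ, hφ0⟩ := exists_contDiffBump_tendsto_zero (half_pos (sub_pos.2 hT.lt))
  have hpath : ∀ n, IsPath Q 0 (mollify (φ n) Ψ) := fun n =>
    hΨ.isPath_mollify (hT.pos.trans hT.lt) (by linarith [hφ n])
  refine le_of_tendsto (hT.isOrderMeasure.tendsto_integral_frob (c := 2) hT.topPoint_lt
    (hT.continuousOn_gradPath hβ hQ)
    (fun n => ((hpath n).continuousOn.fun_sub hT.isPath.continuousOn).mono hT.Icc_subset)
    (fun n t ht i j => ?_) fun t ht => ?_)
    (.of_forall fun n => hmin.integral_frob_gradPath_sub_nonpos hT hβ hQ (hpath n))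
  · have hΦt := hT.isPath.apply_mem_Icc hQ (hT.Icc_subset ht) i j
    have hφt := (hpath n).apply_mem_Icc hQ (hT.Icc_subset ht) i j
    rw [Matrix.sub_apply, abs_le]
    constructor <;> linarith [hΦt.1, hΦt.2, hφt.1, hφt.2]
  · exact (tendsto_mollify hφ0 hΨ.locallyIntegrable_apply (hΨ.continuousAt t ht)).sub_const _

end FirstVariation

end Jumps

/-! ### Stationarity on the support -/

section EulerLagrange

variable {m : ℕ} {μ : Measure ℝ} {Q : Matrix (Fin m) (Fin m) ℝ}
  {Φ : ℝ → Matrix (Fin m) (Fin m) ℝ} {β : ℕ → Fin m → ℝ} {h : Fin m → ℝ} {T : ℝ}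

section LoewnerOrder

variable {A D E G M R : Matrix (Fin m) (Fin m) ℝ} {c ε x : ℝ}

theorem abs_mul_apply_le_dotProduct_self (v : Fin m → ℝ) (i j : Fin m) :
    |v i * v j| ≤ v ⬝ᵥ v := by
  have hle : ∀ k, v k * v k ≤ v ⬝ᵥ v := fun k =>
    Finset.single_le_sum (f := fun k => v k * v k) (fun _ _ => mul_self_nonneg _)
      (Finset.mem_univ k)
  rw [abs_le]
  constructor <;> nlinarith [hle i, hle j, sq_nonneg (v i + v j), sq_nonneg (v i - v j)]

theorem posSemidef_smul_one_sub (hM : M.IsHermitian) (hc : ∑ i, ∑ j, |M i j| ≤ c) :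
    (c • 1 - M).PosSemidef := by
  refine posSemidef_sub_of_quad_le hM (Matrix.isHermitian_one.smul (.all c)) fun v => ?_
  calc v ⬝ᵥ M *ᵥ v = ∑ i, ∑ j, v i * v j * M i j := dotProduct_mulVec_eq_sum M v v
    _ ≤ ∑ i, ∑ j, (v ⬝ᵥ v) * |M i j| :=
        Finset.sum_le_sum fun i _ => Finset.sum_le_sum fun j _ =>
          (le_abs_self _).trans ((abs_mul _ _).trans_le (mul_le_mul_of_nonneg_right
            (abs_mul_apply_le_dotProduct_self v i j) (abs_nonneg _)))
    _ = (v ⬝ᵥ v) * ∑ i, ∑ j, |M i j| := by simp only [Finset.mul_sum]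
    _ ≤ (v ⬝ᵥ v) * c :=
        mul_le_mul_of_nonneg_left hc (Finset.sum_nonneg fun i _ => mul_self_nonneg _)
    _ = v ⬝ᵥ (c • (1 : Matrix (Fin m) (Fin m) ℝ)) *ᵥ v := by
        rw [Matrix.smul_mulVec, Matrix.one_mulVec, dotProduct_smul, smul_eq_mul, mul_comm]

theorem exists_forall_posSemidef_smul_one_sub {s : Set ℝ} (hs : IsCompact s)
    {F : ℝ → Matrix (Fin m) (Fin m) ℝ} (hF : ContinuousOn F s)
    (hherm : ∀ t ∈ s, (F t).IsHermitian) : ∃ c : ℝ, ∀ t ∈ s, (c • 1 - F t).PosSemidef := by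
  obtain ⟨c, hc⟩ := hs.bddAbove_image (f := fun t => ∑ i, ∑ j, |F t i j|)
    (continuousOn_finsetSum _ fun i _ => continuousOn_finsetSum _ fun j _ =>
      (continuousOn_apply hF i j).abs)
  exact ⟨c, fun t ht => posSemidef_smul_one_sub (hherm t ht) (hc (mem_image_of_mem _ ht))⟩

theorem exists_pos_posSemidef_sub_smul_one (hA : A.PosDef) :
    ∃ c : ℝ, 0 < c ∧ (A - c • 1).PosSemidef := by
  set b := (∑ i, ∑ j, |A⁻¹ i j|) + 1
  have hb : 0 < b := by positivity
  have hinv : (b • 1 - A⁻¹).PosSemidef :=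
    posSemidef_smul_one_sub hA.inv.isHermitian (le_add_of_nonneg_right zero_le_one)
  have hP : (1 - b⁻¹ • A⁻¹).IsHermitian :=
    Matrix.isHermitian_one.sub (hA.inv.isHermitian.smul (.all _))
  have hsplit : A - b⁻¹ • 1 =
      (1 - b⁻¹ • A⁻¹) * A * (1 - b⁻¹ • A⁻¹) + b⁻¹ ^ 2 • (b • 1 - A⁻¹) := by
    simp only [sub_mul, mul_sub, one_mul, mul_one, smul_mul_assoc, mul_smul_comm,
      posDef_inv_mul hA, posDef_mul_inv hA]
    match_scalars <;> field_simp <;> ring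
  exact ⟨b⁻¹, inv_pos.2 hb, hsplit ▸
    (posSemidef_conj hA.posSemidef hP).add (hinv.smul (sq_nonneg _))⟩

theorem eventually_posSemidef_sub {ι : Type*} {l : Filter ι}
    {F : ι → Matrix (Fin m) (Fin m) ℝ} (hA : A.PosDef) (hF : Filter.Tendsto F l (nhds 0))
    (hherm : ∀ i, (F i).IsHermitian) : ∀ᶠ i in l, (A - F i).PosSemidef := by
  obtain ⟨c, hc, hAc⟩ := exists_pos_posSemidef_sub_smul_one hA
  have hlim : Filter.Tendsto (fun k => ∑ i, ∑ j, |F k i j|) l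
      (nhds (∑ i, ∑ j, |(0 : Matrix (Fin m) (Fin m) ℝ) i j|)) :=
    tendsto_finsetSum _ fun i _ => tendsto_finsetSum _ fun j _ =>
      (tendsto_pi_nhds.1 (tendsto_pi_nhds.1 hF i) j).abs
  simp only [Matrix.zero_apply, abs_zero, Finset.sum_const_zero] at hlim
  filter_upwards [hlim.eventually (ge_mem_nhds hc)] with k hk
  simpa using hAc.add (posSemidef_smul_one_sub (hherm k) hk)

theorem posSemidef_sub_of_hasDerivWithinAt {F F' : ℝ → Matrix (Fin m) (Fin m) ℝ} {s t : ℝ}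
    (hst : s ≤ t) (hF : ContinuousOn F (Icc s t)) (hherm : ∀ y ∈ Icc s t, (F y).IsHermitian)
    (hderiv : ∀ y ∈ Ico s t, HasDerivWithinAt F (F' y) (Ici y) y)
    (hF' : ∀ y ∈ Ico s t, (F' y).PosSemidef) : (F t - F s).PosSemidef := by
  refine posSemidef_sub_of_quad_le (hherm s ⟨le_rfl, hst⟩) (hherm t ⟨hst, le_rfl⟩) fun v => ?_
  have hcont : ContinuousOn (fun y => v ⬝ᵥ F y *ᵥ v) (Icc s t) := by
    simp only [dotProduct_mulVec_eq_sum]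
    exact continuousOn_finsetSum _ fun i _ => continuousOn_finsetSum _ fun j _ =>
      continuousOn_const.mul (continuousOn_apply hF i j)
  exact image_le_of_deriv_right_le_deriv_boundary (f := fun _ => v ⬝ᵥ F s *ᵥ v)
    (f' := fun _ => 0) continuousOn_const (fun _ _ => hasDerivWithinAt_const _ _ _) le_rfl hcont
    (fun y hy => hasDerivWithinAt_quad (hderiv y hy) v) (fun y hy => quad_nonneg (hF' y hy) v)
    ⟨hst, le_rfl⟩

theorem perturbation_deriv_eq (hR : R.PosDef) :
    (-(x • D) * G + R * (E - R⁻¹ * D * R⁻¹)) * R + R * G * -(x • D) =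
      R * E * R - D - x • (D * G * R + R * G * D) := by
  have hcancel : R * (E - R⁻¹ * D * R⁻¹) * R = R * E * R - D := by
    calc R * (E - R⁻¹ * D * R⁻¹) * R = R * E * R - (R * R⁻¹) * D * (R⁻¹ * R) := by
          simp only [mul_sub, sub_mul, mul_assoc]
      _ = R * E * R - D := by rw [posDef_mul_inv hR, posDef_inv_mul hR, one_mul, mul_one]
  rw [add_mul, hcancel]
  simp only [neg_mul, mul_neg, smul_mul_assoc, mul_smul_comm, smul_add]
  abel

/-- Completing the square in `D`: the indefinite terms of order `ε` are absorbed by `D` up to an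
error of order `ε²`, which `c` controls. -/
theorem posSemidef_perturbation_deriv (hD : D.PosSemidef) (hE : E.PosSemidef)
    (hG : G.IsHermitian) (hR : R.PosDef) (hx : x ∈ Icc (0 : ℝ) 1) (hε : ε ∈ Icc (0 : ℝ) (1 / 2))
    (hc : (c • 1 - (2 : ℝ) • (R * (G * D * G) * R)).PosSemidef) :
    (D + ε • ((-(x • D) * G + R * (E - R⁻¹ * D * R⁻¹)) * R + R * G * -(x • D)) +
      (ε ^ 2 * c) • 1).PosSemidef := by
  set B := 1 - (2 * ε * x) • (G * R)
  have hB : Bᴴ = 1 - (2 * ε * x) • (R * G) := by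
    simp [B, transpose_eq hG, transpose_eq hR.isHermitian]
  have hsplit : D + ε • ((-(x • D) * G + R * (E - R⁻¹ * D * R⁻¹)) * R + R * G * -(x • D)) +
      (ε ^ 2 * c) • 1 =
      (1 / 2 : ℝ) • (Bᴴ * D * B) + (1 / 2 - ε) • D + ε • (R * E * R) +
        (2 * ε ^ 2 * (1 - x ^ 2)) • (R * (G * D * G) * R) +
        ε ^ 2 • (c • 1 - (2 : ℝ) • (R * (G * D * G) * R)) := by
    rw [perturbation_deriv_eq hR, hB]
    simp only [B, sub_mul, mul_sub, one_mul, mul_one, smul_mul_assoc, mul_smul_comm, ← mul_assoc]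
    module
  have hx2 : 0 ≤ 1 - x ^ 2 := sub_nonneg.2 (pow_le_one₀ hx.1 hx.2)
  rw [hsplit]
  refine ((((hD.conjTranspose_mul_mul_same B).smul (by norm_num)).add
    (hD.smul (sub_nonneg.2 hε.2))).add ((posSemidef_conj hE hR.isHermitian).smul hε.1)).add
    ((posSemidef_conj (posSemidef_conj hD hG) hR.isHermitian).smul (by positivity)) |>.add
    (hc.smul (sq_nonneg ε))

end LoewnerOrder

section Perturbation

/-- The direction `Φ̂ G Φ̂` in which a path is perturbed, `G` being the gradient. The weights `Φ̂`
turn the term `-Φ̂⁻¹ Φ' Φ̂⁻¹` of `G'` into `-Φ'`, so that small perturbations stay monotone. -/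
noncomputable def ascentPath (β : ℕ → Fin m → ℝ) (h : Fin m → ℝ) (μ : Measure ℝ)
    (Φ : ℝ → Matrix (Fin m) (Fin m) ℝ) (t : ℝ) : Matrix (Fin m) (Fin m) ℝ :=
  hatPath μ Φ t * gradPath β h μ Φ t * hatPath μ Φ t

/-- The perturbation `Φ + ε Φ̂ G Φ̂ + ε² c t` of a path; the last term makes it monotone. -/
noncomputable def perturbPath (β : ℕ → Fin m → ℝ) (h : Fin m → ℝ) (μ : Measure ℝ)
    (Φ : ℝ → Matrix (Fin m) (Fin m) ℝ) (c ε t : ℝ) : Matrix (Fin m) (Fin m) ℝ :=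
  Φ t + ε • ascentPath β h μ Φ t + (ε ^ 2 * c * t) • 1

namespace IsCutoff

variable {t : ℝ}

theorem isHermitian_ascentPath (hT : IsCutoff Q μ Φ T) (hβ : IsMixed β) (hQ : IsConstraint Q)
    (ht : t ∈ Icc 0 T) : (ascentPath β h μ Φ t).IsHermitian := by
  have hG := hT.isHermitian_gradPath (h := h) hβ hQ ht
  simpa only [ascentPath, (hT.posDef_hatPath ht).isHermitian.eq] using
    Matrix.isHermitian_mul_mul_conjTranspose (hatPath μ Φ t) hG

theorem continuousOn_ascentPath (hT : IsCutoff Q μ Φ T) (hβ : IsMixed β) (hQ : IsConstraint Q) :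
    ContinuousOn (ascentPath β h μ Φ) (Icc 0 T) :=
  (hT.continuousOn_hatPath.fun_mul (hT.continuousOn_gradPath hβ hQ)).fun_mul
    hT.continuousOn_hatPath

theorem isHermitian_perturbPath (hT : IsCutoff Q μ Φ T) (hβ : IsMixed β) (hQ : IsConstraint Q)
    (c ε : ℝ) (ht : t ∈ Icc 0 T) : (perturbPath β h μ Φ c ε t).IsHermitian :=
  ((hT.isPath.posSemidef t (hT.Icc_subset ht)).isHermitian.add
    ((hT.isHermitian_ascentPath hβ hQ ht).smul (.all ε))).add
    (Matrix.isHermitian_one.smul (.all _))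

theorem continuousOn_perturbPath (hT : IsCutoff Q μ Φ T) (hβ : IsMixed β) (hQ : IsConstraint Q)
    (c ε : ℝ) : ContinuousOn (perturbPath β h μ Φ c ε) (Icc 0 T) :=
  ((hT.isPath.continuousOn.mono hT.Icc_subset).fun_add
    ((hT.continuousOn_ascentPath hβ hQ).const_smul ε)).fun_add (by fun_prop)

theorem hasDerivWithinAt_perturbPath (hT : IsCutoff Q μ Φ T) (hβ : IsMixed β)
    (hQ : IsConstraint Q) (c ε : ℝ) (ht : t ∈ Ico 0 T) :
    HasDerivWithinAt (perturbPath β h μ Φ c ε)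
      (pathDeriv Φ t + ε • ((-(orderParam μ t • pathDeriv Φ t) * gradPath β h μ Φ t +
        hatPath μ Φ t * (xiDeriv β 2 (Φ t) ⊙ pathDeriv Φ t -
          (hatPath μ Φ t)⁻¹ * pathDeriv Φ t * (hatPath μ Φ t)⁻¹)) * hatPath μ Φ t +
        hatPath μ Φ t * gradPath β h μ Φ t * -(orderParam μ t • pathDeriv Φ t)) +
        (ε ^ 2 * c) • 1) (Ici t) t := by
  have htm : t ∈ Ico (0 : ℝ) m := ⟨ht.1, ht.2.trans hT.lt⟩
  have hhat := hT.isPath.hasDerivWithinAt_hatPath hT.isOrderMeasure htm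
  have hgrad := (hT.hasDerivWithinAt_gradPath (h := h) hβ hQ
    ⟨ht.1, ht.2.le⟩).mono_of_mem_nhdsWithin
    (Filter.mem_of_superset (Icc_mem_nhdsGE ht.2) (Icc_subset_Icc_left ht.1))
  have hlin : HasDerivWithinAt
      (fun y : ℝ => (ε ^ 2 * c * y) • (1 : Matrix (Fin m) (Fin m) ℝ)) ((ε ^ 2 * c) • 1)
      (Ici t) t :=
    (((hasDerivWithinAt_id t (Ici t)).const_mul (ε ^ 2 * c)).smul_const
      (1 : Matrix (Fin m) (Fin m) ℝ)).congr_deriv (by rw [mul_one])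
  exact ((hT.isPath.hasDerivWithinAt_Ici htm).fun_add
    (((hhat.mul hgrad).mul hhat).const_smul ε)).fun_add hlin

theorem exists_posSemidef_perturbPath_sub (hT : IsCutoff Q μ Φ T) (hβ : IsMixed β)
    (hQ : IsConstraint Q) (h : Fin m → ℝ) :
    ∃ c, ∀ ε ∈ Icc (0 : ℝ) (1 / 2), ∀ s t, 0 ≤ s → s ≤ t → t ≤ T →
      (perturbPath β h μ Φ c ε t - perturbPath β h μ Φ c ε s).PosSemidef := by
  have hDc := hT.isPath.continuousOn_pathDeriv.mono hT.Icc_subset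
  have hGc := hT.continuousOn_gradPath (h := h) hβ hQ
  have hD : ∀ y ∈ Icc 0 T, (pathDeriv Φ y).PosSemidef := fun y hy =>
    hT.isPath.posSemidef_pathDeriv (hT.Icc_subset hy)
  obtain ⟨c, hc⟩ := exists_forall_posSemidef_smul_one_sub isCompact_Icc
    (((hT.continuousOn_hatPath.fun_mul ((hGc.fun_mul hDc).fun_mul hGc)).fun_mul
      hT.continuousOn_hatPath).fun_const_smul (2 : ℝ)) fun y hy =>
    ((posSemidef_conj (posSemidef_conj (hD y hy) (hT.isHermitian_gradPath hβ hQ hy))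
      (hT.posDef_hatPath hy).isHermitian).isHermitian.smul (.all 2))
  refine ⟨c, fun ε hε s t hs hst ht => ?_⟩
  have hIcc : Icc s t ⊆ Icc 0 T := Icc_subset_Icc hs ht
  refine posSemidef_sub_of_hasDerivWithinAt hst
    ((hT.continuousOn_perturbPath hβ hQ c ε).mono hIcc)
    (fun y hy => hT.isHermitian_perturbPath hβ hQ c ε (hIcc hy))
    (fun y hy => hT.hasDerivWithinAt_perturbPath hβ hQ c ε
      ⟨hs.trans hy.1, hy.2.trans_le ht⟩) fun y hy => ?_
  have hy' : y ∈ Icc 0 T := hIcc (Ico_subset_Icc_self hy)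
  exact posSemidef_perturbation_deriv (hD y hy')
    ((hT.isPath.posSemidef_xiDeriv hβ hQ 2 (hT.Icc_subset hy')).hadamard (hD y hy'))
    (hT.isHermitian_gradPath hβ hQ hy') (hT.posDef_hatPath hy')
    ⟨orderParam_nonneg μ y, hT.isOrderMeasure.le_one y⟩ hε (hc y hy')

theorem posSemidef_perturbPath_zero (hT : IsCutoff Q μ Φ T) (hβ : IsMixed β)
    (hQ : IsConstraint Q) (c : ℝ) {ε : ℝ} (hε : 0 ≤ ε) :
    (perturbPath β h μ Φ c ε 0).PosSemidef := by
  rw [perturbPath, hT.isPath.zero, zero_add, mul_zero, zero_smul, add_zero]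
  exact (posSemidef_conj (hT.isPath.posSemidef_gradPath_zero hβ hQ)
    (hT.posDef_hatPath ⟨le_rfl, hT.pos.le⟩).isHermitian).smul hε

theorem eventually_posSemidef_sub_perturbPath (hT : IsCutoff Q μ Φ T) (hβ : IsMixed β)
    (hQ : IsConstraint Q) (h : Fin m → ℝ) (c : ℝ) :
    ∀ᶠ ε in nhds (0 : ℝ), (Q - perturbPath β h μ Φ c ε T).PosSemidef := by
  have hlim : Filter.Tendsto (fun ε : ℝ => ε • ascentPath β h μ Φ T +
      (ε ^ 2 * c * T) • (1 : Matrix (Fin m) (Fin m) ℝ)) (nhds 0) (nhds 0) :=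
    (by fun_prop : Continuous fun ε : ℝ => ε • ascentPath β h μ Φ T +
      (ε ^ 2 * c * T) • (1 : Matrix (Fin m) (Fin m) ℝ)).tendsto' _ _ (by simp)
  filter_upwards [eventually_posSemidef_sub hT.posDef hlim fun ε =>
    ((hT.isHermitian_ascentPath hβ hQ ⟨hT.pos.le, le_rfl⟩).smul (.all ε)).add
      (Matrix.isHermitian_one.smul (.all _))] with ε hε
  rwa [perturbPath, add_assoc, ← sub_sub]

end IsCutoff

end Perturbation

section Completion

variable {F : ℝ → Matrix (Fin m) (Fin m) ℝ} {t : ℝ}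

/-- The path `F` on `(0, T)`, completed by `0` on the left and by `Q` on the right. -/
noncomputable def completePath (Q : Matrix (Fin m) (Fin m) ℝ) (T : ℝ)
    (F : ℝ → Matrix (Fin m) (Fin m) ℝ) (t : ℝ) : Matrix (Fin m) (Fin m) ℝ :=
  if t ≤ 0 then 0 else if T ≤ t then Q else F t

theorem completePath_of_nonpos (ht : t ≤ 0) : completePath Q T F t = 0 := if_pos ht

theorem completePath_of_le (hT : 0 < T) (ht : T ≤ t) : completePath Q T F t = Q := by
  rw [completePath, if_neg (hT.trans_le ht).not_ge, if_pos ht]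

theorem completePath_of_mem_Ioo (ht : t ∈ Ioo 0 T) : completePath Q T F t = F t := by
  rw [completePath, if_neg ht.1.not_ge, if_neg ht.2.not_ge]

theorem posSemidef_completePath_sub (hT : 0 < T) (hF₀ : (F 0).PosSemidef)
    (hF : ∀ s t, 0 ≤ s → s ≤ t → t ≤ T → (F t - F s).PosSemidef) (hFT : (Q - F T).PosSemidef)
    {s : ℝ} (hst : s ≤ t) : (completePath Q T F t - completePath Q T F s).PosSemidef := by
  have hpos : ∀ y, 0 ≤ y → y ≤ T → (F y).PosSemidef := fun y hy hyT => by
    simpa using (hF 0 y le_rfl hy hyT).add hF₀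
  have hle : ∀ y, 0 ≤ y → y ≤ T → (Q - F y).PosSemidef := fun y hy hyT => by
    simpa using hFT.add (hF y T hy hyT le_rfl)
  rcases le_or_gt s 0 with hs | hs <;> rcases le_or_gt T t with hTt | htT
  · rw [completePath_of_nonpos hs, completePath_of_le hT hTt, sub_zero]
    simpa using (hle T hT.le le_rfl).add (hpos T hT.le le_rfl)
  · rw [completePath_of_nonpos hs, sub_zero]
    rcases le_or_gt t 0 with ht | ht
    · rw [completePath_of_nonpos ht]
      exact Matrix.PosSemidef.zero
    · rw [completePath_of_mem_Ioo ⟨ht, htT⟩]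
      exact hpos t ht.le htT.le
  · rw [completePath_of_le hT hTt]
    rcases le_or_gt T s with hTs | hsT
    · rw [completePath_of_le hT hTs, sub_self]
      exact Matrix.PosSemidef.zero
    · rw [completePath_of_mem_Ioo ⟨hs, hsT⟩]
      exact hle s hs.le hsT.le
  · rw [completePath_of_mem_Ioo ⟨hs, hst.trans_lt htT⟩,
      completePath_of_mem_Ioo ⟨hs.trans_le hst, htT⟩]
    exact hF s t hs.le hst htT.le

theorem isJumpPath_completePath (hT : 0 < T) (hF₀ : (F 0).PosSemidef)
    (hF : ∀ s t, 0 ≤ s → s ≤ t → t ≤ T → (F t - F s).PosSemidef) (hFT : (Q - F T).PosSemidef)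
    (hFc : ContinuousOn F (Ioo 0 T)) : IsJumpPath Q (completePath Q T F) T where
  monotone _ _ hst := posSemidef_completePath_sub hT hF₀ hF hFT hst
  zero _ ht := completePath_of_nonpos ht
  top _ ht := completePath_of_le hT ht
  continuousAt _ ht := (hFc.continuousAt (isOpen_Ioo.mem_nhds ht)).congr
    (Filter.eventuallyEq_of_mem (isOpen_Ioo.mem_nhds ht)
      fun _ hy => (completePath_of_mem_Ioo hy).symm)

end Completion

section Stationarity

theorem IsCutoff.integral_frob_completePath_sub (hT : IsCutoff Q μ Φ T) (hβ : IsMixed β)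
    (hQ : IsConstraint Q) (c ε : ℝ) :
    ∫ t, frob (gradPath β h μ Φ t) (completePath Q T (perturbPath β h μ Φ c ε) t - Φ t) ∂μ =
      ε * ((∫ t, frob (gradPath β h μ Φ t) (ascentPath β h μ Φ t) ∂μ) +
        ε * ∫ t, c * t * frob (gradPath β h μ Φ t) 1 ∂μ) := by
  have hGc := hT.continuousOn_gradPath (h := h) hβ hQ
  have hone := hT.isOrderMeasure.orderParam_eq_one hT.topPoint_lt le_rfl
  have hint := hT.isOrderMeasure.integrable_of_continuousOn hone
    (continuousOn_frob hGc (hT.continuousOn_ascentPath (h := h) hβ hQ))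
  have hint' := hT.isOrderMeasure.integrable_of_continuousOn hone
    (f := fun t => c * t * frob (gradPath β h μ Φ t) 1)
    ((by fun_prop : ContinuousOn (fun t => c * t) (Icc 0 T)).mul
      (continuousOn_frob hGc continuousOn_const))
  rw [← integral_const_mul ε (fun t => c * t * frob (gradPath β h μ Φ t) 1),
    ← integral_add hint (hint'.const_mul ε), ← integral_const_mul]
  refine integral_congr_ae ?_
  filter_upwards [hT.isOrderMeasure.ae_mem_Ioo hT.topPoint_lt] with t ht
  rw [completePath_of_mem_Ioo ht, perturbPath, add_assoc, add_sub_cancel_left, frob_add_right,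
    frob_smul_right, frob_smul_right]
  ring

theorem IsMinimizer.integral_frob_ascentPath_nonpos (hmin : IsMinimizer β h Q μ Φ)
    (hT : IsCutoff Q μ Φ T) (hβ : IsMixed β) (hQ : IsConstraint Q) :
    ∫ t, frob (gradPath β h μ Φ t) (ascentPath β h μ Φ t) ∂μ ≤ 0 := by
  obtain ⟨c, hc⟩ := hT.exists_posSemidef_perturbPath_sub hβ hQ h
  set I := ∫ t, frob (gradPath β h μ Φ t) (ascentPath β h μ Φ t) ∂μ
  set J := ∫ t, c * t * frob (gradPath β h μ Φ t) 1 ∂μ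
  have hlim : Filter.Tendsto (fun ε : ℝ => I + ε * J) (nhdsWithin 0 (Ioi 0)) (nhds I) :=
    ((by fun_prop : Continuous fun ε : ℝ => I + ε * J).tendsto' 0 I (by simp)).mono_left
      nhdsWithin_le_nhds
  refine le_of_tendsto hlim ?_
  filter_upwards [Ioo_mem_nhdsGT (by norm_num : (0 : ℝ) < 1 / 2),
    nhdsWithin_le_nhds (hT.eventually_posSemidef_sub_perturbPath hβ hQ h c)] with ε hε hεT
  have hjump : IsJumpPath Q (completePath Q T (perturbPath β h μ Φ c ε)) T :=
    isJumpPath_completePath hT.pos (hT.posSemidef_perturbPath_zero hβ hQ c hε.1.le)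
      (hc ε ⟨hε.1.le, hε.2.le⟩) hεT
      ((hT.continuousOn_perturbPath hβ hQ c ε).mono Ioo_subset_Icc_self)
  have hvar := hmin.integral_frob_gradPath_sub_nonpos_of_isJumpPath hT hβ hQ hjump
  rw [hT.integral_frob_completePath_sub hβ hQ] at hvar
  exact nonpos_of_mul_nonpos_right hvar hε.1

theorem IsMinimizer.gradPath_eq_zero (hmin : IsMinimizer β h Q μ Φ) (hT : IsCutoff Q μ Φ T)
    (hβ : IsMixed β) (hQ : IsConstraint Q) {u : ℝ} (hu : u ∈ μ.support) :
    gradPath β h μ Φ u = 0 := by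
  set f : ℝ → ℝ := fun t => frob (gradPath β h μ Φ t) (ascentPath β h μ Φ t)
  have hfc : ContinuousOn f (Icc 0 T) :=
    continuousOn_frob (hT.continuousOn_gradPath hβ hQ) (hT.continuousOn_ascentPath hβ hQ)
  have hone := hT.isOrderMeasure.orderParam_eq_one hT.topPoint_lt le_rfl
  have hmem := hT.isOrderMeasure.ae_mem_Icc hone
  have hnonneg : 0 ≤ᵐ[μ] f := hmem.mono fun t ht =>
    frob_conj_self_nonneg (hT.posDef_hatPath ht).posSemidef
  have hzero : f =ᵐ[μ] 0 := (integral_eq_zero_iff_of_nonneg_ae hnonneg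
    (hT.isOrderMeasure.integrable_of_continuousOn hone hfc)).1
    (le_antisymm (hmin.integral_frob_ascentPath_nonpos hT hβ hQ) (integral_nonneg_of_ae hnonneg))
  have hclosed : IsClosed (Icc 0 T ∩ f ⁻¹' {0}) :=
    hfc.preimage_isClosed_of_isClosed isClosed_Icc isClosed_singleton
  obtain ⟨huT, hfu⟩ := Measure.support_subset_of_isClosed hclosed (hmem.and hzero) hu
  exact eq_zero_of_frob_conj_self (hT.posDef_hatPath huT) hfu

end Stationarity

end EulerLagrange

/-! ### Derivatives of the stationarity equation -/

variable {m : ℕ} {μ : Measure ℝ} {Q : Matrix (Fin m) (Fin m) ℝ}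
  {Φ : ℝ → Matrix (Fin m) (Fin m) ℝ} {β : ℕ → Fin m → ℝ} {h : Fin m → ℝ} {T u : ℝ}

theorem IsAdmissible.nonempty_cutoffs (hadm : IsAdmissible Q μ Φ) : (cutoffs μ Φ).Nonempty := by
  have hcont : ContinuousWithinAt (fun t => (Q - Φ t).det) (Icc (0 : ℝ) m) (topPoint m μ) :=
    (continuous_id.matrix_det.comp_continuousOn (continuousOn_const.fun_sub
      hadm.isPath.continuousOn)) _ ⟨topPoint_nonneg m μ, hadm.topPoint_lt.le⟩
  have hright : Icc (0 : ℝ) m ∈ nhdsWithin (topPoint m μ) (Ioi (topPoint m μ)) :=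
    Filter.mem_of_superset (Ioo_mem_nhdsGT hadm.topPoint_lt)
      (Ioo_subset_Icc_self.trans (Icc_subset_Icc_left (topPoint_nonneg m μ)))
  obtain ⟨T, hdet, hT⟩ := (((hcont.mono_of_mem_nhdsWithin hright).eventually
    (lt_mem_nhds hadm.det_pos)).and (Ioo_mem_nhdsGT hadm.topPoint_lt)).exists
  exact ⟨T, hT.1, hT.2, hadm.isPath.top.symm ▸ hdet⟩

theorem IsMinimizer.exists_isCutoff (hmin : IsMinimizer β h Q μ Φ) : ∃ T, IsCutoff Q μ Φ T :=
  hmin.1.nonempty_cutoffs.imp fun _ => hmin.isCutoff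

theorem IsCutoff.support_subset (hT : IsCutoff Q μ Φ T) : μ.support ⊆ Ico 0 T := fun _ hs =>
  ⟨(hT.isOrderMeasure.support_subset hs).1,
    (hT.isOrderMeasure.support_subset hs).2.trans_lt hT.topPoint_lt⟩

theorem IsPath.trace_pathDeriv_eq_one (hΦ : IsPath Q μ Φ) (hμ : IsOrderMeasure m μ)
    (htop : topPoint m μ ≤ m) (hu : u ∈ interior μ.support) : (pathDeriv Φ u).trace = 1 := by
  have hsub : interior μ.support ⊆ Icc (0 : ℝ) m := interior_subset.trans
    (hμ.support_subset.trans (Icc_subset_Icc_right htop))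
  exact (isOpen_interior.uniqueDiffWithinAt hu).eq_deriv _
    (hasDerivWithinAt_trace ((hΦ.hasDerivWithinAt (hsub hu)).mono hsub))
    ((hasDerivWithinAt_id u _).congr (fun s hs => hΦ.trace_eq s (interior_subset hs))
      (hΦ.trace_eq u (interior_subset hu)))

theorem IsMinimizer.xiDeriv_two_hadamard_pathDeriv (hmin : IsMinimizer β h Q μ Φ)
    (hT : IsCutoff Q μ Φ T) (hβ : IsMixed β) (hQ : IsConstraint Q)
    (hu : u ∈ interior μ.support) :
    xiDeriv β 2 (Φ u) ⊙ pathDeriv Φ u =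
      (hatPath μ Φ u)⁻¹ * pathDeriv Φ u * (hatPath μ Φ u)⁻¹ := by
  have hsub : interior μ.support ⊆ Icc 0 T :=
    interior_subset.trans (hT.support_subset.trans Ico_subset_Icc_self)
  have hzero : ∀ s ∈ interior μ.support, gradPath β h μ Φ s = 0 := fun s hs =>
    hmin.gradPath_eq_zero hT hβ hQ (interior_subset hs)
  exact sub_eq_zero.1 ((isOpen_interior.uniqueDiffWithinAt hu).eq_deriv _
    ((hT.hasDerivWithinAt_gradPath hβ hQ (hsub hu)).mono hsub)
    ((hasDerivWithinAt_const u _ 0).congr hzero (hzero u hu)))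

theorem frob_deriv_eq_zero {D W : ℝ → Matrix (Fin m) (Fin m) ℝ} {W' : Matrix (Fin m) (Fin m) ℝ}
    (hD : ContinuousWithinAt D (Ioi u) u) (hW : HasDerivWithinAt W W' (Ioi u) u) (hWu : W u = 0)
    (hDW : ∀ᶠ t in nhdsWithin u (Ioi u), frob (D t) (W t) = 0) : frob (D u) W' = 0 := by
  have hslope := (hasDerivWithinAt_iff_tendsto_slope' self_notMem_Ioi).1 hW
  have hlim : Filter.Tendsto (fun t => frob (D t) (slope W u t)) (nhdsWithin u (Ioi u))
      (nhds (frob (D u) W')) :=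
    tendsto_finsetSum _ fun i _ => tendsto_finsetSum _ fun j _ =>
      (tendsto_pi_nhds.1 (tendsto_pi_nhds.1 hD i) j).mul
        (tendsto_pi_nhds.1 (tendsto_pi_nhds.1 hslope i) j)
  refine tendsto_nhds_unique hlim (tendsto_const_nhds.congr' (hDW.mono fun t ht => ?_))
  change 0 = frob (D t) (slope W u t)
  rw [slope_def_module, hWu, sub_zero, frob_smul_right, ht, mul_zero]

theorem IsCutoff.hasDerivWithinAt_inv_mul_mul_inv_sub_hadamard (hT : IsCutoff Q μ Φ T)
    (hβ : IsMixed β) (hQ : IsConstraint Q) (hu : u ∈ Ico 0 T) (M : Matrix (Fin m) (Fin m) ℝ) :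
    HasDerivWithinAt (fun t => (hatPath μ Φ t)⁻¹ * M * (hatPath μ Φ t)⁻¹ - xiDeriv β 2 (Φ t) ⊙ M)
      (orderParam μ u • ((hatPath μ Φ u)⁻¹ * pathDeriv Φ u * (hatPath μ Φ u)⁻¹ * M *
          (hatPath μ Φ u)⁻¹ +
        (hatPath μ Φ u)⁻¹ * M * ((hatPath μ Φ u)⁻¹ * pathDeriv Φ u * (hatPath μ Φ u)⁻¹)) -
        (xiDeriv β 3 (Φ u) ⊙ pathDeriv Φ u) ⊙ M) (Ici u) u := by
  have hum : u ∈ Ico (0 : ℝ) m := ⟨hu.1, hu.2.trans hT.lt⟩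
  have hinv := hT.hasDerivWithinAt_inv_hatPath hu
  have hxi : HasDerivWithinAt (fun t => xiDeriv β 2 (Φ t) ⊙ M)
      ((xiDeriv β 3 (Φ u) ⊙ pathDeriv Φ u) ⊙ M) (Ici u) u :=
    hasDerivWithinAt_matrix_iff.2 fun i j =>
      (hasDerivWithinAt_matrix_iff.1 ((hT.isPath.hasDerivWithinAt_xiDeriv hβ hQ 2
        ⟨hum.1, hum.2.le⟩).mono_of_mem_nhdsWithin (Filter.mem_of_superset
          (Icc_mem_nhdsGE hum.2) (Icc_subset_Icc_left hum.1))) i j).mul_const (M i j)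
  refine (((hinv.mul_const M).mul hinv).fun_sub hxi).congr_deriv ?_
  simp only [smul_mul_assoc, mul_smul_comm, smul_add]

theorem IsMinimizer.frob_pathDeriv_inv_mul_mul_inv_sub_hadamard (hmin : IsMinimizer β h Q μ Φ)
    (hT : IsCutoff Q μ Φ T) (hβ : IsMixed β) (hQ : IsConstraint Q)
    (hu : u ∈ interior μ.support) (M : Matrix (Fin m) (Fin m) ℝ) :
    frob (pathDeriv Φ u)
      ((hatPath μ Φ u)⁻¹ * M * (hatPath μ Φ u)⁻¹ - xiDeriv β 2 (Φ u) ⊙ M) = 0 := by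
  have hP : ((hatPath μ Φ u)⁻¹).IsHermitian := (hT.posDef_hatPath
    (Ico_subset_Icc_self (hT.support_subset (interior_subset hu)))).inv.isHermitian
  rw [frob_sub_right, ← frob_conj hP, ← hmin.xiDeriv_two_hadamard_pathDeriv hT hβ hQ hu,
    frob_hadamard_right, frob_comm, sub_self]

theorem frob_hadamard_hadamard_self (A D : Matrix (Fin m) (Fin m) ℝ) :
    frob D ((A ⊙ D) ⊙ D) = frob A (D.map fun y => y ^ 3) := by
  simp only [frob, Matrix.hadamard_apply, Matrix.map_apply]
  exact Finset.sum_congr rfl fun i _ => Finset.sum_congr rfl fun j _ => by ring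

theorem IsMinimizer.frob_xiDeriv_three (hmin : IsMinimizer β h Q μ Φ) (hT : IsCutoff Q μ Φ T)
    (hβ : IsMixed β) (hQ : IsConstraint Q) (hu : u ∈ interior μ.support) :
    frob (xiDeriv β 3 (Φ u)) ((pathDeriv Φ u).map fun y => y ^ 3) =
      2 * orderParam μ u * ((hatPath μ Φ u)⁻¹ * pathDeriv Φ u * (hatPath μ Φ u)⁻¹ *
        pathDeriv Φ u * (hatPath μ Φ u)⁻¹ * pathDeriv Φ u).trace := by
  have huT : u ∈ Ico 0 T := hT.support_subset (interior_subset hu)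
  have hDh := (hT.isPath.posSemidef_pathDeriv
    (hT.Icc_subset (Ico_subset_Icc_self huT))).isHermitian
  have hDc : ContinuousWithinAt (pathDeriv Φ) (Ioi u) u :=
    ((hT.isPath.continuousOn_pathDeriv.mono hT.Icc_subset) u
      (Ico_subset_Icc_self huT)).mono_of_mem_nhdsWithin
      (Filter.mem_of_superset (Ioo_mem_nhdsGT huT.2)
        (Ioo_subset_Icc_self.trans (Icc_subset_Icc_left huT.1)))
  have key := frob_deriv_eq_zero hDc
    ((hT.hasDerivWithinAt_inv_mul_mul_inv_sub_hadamard hβ hQ huT (pathDeriv Φ u)).mono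
      Ioi_subset_Ici_self)
    (sub_eq_zero.2 (hmin.xiDeriv_two_hadamard_pathDeriv hT hβ hQ hu).symm)
    (nhdsWithin_le_nhds (Filter.mem_of_superset (isOpen_interior.mem_nhds hu) fun t ht =>
      hmin.frob_pathDeriv_inv_mul_mul_inv_sub_hadamard hT hβ hQ ht (pathDeriv Φ u)))
  rw [frob_sub_right, frob_hadamard_hadamard_self, sub_eq_zero] at key
  rw [← key, frob_eq_trace, transpose_eq hDh, Matrix.trace_mul_comm]
  simp only [← mul_assoc, add_mul, smul_mul_assoc, Matrix.trace_add, Matrix.trace_smul, smul_eq_mul]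
  ring

end VectorSpin

theorem mainTheorem8_general {m : ℕ} {β : ℕ → Fin m → ℝ} (hβ : VectorSpin.IsMixed β)
    {h : Fin m → ℝ} {Q : Matrix (Fin m) (Fin m) ℝ} (hQ : VectorSpin.IsConstraint Q)
    {μ : Measure ℝ} {Φ : ℝ → Matrix (Fin m) (Fin m) ℝ}
    (hmin : VectorSpin.IsMinimizer β h Q μ Φ) {u : ℝ} (hu : u ∈ interior μ.support) :
    0 < (VectorSpin.threeHalves β (Φ u) (VectorSpin.pathDeriv Φ u)).trace ∧
    μ.real (Icc 0 u) =
      VectorSpin.frob (VectorSpin.xiDeriv β 3 (Φ u))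
          ((VectorSpin.pathDeriv Φ u).map fun y => y ^ 3) /
        (2 * (VectorSpin.threeHalves β (Φ u) (VectorSpin.pathDeriv Φ u)).trace) := by
  obtain ⟨T, hT⟩ := hmin.exists_isCutoff
  have huT : u ∈ Icc 0 T := Ico_subset_Icc_self (hT.support_subset (interior_subset hu))
  have hD := hT.isPath.posSemidef_pathDeriv (hT.Icc_subset huT)
  have hP := (hT.posDef_hatPath huT).inv
  have htrace : (VectorSpin.pathDeriv Φ u).trace = 1 :=
    hmin.1.isPath.trace_pathDeriv_eq_one hT.isOrderMeasure hmin.1.topPoint_lt.le hu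
  have hD0 : VectorSpin.pathDeriv Φ u ≠ 0 := fun h0 => by
    rw [h0, Matrix.trace_zero] at htrace
    exact zero_ne_one htrace
  rw [VectorSpin.threeHalves, hmin.xiDeriv_two_hadamard_pathDeriv hT hβ hQ hu]
  have hpos := VectorSpin.trace_psdPow_three_halves_conj_pos hD hP hD0
  refine ⟨hpos, (eq_div_iff (mul_pos two_pos hpos).ne').2 ?_⟩
  rw [VectorSpin.trace_psdPow_three_halves_conj hD hP.posSemidef,
    hmin.frob_xiDeriv_three hT hβ hQ hu, VectorSpin.orderParam]
  ring

theorem mainTheorem8 (m : ℕ) (β : ℕ → Fin m → ℝ) (hβ : VectorSpin.IsMixedEven β)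
    (h : Fin m → ℝ) (Q : Matrix (Fin m) (Fin m) ℝ) (hQ : VectorSpin.IsConstraint Q)
    (μ : Measure ℝ) (Φ : ℝ → Matrix (Fin m) (Fin m) ℝ)
    (hmin : VectorSpin.IsMinimizer β h Q μ Φ)
    (a b : ℝ) (ha : 0 ≤ a) (hab : a < b) (hb : b < m) (hsupp : Ioo a b ⊆ μ.support)
    (u : ℝ) (hu : u ∈ Ioo a b) :
    0 < (VectorSpin.threeHalves β (Φ u) (VectorSpin.pathDeriv Φ u)).trace ∧
    μ.real (Icc 0 u) =
      VectorSpin.frob (VectorSpin.xiDeriv β 3 (Φ u))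
          ((VectorSpin.pathDeriv Φ u).map fun y => y ^ 3) /
        (2 * (VectorSpin.threeHalves β (Φ u) (VectorSpin.pathDeriv Φ u)).trace) :=
  mainTheorem8_general hβ.isMixed hQ hmin (interior_maximal hsupp isOpen_Ioo hu)
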